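/- Let $\Bbbk$ be a field. For a composition $\alpha=(a_1,\dots,a_k)$ (a finite, possibly empty, sequence of positive integers) write $|\alpha|=\sum a_i$, $k(\alpha)=k$, and for $1\le i\le k$ write $\alpha_i=(a_1,\dots,a_{i-1})$ and $\alpha^i=(a_{i+1},\dots,a_k)$; let $\alpha\vDash n$ mean $|\alpha|=n$. **Notions.** For a graded connected Hopf algebra $H$ over $\Bbbk$ with a character $\zeta$, put $\bar\zeta(h)=(-1)^n\zeta(h)$ for $h\in H_n$, $\zeta^{-1}=\zeta\circ S$ ($S$ the antipode), and $\chi=\bar\zeta\zeta$ (convolution product). The odd subalgebra $S_-(H,\zeta)$ is the largest graded subcoalgebra of $H$ on which $\bar\zeta=\zeta^{-1}$. For homogeneous $h$, the generalized Dehn–Sommerville relations are either of $$(\mathrm{id}\otimes(\bar\zeta-\zeta^{-1})\otimes\mathrm{id})\circ\Delta^{(2)}(h)=0,\qquad(\mathrm{id}\otimes(\chi-\epsilon)\otimes\mathrm{id})\circ\Delta^{(2)}(h)=0 .$$ $\mathcal{Q}Sym$ is the Hopf algebra of quasi-symmetric functions over $\Bbbk$ with monomial basis $M_\alpha$, coproduct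 $\Delta(M_\alpha)=\sum_{\alpha=\beta\gamma}M_\beta\otimes M_\gamma$, and character $\zeta_{\mathcal Q}(M_\alpha)=1$ if $k(\alpha)\le1$ and $0$ otherwise. A finite poset is graded if it has a minimum $0_P$ and a maximum $1_P$ and all its maximal chains have the same length, which is its rank. $\mathcal R$ is Rota's Hopf algebra: its basis consists of the isomorphism classes of finite graded posets, graded by rank, with product $P\cdot Q=P\times Q$, coproduct $\Delta(P)=\sum_{z\in P}[0_P,z]\otimes[z,1_P]$ and character $\zeta(P)=1$. A graded poset $P$ is eulerian if $\mu(x,y)=(-1)^{\mathrm{rank}[x,y]}$ for all $x<y$ in $P$; $\mathcal E\subseteq\mathcal R$ is the span of the eulerian posets. For $\alpha=(a_1,\dots,a_k)$ the flag $f$-vector entry $f_\alpha(P)$ is the number of chains $0_P=z_0<\dots<z_k=1_P$ with $\mathrm{rank}[z_{i-1},z_i]=a_i$ for all $i$. **Statement.** 1. For every composition $\beta$, $$(\bar\zeta_{\mathcal Q}-\zeta_{\mathcal Q}^{-1})(M_\beta)=\begin{cases}0&\beta=()\\(-1)^n+1&\beta=(n)\\-(-1)^{k(\beta)}&\text{otherwise,}\end{cases}\qquad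 (\chi_{\mathcal Q}-\epsilon)(M_\beta)=\begin{cases}1+(-1)^n&\beta=(n)\\(-1)^i&\beta=(i,j)\\0&\text{otherwise.}\end{cases}$$ 2. Let $h=\sum_{\gamma\vDash n}f_\gamma(h)M_\gamma\in\mathcal{Q}Sym_n$, and for $\alpha=(a_1,\dots,a_k)\vDash n$ and $1\le i\le k$ put $$E_{\alpha,i}(h)=(-1)^{a_i}f_\alpha(h)-\sum_{\beta\vDash a_i}(-1)^{k(\beta)}f_{\alpha\circ_i\beta}(h),\qquad B_{\alpha,i}(h)=\sum_{j=0}^{a_i}(-1)^jf_{(a_1,\dots,a_{i-1},\,j,\,a_i-j,\,a_{i+1},\dots,a_k)}(h),$$ where $\alpha\circ_i\beta$ is $\alpha$ with its $i$-th part replaced by the parts of $\beta$, and zero parts are omitted. Then $$(\mathrm{id}\otimes(\bar\zeta_{\mathcal Q}-\zeta_{\mathcal Q}^{-1})\otimes\mathrm{id})\Delta^{(2)}(h)=\sum_{\alpha\vDash n}\sum_{i=1}^{k(\alpha)}E_{\alpha,i}(h)\,M_{\alpha_i}\otimes M_{\alpha^i},\qquad (\mathrm{id}\otimes(\chi_{\mathcal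 Q}-\epsilon)\otimes\mathrm{id})\Delta^{(2)}(h)=\sum_{\alpha\vDash n}\sum_{i=1}^{k(\alpha)}B_{\alpha,i}(h)\,M_{\alpha_i}\otimes M_{\alpha^i},$$ and the following are equivalent: (a) $h\in S_-(\mathcal{Q}Sym,\zeta_{\mathcal Q})$; (b) $h$ satisfies the first form of the generalized Dehn–Sommerville relations; (c) $h$ satisfies the second form; (d) $E_{\alpha,i}(h)=0$ for all $\alpha\vDash n$ and all $i$; (e) $h$ satisfies the Bayer–Billera relations $B_{\alpha,i}(h)=0$ for all $\alpha\vDash n$ and all $i$. 3. $\mathcal E\subseteq S_-(\mathcal R,\zeta)$. 4. There is a unique morphism of graded Hopf algebras $\Psi:\mathcal R\to\mathcal{Q}Sym$ with $\zeta_{\mathcal Q}\circ\Psi=\zeta$. It is given by $\Psi(P)=\sum_{\alpha\vDash\mathrm{rank}(P)}f_\alpha(P)M_\alpha$, and it satisfies $\Psi(S_-(\mathcal R,\zeta))\subseteq S_-(\mathcal{Q}Sym,\zeta_{\mathcal Q})$ and $\Psi(\mathcal E)\subseteq S_-(\mathcal{Q}Sym,\zeta_{\mathcal Q})$. 5. For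 every eulerian poset $P$, every $\alpha=(a_1,\dots,a_k)\vDash\mathrm{rank}(P)$ and every $1\le i\le k$, $$\sum_{j=0}^{a_i}(-1)^jf_{(a_1,\dots,a_{i-1},\,j,\,a_i-j,\,a_{i+1},\dots,a_k)}(P)=0\quad\text{in }\mathbb Z .$$ -/

import Mathlib

/-- All maximal chains have the same length (number of elements minus one). -/
def MaxChainsSameLength (α : Type*) [LE α] : Prop :=
  ∀ s t : Set α, IsMaxChain (· ≤ ·) s → IsMaxChain (· ≤ ·) t → s.ncard = t.ncard

/-- The length of a maximal chain (any one: used where all have the same length). -/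
noncomputable def posetRank (α : Type*) [LE α] : ℕ :=
  (maxChain (α := α) (· ≤ ·)).ncard - 1

/-- Auxiliary: a rank function, normalized to be `0` at the bottom. -/
structure IsRankFun {α : Type*} [PartialOrder α] [OrderBot α] (r : α → ℕ) : Prop where
  bot : r ⊥ = 0
  strictMono : StrictMono r
  covBy : ∀ x y, x ⋖ y → r y = r x + 1

section PosetLemmas

variable {α : Type*} [PartialOrder α]

theorem isMaxChain_iff_mem {s : Set α} :
    IsMaxChain (· ≤ ·) s ↔ IsChain (· ≤ ·) s ∧ ∀ a, (∀ b ∈ s, a ≤ b ∨ b ≤ a) → a ∈ s := by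
  constructor
  · intro h
    refine ⟨h.1, fun a ha => ?_⟩
    have := h.2 (h.1.insert (a := a) (fun b hb _ => ha b hb)) (Set.subset_insert _ _)
    rw [this]; exact Set.mem_insert _ _
  · rintro ⟨h1, h2⟩
    refine ⟨h1, fun t ht hst => hst.antisymm fun a ha => h2 a fun b hb => ht.total ha (hst hb)⟩

theorem IsMaxChain.glue {s t : Set α} (hs : IsMaxChain (· ≤ ·) s) (ht : IsMaxChain (· ≤ ·) t)
    {x : α} (hxs : x ∈ s) (hxt : x ∈ t) :
    IsMaxChain (· ≤ ·) ((s ∩ Set.Iic x) ∪ (t ∩ Set.Ici x)) := by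
  rw [isMaxChain_iff_mem] at *
  constructor
  · rintro a (⟨ha, hax⟩ | ⟨ha, hax⟩) b (⟨hb, hbx⟩ | ⟨hb, hbx⟩) hab
    · exact hs.1 ha hb hab
    · exact Or.inl (le_trans hax hbx)
    · exact Or.inr (le_trans hbx hax)
    · exact ht.1 ha hb hab
  · intro a ha
    rcases ha x (Or.inl ⟨hxs, le_rfl⟩) with hax | hax
    · left
      refine ⟨hs.2 a fun b hb => ?_, hax⟩
      rcases hs.1.total hb hxs with h | h
      · exact ha b (Or.inl ⟨hb, h⟩)
      · exact Or.inl (le_trans hax h)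
    · right
      refine ⟨ht.2 a fun b hb => ?_, hax⟩
      rcases ht.1.total hb hxt with h | h
      · exact Or.inr (le_trans h hax)
      · exact ha b (Or.inr ⟨hb, h⟩)

theorem ncard_glue [Finite α] {s t : Set α} {x : α} (hxs : x ∈ s) (hxt : x ∈ t) :
    ((s ∩ Set.Iic x) ∪ (t ∩ Set.Ici x)).ncard + 1
      = (s ∩ Set.Iic x).ncard + (t ∩ Set.Ici x).ncard := by
  have h := Set.ncard_union_add_ncard_inter (s ∩ Set.Iic x) (t ∩ Set.Ici x)
  have h2 : (s ∩ Set.Iic x) ∩ (t ∩ Set.Ici x) = {x} := by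
    ext a
    simp only [Set.mem_inter_iff, Set.mem_Iic, Set.mem_Ici, Set.mem_singleton_iff]
    constructor
    · rintro ⟨⟨_, h1⟩, _, h2⟩; exact le_antisymm h1 h2
    · rintro rfl; exact ⟨⟨hxs, le_rfl⟩, hxt, le_rfl⟩
  rw [h2, Set.ncard_singleton] at h
  exact h

theorem exists_isMaxChain_mem_pair {x y : α} (h : x ≤ y) :
    ∃ s : Set α, IsMaxChain (· ≤ ·) s ∧ x ∈ s ∧ y ∈ s := by
  obtain ⟨s, hsub⟩ := (IsChain.pair (r := (· ≤ ·)) h).exists_subset_flag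
  exact ⟨s, s.maxChain, hsub (by simp), hsub (by simp)⟩

theorem MaxChainsSameLength.ncard_inter_Iic [Finite α] (h : MaxChainsSameLength α)
    {s t : Set α} (hs : IsMaxChain (· ≤ ·) s) (ht : IsMaxChain (· ≤ ·) t) {x : α}
    (hxs : x ∈ s) (hxt : x ∈ t) : (s ∩ Set.Iic x).ncard = (t ∩ Set.Iic x).ncard := by
  have h1 := h _ _ (hs.glue ht hxs hxt) (ht.glue ht hxt hxt)
  have h2 := ncard_glue hxs hxt
  have h3 := ncard_glue hxt hxt
  omega

theorem MaxChainsSameLength.exists_isRankFun [Finite α] [OrderBot α]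
    (h : MaxChainsSameLength α) : ∃ r : α → ℕ, IsRankFun r := by
  choose c hc using fun x : α => exists_isMaxChain_mem_pair (le_refl x)
  have key : ∀ (x : α) (s : Set α), IsMaxChain (· ≤ ·) s → x ∈ s →
      (c x ∩ Set.Iic x).ncard = (s ∩ Set.Iic x).ncard := fun x s hs hx =>
    h.ncard_inter_Iic (hc x).1 hs (hc x).2.1 hx
  have hpos : ∀ x, 0 < (c x ∩ Set.Iic x).ncard := fun x =>
    (Set.ncard_pos (Set.toFinite _)).2 ⟨x, (hc x).2.1, le_rfl⟩
  refine ⟨fun x => (c x ∩ Set.Iic x).ncard - 1, ?_, ?_, ?_⟩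
  · have : c ⊥ ∩ Set.Iic ⊥ = {⊥} := by
      ext a; simp only [Set.Iic_bot, Set.mem_inter_iff, Set.mem_singleton_iff]
      exact ⟨fun h => h.2, fun h => ⟨h ▸ (hc ⊥).2.1, h⟩⟩
    simp only [this, Set.ncard_singleton]
  · intro x y hxy
    obtain ⟨s, hs, hx, hy⟩ := exists_isMaxChain_mem_pair hxy.le
    have h1 := key x s hs hx
    have h2 := key y s hs hy
    have h3 : (s ∩ Set.Iic x).ncard < (s ∩ Set.Iic y).ncard := by
      apply Set.ncard_lt_ncard _ (Set.toFinite _)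
      refine ⟨fun a ha => ⟨ha.1, le_trans ha.2 hxy.le⟩, fun hh => ?_⟩
      exact absurd (hh ⟨hy, le_rfl⟩).2 (not_le_of_gt hxy)
    have := hpos x
    show (c x ∩ Set.Iic x).ncard - 1 < (c y ∩ Set.Iic y).ncard - 1
    omega
  · intro x y hxy
    obtain ⟨s, hs, hx, hy⟩ := exists_isMaxChain_mem_pair hxy.le
    have h1 := key x s hs hx
    have h2 := key y s hs hy
    have h3 : s ∩ Set.Iic y = insert y (s ∩ Set.Iic x) := by
      ext a
      simp only [Set.mem_inter_iff, Set.mem_Iic, Set.mem_insert_iff]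
      constructor
      · rintro ⟨has, hay⟩
        rcases hs.1.total has hx with hax | hxa
        · exact Or.inr ⟨has, hax⟩
        · rcases hxy.eq_or_eq hxa hay with h | h
          · exact Or.inr ⟨has, h.le⟩
          · exact Or.inl h
      · rintro (rfl | ⟨h, h'⟩)
        · exact ⟨hy, le_rfl⟩
        · exact ⟨h, h'.trans hxy.le⟩
    have h4 : (s ∩ Set.Iic y).ncard = (s ∩ Set.Iic x).ncard + 1 := by
      rw [h3, Set.ncard_insert_of_notMem]
      exact fun hh => not_le_of_gt hxy.lt hh.2
    have := hpos x
    omega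

theorem IsRankFun.ncard_of_isMaxChain [Finite α] [BoundedOrder α] {r : α → ℕ} (hr : IsRankFun r)
    {s : Set α} (hs : IsMaxChain (· ≤ ·) s) : s.ncard = r ⊤ + 1 := by
  have him : r '' s = Set.Iic (r ⊤) := by
    ext n
    constructor
    · rintro ⟨x, _, rfl⟩; exact hr.strictMono.monotone le_top
    · intro hn
      induction n with
      | zero => exact ⟨⊥, hs.bot_mem, hr.bot⟩
      | succ n ih =>
        obtain ⟨x, hxs, hx⟩ := ih (Nat.le_of_succ_le hn)
        have hxt : x < ⊤ := lt_of_le_of_ne le_top (by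
          rintro rfl
          have : n + 1 ≤ r ⊤ := hn
          omega)
        obtain ⟨y, hy⟩ := (Set.toFinite (s ∩ Set.Ioi x)).exists_minimal ⟨⊤, hs.top_mem, hxt⟩
        have hcov : x ⋖ y := by
          refine ⟨hy.1.2, fun z hxz hzy => ?_⟩
          have hz : z ∈ s := by
            apply (isMaxChain_iff_mem.1 hs).2
            intro b hb
            rcases hs.1.total hb hxs with h | h
            · exact Or.inr (h.trans hxz.le)
            · rcases h.eq_or_lt with rfl | h
              · exact Or.inr hxz.le
              · rcases hs.1.total hb hy.1.1 with h' | h'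
                · exact Or.inl (hzy.le.trans (hy.2 ⟨hb, h⟩ h'))
                · exact Or.inl (hzy.le.trans h')
          exact absurd (hy.2 ⟨hz, hxz⟩ hzy.le) (not_le_of_gt hzy)
        exact ⟨y, hy.1.1, by rw [hr.covBy x y hcov, hx]⟩
  have hinj : Set.InjOn r s := by
    intro a ha b hb hab
    rcases hs.1.total ha hb with h | h
    · by_contra hne
      exact absurd hab (hr.strictMono (lt_of_le_of_ne h hne)).ne
    · by_contra hne
      exact absurd hab (hr.strictMono (lt_of_le_of_ne h (Ne.symm hne))).ne'
  rw [← hinj.ncard_image, him, ← Finset.coe_Iic, Set.ncard_coe_finset, Nat.card_Iic]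

theorem IsRankFun.maxChainsSameLength [Finite α] [BoundedOrder α] {r : α → ℕ} (hr : IsRankFun r) :
    MaxChainsSameLength α := fun s t hs ht => by
  rw [hr.ncard_of_isMaxChain hs, hr.ncard_of_isMaxChain ht]

theorem IsRankFun.posetRank_eq [Finite α] [BoundedOrder α] {r : α → ℕ} (hr : IsRankFun r) :
    posetRank α = r ⊤ := by
  rw [posetRank, hr.ncard_of_isMaxChain maxChain_spec]; rfl

/-- The interval `[x, y]` as a bounded poset. -/
@[reducible] def iccBoundedOrder {x y : α} (h : x ≤ y) : BoundedOrder (Set.Icc x y) where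
  top := ⟨y, h, le_rfl⟩
  le_top a := a.2.2
  bot := ⟨x, le_rfl, h⟩
  bot_le a := a.2.1

theorem IsRankFun.icc [Finite α] [OrderBot α] {r : α → ℕ} (hr : IsRankFun r) {x y : α}
    (h : x ≤ y) : @IsRankFun (Set.Icc x y) _ (iccBoundedOrder h).toOrderBot (fun z => r z - r x) := by
  let _ := iccBoundedOrder h
  refine ⟨Nat.sub_self _, fun a b hab => ?_, fun a b hab => ?_⟩
  · have h1 : r x ≤ r a := hr.strictMono.monotone a.2.1
    have h2 : r a < r b := hr.strictMono hab
    omega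
  · have h1 : r x ≤ r a := hr.strictMono.monotone a.2.1
    have h2 : r b = r a + 1 := hr.covBy _ _ <| by
      refine ⟨hab.1, fun c hac hcb => ?_⟩
      exact hab.2 (c := ⟨c, a.2.1.trans hac.le, hcb.le.trans b.2.2⟩) hac hcb
    omega

theorem IsRankFun.posetRank_icc [Finite α] [OrderBot α] {r : α → ℕ} (hr : IsRankFun r) {x y : α}
    (h : x ≤ y) : posetRank (Set.Icc x y) = r y - r x := by
  let _ := iccBoundedOrder h
  exact (hr.icc h).posetRank_eq

theorem IsRankFun.prod {β : Type*} [PartialOrder β] [OrderBot α] [OrderBot β]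
    {r : α → ℕ} {r' : β → ℕ} (hr : IsRankFun r) (hr' : IsRankFun r') :
    IsRankFun (fun p : α × β => r p.1 + r' p.2) := by
  refine ⟨by simp [hr.bot, hr'.bot], fun a b hab => ?_, fun a b hab => ?_⟩
  · rcases Prod.lt_iff.1 hab with ⟨h1, h2⟩ | ⟨h1, h2⟩
    · exact add_lt_add_of_lt_of_le (hr.strictMono h1) (hr'.strictMono.monotone h2)
    · exact add_lt_add_of_le_of_lt (hr.strictMono.monotone h1) (hr'.strictMono h2)
  · rcases Prod.covBy_iff.1 hab with ⟨h1, h2⟩ | ⟨h1, h2⟩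
    · simp only [hr.covBy _ _ h1, h2]; omega
    · simp only [hr'.covBy _ _ h1, h2]; omega

theorem IsRankFun.comp_orderIso {β : Type*} [PartialOrder β] [OrderBot α] [OrderBot β]
    {r : α → ℕ} (hr : IsRankFun r) (e : β ≃o α) : IsRankFun (fun x => r (e x)) :=
  ⟨by simp [hr.bot], fun _ _ h => hr.strictMono (e.strictMono h),
    fun _ _ h => hr.covBy _ _ ((apply_covBy_apply_iff e).2 h)⟩

end PosetLemmas

open scoped TensorProduct

section GradedBasis

variable {k H ι : Type*} [CommRing k] [CommRing H]

/-- The span of the basis elements of degree `n`. -/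
def basisGrading [Algebra k H] (b : Module.Basis ι k H) (deg : ι → ℕ) (n : ℕ) : Submodule k H :=
  Submodule.span k (b '' {i | deg i = n})

theorem basis_mem_basisGrading [Algebra k H] (b : Module.Basis ι k H) (deg : ι → ℕ) (i : ι) :
    b i ∈ basisGrading b deg (deg i) := Submodule.subset_span ⟨i, rfl, rfl⟩

/-- A basis of homogeneous elements, with products of basis elements homogeneous of the right
degree, makes the algebra graded. -/
@[reducible] noncomputable def gradedAlgebraOfBasis [Algebra k H] (b : Module.Basis ι k H)
    (deg : ι → ℕ) (h1 : (1 : H) ∈ basisGrading b deg 0)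
    (hmul : ∀ i j, b i * b j ∈ basisGrading b deg (deg i + deg j)) :
    GradedAlgebra (basisGrading b deg) :=
  { one_mem := h1
    mul_mem := by
      intro m n x y hx hy
      refine Submodule.span_induction₂ (p := fun x y _ _ => x * y ∈ basisGrading b deg (m + n))
        ?_ ?_ ?_ ?_ ?_ ?_ ?_ hx hy
      · rintro _ _ ⟨i, rfl, rfl⟩ ⟨j, rfl, rfl⟩; exact hmul i j
      · intros; simp
      · intros; simp
      · intro x y z _ _ _ h1 h2; rw [add_mul]; exact add_mem h1 h2
      · intro x y z _ _ _ h1 h2; rw [mul_add]; exact add_mem h1 h2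
      · intro r x y _ _ h; rw [smul_mul_assoc]; exact Submodule.smul_mem _ _ h
      · intro r x y _ _ h; rw [mul_smul_comm]; exact Submodule.smul_mem _ _ h
    toDecomposition := DirectSum.Decomposition.ofLinearMap _
      (b.constr k fun i => DirectSum.lof k ℕ (fun n => basisGrading b deg n) (deg i)
        ⟨b i, basis_mem_basisGrading b deg i⟩)
      (by
        apply b.ext
        intro i
        simp)
      (by
        ext n ⟨x, hx⟩ : 2
        simp only [LinearMap.comp_apply, LinearMap.id_apply, DirectSum.coeLinearMap_lof]
        induction hx using Submodule.span_induction with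
        | mem x h => obtain ⟨i, rfl, rfl⟩ := h; simp
        | zero => simp only [map_zero]; exact (map_zero _).symm
        | add x y hx hy h1 h2 => rw [map_add, h1, h2, ← map_add]; rfl
        | smul r x hx h => rw [map_smul, h, ← map_smul]; rfl) }

/-- The span of the tensors of basis elements of total degree `n`. -/
def tensorBasisGrading [Algebra k H] (b : Module.Basis ι k H) (deg : ι → ℕ) (n : ℕ) :
    Submodule k (H ⊗[k] H) :=
  Submodule.span k {t | ∃ i j, deg i + deg j = n ∧ t = b i ⊗ₜ b j}

variable [Bialgebra k H]

/-- The map `id - η ∘ ε`, in the convolution algebra. -/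
noncomputable def reducedId (k H : Type*) [CommRing k] [CommRing H] [Bialgebra k H] :
    WithConv (H →ₗ[k] H) := WithConv.toConv LinearMap.id - 1

/-- The antipode of a connected graded bialgebra, as the geometric series of `η ∘ ε - id`. -/
noncomputable def basisAntipode (b : Module.Basis ι k H) (deg : ι → ℕ) : H →ₗ[k] H :=
  b.constr k fun i =>
    (∑ m ∈ Finset.range (deg i + 1), (-1 : k) ^ m • (reducedId k H) ^ m).ofConv (b i)

theorem conv_mul_eq_zero (b : Module.Basis ι k H) (deg : ι → ℕ)
    (f g : WithConv (H →ₗ[k] H)) {n : ℕ} {x : H}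
    (hx : Coalgebra.comul (R := k) x ∈ tensorBasisGrading b deg n)
    (h : ∀ i j, deg i + deg j = n → f.ofConv (b i) * g.ofConv (b j) = 0) :
    (f * g).ofConv x = 0 := by
  have : tensorBasisGrading b deg n ≤
      LinearMap.ker (LinearMap.mul' k H ∘ₗ TensorProduct.map f.ofConv g.ofConv) := by
    refine Submodule.span_le.2 ?_
    rintro _ ⟨i, j, hij, rfl⟩
    simpa using h i j hij
  exact this hx

variable (b : Module.Basis ι k H) (deg : ι → ℕ)

theorem reducedId_apply_deg_zero
    (hdeg0 : ∀ i, deg i = 0 → b i = 1) (i : ι) (hi : deg i = 0) :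
    (reducedId k H).ofConv (b i) = 0 := by
  rw [hdeg0 i hi]
  simp [reducedId, LinearMap.convOne_def]

theorem reducedId_pow_apply
    (hdeg0 : ∀ i, deg i = 0 → b i = 1)
    (hcomul : ∀ i, Coalgebra.comul (R := k) (b i) ∈ tensorBasisGrading b deg (deg i)) (m : ℕ) (i : ι) (hi : deg i < m) :
    ((reducedId k H) ^ m).ofConv (b i) = 0 := by
  induction m generalizing i with
  | zero => omega
  | succ m ih =>
    rw [pow_succ']
    refine conv_mul_eq_zero b deg _ _ (hcomul i) fun p q hpq => ?_
    rcases Nat.eq_zero_or_pos (deg p) with hp | hp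
    · rw [reducedId_apply_deg_zero b deg hdeg0 p hp, zero_mul]
    · rw [ih q (by omega), mul_zero]

theorem basisAntipode_apply
    (hdeg0 : ∀ i, deg i = 0 → b i = 1)
    (hcomul : ∀ i, Coalgebra.comul (R := k) (b i) ∈ tensorBasisGrading b deg (deg i)) (i : ι) (N : ℕ) (hN : deg i ≤ N) :
    basisAntipode b deg (b i) =
      (∑ m ∈ Finset.range (N + 1), (-1 : k) ^ m • (reducedId k H) ^ m).ofConv (b i) := by
  rw [basisAntipode, Module.Basis.constr_basis]
  have hsub : Finset.range (deg i + 1) ⊆ Finset.range (N + 1) :=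
    Finset.range_subset_range.2 (by omega)
  rw [← Finset.sum_sdiff hsub, WithConv.ofConv_add, LinearMap.add_apply]
  symm
  rw [add_eq_right]
  rw [WithConv.ofConv_sum, LinearMap.sum_apply]
  refine Finset.sum_eq_zero fun m hm => ?_
  simp only [Finset.mem_sdiff, Finset.mem_range] at hm
  rw [WithConv.ofConv_smul, LinearMap.smul_apply,
    reducedId_pow_apply b deg hdeg0 hcomul m i (by omega), smul_zero]

theorem geom_mul (N : ℕ) :
    (∑ m ∈ Finset.range (N + 1), (-1 : k) ^ m • (reducedId k H) ^ m) *
      WithConv.toConv LinearMap.id = 1 - (-1 : k) ^ (N + 1) • (reducedId k H) ^ (N + 1) := by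
  have hid : (WithConv.toConv LinearMap.id : WithConv (H →ₗ[k] H)) = reducedId k H + 1 := by
    simp [reducedId]
  rw [hid]
  induction N with
  | zero => simp [add_comm]
  | succ N ih =>
    rw [Finset.sum_range_succ, add_mul, ih, smul_mul_assoc, mul_add, mul_one, ← pow_succ,
      pow_succ (-1 : k) (N + 1), mul_neg_one, neg_smul, smul_add]
    abel

theorem mul_geom (N : ℕ) :
    WithConv.toConv LinearMap.id * (∑ m ∈ Finset.range (N + 1), (-1 : k) ^ m • (reducedId k H) ^ m)
      = 1 - (-1 : k) ^ (N + 1) • (reducedId k H) ^ (N + 1) := by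
  rw [← geom_mul N]
  have hid : (WithConv.toConv LinearMap.id : WithConv (H →ₗ[k] H)) = reducedId k H + 1 := by
    simp [reducedId]
  rw [hid]
  refine Commute.eq (Commute.sum_right _ _ _ fun m _ => ?_)
  exact ((((Commute.refl _).pow_right m).add_left (Commute.one_left _)).smul_right _)

theorem basisAntipode_mul_id
    (hdeg0 : ∀ i, deg i = 0 → b i = 1)
    (hcomul : ∀ i, Coalgebra.comul (R := k) (b i) ∈ tensorBasisGrading b deg (deg i)) :
    WithConv.toConv (basisAntipode b deg) * WithConv.toConv LinearMap.id
      = (1 : WithConv (H →ₗ[k] H)) := by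
  apply WithConv.ofConv_injective
  apply b.ext
  intro i
  have h1 : (1 : WithConv (H →ₗ[k] H)).ofConv (b i) =
      ((∑ m ∈ Finset.range (deg i + 1), (-1 : k) ^ m • (reducedId k H) ^ m) *
        WithConv.toConv LinearMap.id).ofConv (b i) := by
    rw [geom_mul, WithConv.ofConv_sub, LinearMap.sub_apply, WithConv.ofConv_smul,
      LinearMap.smul_apply, reducedId_pow_apply b deg hdeg0 hcomul _ i (by omega)]
    simp
  rw [h1, ← sub_eq_zero, ← LinearMap.sub_apply, ← WithConv.ofConv_sub, ← sub_mul]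
  refine conv_mul_eq_zero b deg _ _ (hcomul i) fun p q hpq => ?_
  rw [WithConv.ofConv_sub, LinearMap.sub_apply, WithConv.ofConv_toConv,
    basisAntipode_apply b deg hdeg0 hcomul p (deg i) (by omega), sub_self, zero_mul]

theorem id_mul_basisAntipode
    (hdeg0 : ∀ i, deg i = 0 → b i = 1)
    (hcomul : ∀ i, Coalgebra.comul (R := k) (b i) ∈ tensorBasisGrading b deg (deg i)) :
    WithConv.toConv LinearMap.id * WithConv.toConv (basisAntipode b deg)
      = (1 : WithConv (H →ₗ[k] H)) := by
  apply WithConv.ofConv_injective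
  apply b.ext
  intro i
  have h1 : (1 : WithConv (H →ₗ[k] H)).ofConv (b i) =
      (WithConv.toConv LinearMap.id *
        (∑ m ∈ Finset.range (deg i + 1), (-1 : k) ^ m • (reducedId k H) ^ m)).ofConv (b i) := by
    rw [mul_geom, WithConv.ofConv_sub, LinearMap.sub_apply, WithConv.ofConv_smul,
      LinearMap.smul_apply, reducedId_pow_apply b deg hdeg0 hcomul _ i (by omega)]
    simp
  rw [h1, ← sub_eq_zero, ← LinearMap.sub_apply, ← WithConv.ofConv_sub, ← mul_sub]
  refine conv_mul_eq_zero b deg _ _ (hcomul i) fun p q hpq => ?_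
  rw [WithConv.ofConv_sub, LinearMap.sub_apply, WithConv.ofConv_toConv,
    basisAntipode_apply b deg hdeg0 hcomul q (deg i) (by omega), sub_self, mul_zero]

/-- A bialgebra with a homogeneous basis, connected and with a graded coproduct, is a Hopf
algebra. -/
@[reducible] noncomputable def hopfAlgebraOfBasis
    (hdeg0 : ∀ i, deg i = 0 → b i = 1)
    (hcomul : ∀ i, Coalgebra.comul (R := k) (b i) ∈ tensorBasisGrading b deg (deg i)) : HopfAlgebra k H where
  antipode := basisAntipode b deg
  mul_antipode_rTensor_comul :=
    congrArg WithConv.ofConv (basisAntipode_mul_id b deg hdeg0 hcomul)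
  mul_antipode_lTensor_comul :=
    congrArg WithConv.ofConv (id_mul_basisAntipode b deg hdeg0 hcomul)

end GradedBasis

/-- The algebra of quasi-symmetric functions over `k`: the free module on the monomial basis
`M_α`, where `α` runs over all compositions (lists of positive integers). -/
def QSym (k : Type*) [CommRing k] : Type _ := List ℕ+ →₀ k

namespace QSym

variable (k : Type*) [CommRing k]

noncomputable instance : AddCommGroup (QSym k) := inferInstanceAs (AddCommGroup (List ℕ+ →₀ k))
noncomputable instance : Module k (QSym k) := inferInstanceAs (Module k (List ℕ+ →₀ k))

/-- The monomial basis. -/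
noncomputable def basis : Module.Basis (List ℕ+) k (QSym k) :=
  Module.Basis.ofRepr (LinearEquiv.refl k (List ℕ+ →₀ k))

/-- The monomial quasi-symmetric function `M_α`. -/
noncomputable def M (α : List ℕ+) : QSym k := basis k α

variable {k}

/-- The coefficient `f_α(h)` of `M_α` in `h`. -/
noncomputable def coeff (h : QSym k) (α : List ℕ+) : k := (basis k).repr h α

variable (k)

/-- The linear operator `M_β ↦ M_{(a, β)}`. -/
noncomputable def consOp (a : ℕ+) : QSym k →ₗ[k] QSym k :=
  (basis k).constr k fun β => M k (a :: β)

variable {k} in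
theorem ext_M {N : Type*} [AddCommGroup N] [Module k N] {f g : QSym k →ₗ[k] N}
    (h : ∀ α, f (M k α) = g (M k α)) : f = g := (basis k).ext h

@[simp] theorem consOp_M (a : ℕ+) (β : List ℕ+) : consOp k a (M k β) = M k (a :: β) :=
  (basis k).constr_basis k _ β

/-- The product `M_α * M_β`, as the quasi-shuffle of `α` and `β`. -/
noncomputable def quasiShuffle : List ℕ+ → List ℕ+ → QSym k
  | [], β => M k β
  | a :: α, [] => M k (a :: α)
  | a :: α, b :: β =>
      consOp k a (quasiShuffle α (b :: β)) + consOp k b (quasiShuffle (a :: α) β)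
        + consOp k (a + b) (quasiShuffle α β)
termination_by α β => α.length + β.length

/-- The product of quasi-symmetric functions, as a bilinear map. -/
noncomputable def mulMap : QSym k →ₗ[k] QSym k →ₗ[k] QSym k :=
  (basis k).constr k fun α => (basis k).constr k fun β => quasiShuffle k α β

theorem mulMap_M (α β : List ℕ+) : mulMap k (M k α) (M k β) = quasiShuffle k α β := by
  simp [mulMap, M]

theorem mulMap_nil_left (x : QSym k) : mulMap k (M k []) x = x := by
  have : mulMap k (M k []) = LinearMap.id := ext_M fun α => by
    rw [mulMap_M, quasiShuffle]; rfl
  rw [this]; rfl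

theorem mulMap_nil_right (x : QSym k) : mulMap k x (M k []) = x := by
  have : (mulMap k).flip (M k []) = LinearMap.id := ext_M fun α => by
    rw [LinearMap.flip_apply, mulMap_M]
    cases α <;> rw [quasiShuffle] <;> rfl
  rw [← LinearMap.flip_apply, this]; rfl

theorem mulMap_cons_cons (a b : ℕ+) (x y : QSym k) :
    mulMap k (consOp k a x) (consOp k b y) =
      consOp k a (mulMap k x (consOp k b y)) + consOp k b (mulMap k (consOp k a x) y)
        + consOp k (a + b) (mulMap k x y) := by
  have : (mulMap k).compl₁₂ (consOp k a) (consOp k b) =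
      ((mulMap k).compl₂ (consOp k b)).compr₂ (consOp k a)
      + ((mulMap k).comp (consOp k a)).compr₂ (consOp k b)
      + (mulMap k).compr₂ (consOp k (a + b)) := by
    refine ext_M fun α => ext_M fun β => ?_
    simp only [LinearMap.compl₁₂_apply, LinearMap.add_apply, LinearMap.compr₂_apply,
      LinearMap.compl₂_apply, LinearMap.comp_apply, consOp_M, mulMap_M]
    rw [quasiShuffle]
  exact congr($this x y)

theorem mulMap_comm (x y : QSym k) : mulMap k x y = mulMap k y x := by
  have : mulMap k = (mulMap k).flip := by
    refine ext_M fun α => ext_M fun β => ?_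
    rw [LinearMap.flip_apply]
    induction h : α.length + β.length using Nat.strong_induction_on generalizing α β with
    | _ n ih =>
      subst h
      cases α with
      | nil => rw [mulMap_nil_left, mulMap_nil_right]
      | cons a α =>
        cases β with
        | nil => rw [mulMap_nil_left, mulMap_nil_right]
        | cons b β =>
          simp only [← consOp_M]
          rw [mulMap_cons_cons, mulMap_cons_cons]
          simp only [consOp_M]
          rw [ih _ (by simp) α (b :: β) rfl, ih _ (by simp) (a :: α) β rfl,
            ih _ (by simp; omega) α β rfl, add_comm b a]
          abel
  exact congr($this x y)

variable {k} in
theorem induction_M {p : QSym k → Prop} (x : QSym k) (zero : p 0)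
    (add : ∀ x y, p x → p y → p (x + y)) (smul : ∀ (r : k) x, p x → p (r • x))
    (M : ∀ α, p (M k α)) : p x := by
  have hx : x ∈ Submodule.span k (Set.range (basis k)) := (basis k).mem_span x
  induction hx using Submodule.span_induction with
  | mem x h => obtain ⟨α, rfl⟩ := h; exact M α
  | zero => exact zero
  | add x y _ _ h1 h2 => exact add x y h1 h2
  | smul r x _ h => exact smul r x h

theorem mulMap_assoc_M (α β γ : List ℕ+) :
    mulMap k (mulMap k (M k α) (M k β)) (M k γ) = mulMap k (M k α) (mulMap k (M k β) (M k γ)) := by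
  induction h : α.length + β.length + γ.length using Nat.strong_induction_on
    generalizing α β γ with
  | _ n ih =>
    subst h
    rcases α with _ | ⟨a, α⟩
    · simp only [mulMap_nil_left]
    rcases β with _ | ⟨b, β⟩
    · simp only [mulMap_nil_left, mulMap_nil_right]
    rcases γ with _ | ⟨c, γ⟩
    · simp only [mulMap_nil_right]
    have e1 := ih _ (by simp) α (b :: β) (c :: γ) rfl
    have e2 := ih _ (by simp) (a :: α) β (c :: γ) rfl
    have e3 := ih _ (by simp) (a :: α) (b :: β) γ rfl
    have e4 := ih _ (by simp; omega) α β (c :: γ) rfl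
    have e5 := ih _ (by simp; omega) α (b :: β) γ rfl
    have e6 := ih _ (by simp; omega) (a :: α) β γ rfl
    have e7 := ih _ (by simp; omega) α β γ rfl
    simp only [← consOp_M] at e1 e2 e3 e4 e5 e6 e7 ⊢
    have l3 : mulMap k (consOp k a (mulMap k (M k α) (consOp k b (M k β)))) (M k γ)
        + mulMap k (consOp k b (mulMap k (consOp k a (M k α)) (M k β))) (M k γ)
        + mulMap k (consOp k (a + b) (mulMap k (M k α) (M k β))) (M k γ)
        = mulMap k (mulMap k (consOp k a (M k α)) (consOp k b (M k β))) (M k γ) := by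
      rw [mulMap_cons_cons]; simp only [map_add, LinearMap.add_apply]
    have l1 : mulMap k (M k α) (consOp k b (mulMap k (M k β) (consOp k c (M k γ))))
        + mulMap k (M k α) (consOp k c (mulMap k (consOp k b (M k β)) (M k γ)))
        + mulMap k (M k α) (consOp k (b + c) (mulMap k (M k β) (M k γ)))
        = mulMap k (M k α) (mulMap k (consOp k b (M k β)) (consOp k c (M k γ))) := by
      rw [mulMap_cons_cons]; simp only [map_add]
    rw [mulMap_cons_cons k a b, mulMap_cons_cons k b c]
    simp only [map_add, LinearMap.add_apply]
    simp only [mulMap_cons_cons]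
    rw [e2, e4, e5, e6, e7, e1, add_assoc a b c, ← l1, ]
    have l3' := congrArg (consOp k c) (l3.trans e3)
    simp only [map_add] at l3' ⊢
    rw [← sub_eq_zero] at l3' ⊢
    rw [← l3']
    abel

theorem mulMap_assoc (x y z : QSym k) :
    mulMap k (mulMap k x y) z = mulMap k x (mulMap k y z) := by
  induction x using induction_M with
  | zero => simp
  | add x x' h h' => simp only [map_add, LinearMap.add_apply, h, h']
  | smul r x h => simp only [map_smul, LinearMap.smul_apply, h]
  | M α =>
    induction y using induction_M with
    | zero => simp
    | add x x' h h' => simp only [map_add, LinearMap.add_apply, h, h']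
    | smul r x h => simp only [map_smul, LinearMap.smul_apply, h]
    | M β =>
      induction z using induction_M with
      | zero => simp
      | add x x' h h' => simp only [map_add, h, h']
      | smul r x h => simp only [map_smul, h]
      | M γ => exact mulMap_assoc_M k α β γ

noncomputable instance : CommRing (QSym k) :=
  { (inferInstance : AddCommGroup (QSym k)) with
    mul := fun x y => mulMap k x y
    one := M k []
    left_distrib := fun x y z => map_add (mulMap k x) y z
    right_distrib := fun x y z => congr($(map_add (mulMap k) x y) z)
    zero_mul := fun x => congr($(map_zero (mulMap k)) x)
    mul_zero := fun x => map_zero (mulMap k x)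
    mul_assoc := mulMap_assoc k
    one_mul := mulMap_nil_left k
    mul_one := mulMap_nil_right k
    mul_comm := mulMap_comm k }

variable {k}

theorem mul_def (x y : QSym k) : x * y = mulMap k x y := rfl

theorem one_def : (1 : QSym k) = M k [] := rfl

theorem consOp_mul_consOp (a b : ℕ+) (x y : QSym k) :
    consOp k a x * consOp k b y =
      consOp k a (x * consOp k b y) + consOp k b (consOp k a x * y) + consOp k (a + b) (x * y) :=
  mulMap_cons_cons k a b x y

variable (k)

noncomputable instance : Algebra k (QSym k) :=
  Algebra.ofModule (fun r x y => congr($(map_smul (mulMap k) r x) y))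
    (fun r x y => map_smul (mulMap k x) r y)

/-- The counit: projection onto the component of degree `0`. -/
noncomputable def counitMap : QSym k →ₗ[k] k :=
  (basis k).constr k fun α => if α = [] then 1 else 0

/-- The coproduct `Δ(M_α) = ∑_{α = βγ} M_β ⊗ M_γ`. -/
noncomputable def comulMap : QSym k →ₗ[k] QSym k ⊗[k] QSym k :=
  (basis k).constr k fun α =>
    ∑ i ∈ Finset.range (α.length + 1), M k (α.take i) ⊗ₜ[k] M k (α.drop i)

theorem counitMap_M (α : List ℕ+) : counitMap k (M k α) = if α = [] then 1 else 0 :=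
  (basis k).constr_basis k _ α

theorem comulMap_M (α : List ℕ+) : comulMap k (M k α) =
    ∑ i ∈ Finset.range (α.length + 1), M k (α.take i) ⊗ₜ[k] M k (α.drop i) :=
  (basis k).constr_basis k _ α

theorem counitMap_consOp (a : ℕ+) (x : QSym k) : counitMap k (consOp k a x) = 0 := by
  have : counitMap k ∘ₗ consOp k a = 0 := ext_M fun α => by simp [counitMap_M]
  exact congr($this x)

theorem comulMap_consOp (a : ℕ+) (x : QSym k) : comulMap k (consOp k a x) =
    1 ⊗ₜ[k] consOp k a x + (consOp k a).rTensor (QSym k) (comulMap k x) := by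
  have : comulMap k ∘ₗ consOp k a = TensorProduct.mk k _ _ 1 ∘ₗ consOp k a +
      (consOp k a).rTensor (QSym k) ∘ₗ comulMap k := ext_M fun α => by
    simp only [LinearMap.comp_apply, LinearMap.add_apply, consOp_M, comulMap_M,
      TensorProduct.mk_apply, map_sum, LinearMap.rTensor_tmul]
    rw [List.length_cons, Finset.sum_range_succ', add_comm]
    rfl
  exact congr($this x)

theorem counitMap_mul (x y : QSym k) :
    counitMap k (x * y) = counitMap k x * counitMap k y := by
  have : (mulMap k).compr₂ (counitMap k) =
      (LinearMap.mul k k).compl₁₂ (counitMap k) (counitMap k) := by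
    refine ext_M fun α => ext_M fun β => ?_
    simp only [LinearMap.compr₂_apply, LinearMap.compl₁₂_apply, ← mul_def, LinearMap.mul_apply']
    rcases α with _ | ⟨a, α⟩
    · rw [← one_def, one_mul, one_def]; simp [counitMap_M]
    rcases β with _ | ⟨b, β⟩
    · rw [← one_def, mul_one, one_def]; simp [counitMap_M]
    simp only [← consOp_M, consOp_mul_consOp, map_add, counitMap_consOp]
    simp
  exact congr($this x y)

theorem rTensor_consOp_mul (a b : ℕ+) (s t : QSym k ⊗[k] QSym k) :
    (consOp k a).rTensor (QSym k) s * (consOp k b).rTensor (QSym k) t =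
      (consOp k a).rTensor (QSym k) (s * (consOp k b).rTensor (QSym k) t) +
      (consOp k b).rTensor (QSym k) ((consOp k a).rTensor (QSym k) s * t) +
      (consOp k (a + b)).rTensor (QSym k) (s * t) := by
  induction s using TensorProduct.induction_on with
  | zero => simp
  | add s s' h h' => simp only [map_add, add_mul, h, h']; abel
  | tmul x y =>
    induction t using TensorProduct.induction_on with
    | zero => simp
    | add s s' h h' => simp only [map_add, mul_add, h, h']; abel
    | tmul x' y' =>
      simp only [LinearMap.rTensor_tmul, Algebra.TensorProduct.tmul_mul_tmul, consOp_mul_consOp,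
        TensorProduct.add_tmul]

theorem rTensor_consOp_mul_one_tmul (a : ℕ+) (s : QSym k ⊗[k] QSym k) (y : QSym k) :
    (consOp k a).rTensor (QSym k) s * (1 ⊗ₜ[k] y) =
      (consOp k a).rTensor (QSym k) (s * (1 ⊗ₜ[k] y)) := by
  induction s using TensorProduct.induction_on with
  | zero => simp
  | add s s' h h' => simp only [map_add, add_mul, h, h']
  | tmul x z => simp only [LinearMap.rTensor_tmul, Algebra.TensorProduct.tmul_mul_tmul, mul_one]

theorem one_tmul_mul_rTensor_consOp (a : ℕ+) (s : QSym k ⊗[k] QSym k) (y : QSym k) :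
    (1 ⊗ₜ[k] y) * (consOp k a).rTensor (QSym k) s =
      (consOp k a).rTensor (QSym k) (s * (1 ⊗ₜ[k] y)) := by
  rw [mul_comm, rTensor_consOp_mul_one_tmul]

theorem comulMap_one : comulMap k 1 = 1 := by
  rw [one_def, comulMap_M]; simp [← one_def, Algebra.TensorProduct.one_def]

theorem comulMap_mul (x y : QSym k) : comulMap k (x * y) = comulMap k x * comulMap k y := by
  have : (mulMap k).compr₂ (comulMap k) =
      (LinearMap.mul k (QSym k ⊗[k] QSym k)).compl₁₂ (comulMap k) (comulMap k) := by
    refine ext_M fun α => ext_M fun β => ?_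
    simp only [LinearMap.compr₂_apply, LinearMap.compl₁₂_apply, ← mul_def, LinearMap.mul_apply']
    induction h : α.length + β.length using Nat.strong_induction_on generalizing α β with
    | _ n ih =>
      subst h
      rcases α with _ | ⟨a, α⟩
      · rw [← one_def, one_mul, comulMap_one, one_mul]
      rcases β with _ | ⟨b, β⟩
      · rw [← one_def, mul_one, comulMap_one, mul_one]
      have e1 := ih _ (by simp) α (b :: β) rfl
      have e2 := ih _ (by simp) (a :: α) β rfl
      have e3 := ih _ (by simp; omega) α β rfl
      simp only [← consOp_M] at e1 e2 e3 ⊢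
      rw [consOp_mul_consOp]
      simp only [map_add, comulMap_consOp]
      rw [e1, e2, e3]
      simp only [comulMap_consOp, add_mul, mul_add, map_add, rTensor_consOp_mul,
        rTensor_consOp_mul_one_tmul, Algebra.TensorProduct.tmul_mul_tmul, mul_one,
        consOp_mul_consOp, TensorProduct.tmul_add,
        one_tmul_mul_rTensor_consOp, mul_comm (1 ⊗ₜ[k] _) (comulMap k _)]
      abel
  exact congr($this x y)

/-- The counit as a character. -/
noncomputable def counitHom : QSym k →ₐ[k] k :=
  AlgHom.ofLinearMap (counitMap k) (by rw [one_def, counitMap_M]; rfl) (counitMap_mul k)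

/-- The coproduct as a morphism of algebras. -/
noncomputable def comulHom : QSym k →ₐ[k] QSym k ⊗[k] QSym k :=
  AlgHom.ofLinearMap (comulMap k) (comulMap_one k) (comulMap_mul k)

set_option synthInstance.maxHeartbeats 200000 in
theorem coassoc_aux (a : ℕ+) (t : QSym k ⊗[k] QSym k) :
    TensorProduct.assoc k _ _ _ ((comulMap k).rTensor (QSym k)
        ((consOp k a).rTensor (QSym k) t)) =
      1 ⊗ₜ[k] (consOp k a).rTensor (QSym k) t + (consOp k a).rTensor (QSym k ⊗[k] QSym k)
        (TensorProduct.assoc k _ _ _ ((comulMap k).rTensor (QSym k) t)) := by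
  induction t using TensorProduct.induction_on with
  | zero => simp
  | add s s' h h' => simp only [map_add, h, h', TensorProduct.tmul_add]; abel
  | tmul x y =>
    simp only [LinearMap.rTensor_tmul, comulMap_consOp, TensorProduct.add_tmul, map_add,
      TensorProduct.assoc_tmul]
    congr 1
    generalize comulMap k x = u
    induction u using TensorProduct.induction_on with
    | zero => simp
    | add s s' h h' => simp only [map_add, TensorProduct.add_tmul, h, h']
    | tmul p q => simp

theorem comulMap_coassoc (x : QSym k) :
    TensorProduct.assoc k _ _ _ ((comulMap k).rTensor (QSym k) (comulMap k x)) =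
      (comulMap k).lTensor (QSym k) (comulMap k x) := by
  induction x using induction_M with
  | zero => simp
  | add x y h h' => simp only [map_add, h, h']
  | smul r x h => simp only [map_smul, h]
  | M α =>
    induction α with
    | nil => rw [← one_def, comulMap_one]; simp [Algebra.TensorProduct.one_def, comulMap_one]
    | cons a α ih =>
      rw [← consOp_M, comulMap_consOp, map_add, map_add, coassoc_aux, ih, map_add]
      have hc : (comulMap k).lTensor (QSym k) ((consOp k a).rTensor (QSym k) (comulMap k (M k α)))
          = (consOp k a).rTensor (QSym k ⊗[k] QSym k)
            ((comulMap k).lTensor (QSym k) (comulMap k (M k α))) := by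
        generalize comulMap k (M k α) = u
        rw [← LinearMap.comp_apply, ← LinearMap.comp_apply, LinearMap.lTensor_comp_rTensor,
          LinearMap.rTensor_comp_lTensor]
      rw [hc]
      simp only [LinearMap.rTensor_tmul, LinearMap.lTensor_tmul, comulMap_one, comulMap_consOp,
        TensorProduct.tmul_add, Algebra.TensorProduct.one_def, TensorProduct.assoc_tmul]
      abel

theorem counit_rTensor (x : QSym k) : (counitMap k).rTensor (QSym k) (comulMap k x) = 1 ⊗ₜ x := by
  induction x using induction_M with
  | zero => simp
  | add x y h h' => simp only [map_add, h, h', TensorProduct.tmul_add]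
  | smul r x h => simp only [map_smul, h, TensorProduct.tmul_smul]
  | M α =>
    rw [comulMap_M, map_sum, Finset.sum_eq_single 0]
    · simp [counitMap_M]
    · intro i hi h0
      have : α.take i ≠ [] := by
        simp only [Finset.mem_range] at hi
        rw [Ne, List.take_eq_nil_iff]
        rintro (h | rfl)
        · exact h0 h
        · simp at hi; omega
      simp [counitMap_M, this]
    · simp

theorem counit_lTensor (x : QSym k) : (counitMap k).lTensor (QSym k) (comulMap k x) = x ⊗ₜ 1 := by
  induction x using induction_M with
  | zero => simp
  | add x y h h' => simp only [map_add, h, h', TensorProduct.add_tmul]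
  | smul r x h => simp only [map_smul, h, TensorProduct.smul_tmul']
  | M α =>
    rw [comulMap_M, map_sum, Finset.sum_eq_single α.length]
    · simp [counitMap_M]
    · intro i hi h0
      have : α.drop i ≠ [] := by
        simp only [Finset.mem_range] at hi
        rw [Ne, List.drop_eq_nil_iff]
        omega
      simp [counitMap_M, this]
    · simp

noncomputable instance : Bialgebra k (QSym k) :=
  Bialgebra.ofAlgHom (comulHom k) (counitHom k)
    (AlgHom.ext (comulMap_coassoc k))
    (AlgHom.ext (counit_rTensor k))
    (AlgHom.ext (counit_lTensor k))

/-- The size `|α|` of a composition. -/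
def size (α : List ℕ+) : ℕ := (α.map (fun a : ℕ+ => (a : ℕ))).sum

theorem size_append (α β : List ℕ+) : size (α ++ β) = size α + size β := by simp [size]

theorem size_cons (a : ℕ+) (β : List ℕ+) : size (a :: β) = a + size β := by simp [size]

/-- The homogeneous component of degree `n`, spanned by the `M_α` with `|α| = n`. -/
noncomputable def grading (n : ℕ) : Submodule k (QSym k) := basisGrading (basis k) size n

variable {k} in
theorem consOp_mem_grading (a : ℕ+) {n : ℕ} {x : QSym k} (hx : x ∈ grading k n) :
    consOp k a x ∈ grading k (a + n) := by
  have : grading k n ≤ (grading k (a + n)).comap (consOp k a) := by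
    refine Submodule.span_le.2 ?_
    rintro _ ⟨α, rfl, rfl⟩
    have : M k (a :: α) ∈ grading k (size (a :: α)) := basis_mem_basisGrading (basis k) size (a :: α)
    rw [size_cons] at this
    change consOp k a (M k α) ∈ grading k (a + size α)
    rw [consOp_M]; exact this
  exact this hx

theorem quasiShuffle_mem_grading (α β : List ℕ+) :
    quasiShuffle k α β ∈ grading k (size α + size β) := by
  induction h : α.length + β.length using Nat.strong_induction_on generalizing α β with
  | _ n ih =>
    subst h
    rcases α with _ | ⟨a, α⟩
    · rw [quasiShuffle, show size [] = 0 from rfl, zero_add]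
      exact basis_mem_basisGrading (basis k) size β
    rcases β with _ | ⟨b, β⟩
    · rw [quasiShuffle, show size [] = 0 from rfl, add_zero]
      exact basis_mem_basisGrading (basis k) size (a :: α)
    have e1 := consOp_mem_grading a (ih _ (by simp) α (b :: β) rfl)
    have e2 := consOp_mem_grading b (ih _ (by simp) (a :: α) β rfl)
    have e3 := consOp_mem_grading (a + b) (ih _ (by simp; omega) α β rfl)
    rw [quasiShuffle]
    rw [size_cons, size_cons] at *
    refine add_mem (add_mem ?_ ?_) ?_
    · convert e1 using 2; ring
    · convert e2 using 2; ring
    · convert e3 using 2; push_cast; ring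

noncomputable instance : GradedAlgebra (grading k) :=
  gradedAlgebraOfBasis (basis k) size (basis_mem_basisGrading (basis k) size [])
    (fun α β => by
      have := quasiShuffle_mem_grading k α β
      rw [← mulMap_M] at this
      exact this)

noncomputable instance : HopfAlgebra k (QSym k) :=
  hopfAlgebraOfBasis (basis k) size
    (fun α hα => by
      rcases α with _ | ⟨a, α⟩
      · rfl
      · rw [size_cons] at hα; have := a.pos; omega)
    (fun α => by
      change comulMap k (M k α) ∈ _
      rw [comulMap_M]
      refine sum_mem fun i _ => Submodule.subset_span ⟨α.take i, α.drop i, ?_, rfl⟩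
      rw [← size_append, List.take_append_drop])

end QSym

universe u v

/-- A finite graded poset: it has a maximum and a minimum, and all its maximal chains have the
same length. -/
structure GradedPoset : Type (v + 1) where
  carrier : Type v
  [partialOrder : PartialOrder carrier]
  [boundedOrder : BoundedOrder carrier]
  [finite : Finite carrier]
  graded : MaxChainsSameLength carrier

namespace GradedPoset

instance : CoeSort GradedPoset.{v} (Type v) := ⟨GradedPoset.carrier⟩

attribute [instance] GradedPoset.partialOrder GradedPoset.boundedOrder GradedPoset.finite

noncomputable instance (P : GradedPoset.{v}) : Fintype P := Fintype.ofFinite P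

noncomputable instance (P : GradedPoset.{v}) : DecidableEq P := Classical.decEq P

noncomputable instance (P : GradedPoset.{v}) : LocallyFiniteOrder P :=
  LocallyFiniteOrder.ofFiniteIcc fun _ _ => Set.toFinite _

/-- The rank of a graded poset: the length of a maximal chain. -/
noncomputable def rank (P : GradedPoset.{v}) : ℕ := posetRank P

theorem exists_isRankFun (P : GradedPoset.{v}) : ∃ r : P → ℕ, IsRankFun r :=
  P.graded.exists_isRankFun

/-- The interval `[x, y]` of a graded poset, as a graded poset. -/
def interval (P : GradedPoset.{v}) (x y : P) (h : x ≤ y) : GradedPoset.{v} :=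
  letI := iccBoundedOrder h
  { carrier := Set.Icc x y
    graded := by
      obtain ⟨r, hr⟩ := P.exists_isRankFun
      exact (hr.icc h).maxChainsSameLength }

/-- The cartesian product of two graded posets. -/
def prod (P Q : GradedPoset.{v}) : GradedPoset.{v} where
  carrier := P × Q
  graded := by
    obtain ⟨r, hr⟩ := P.exists_isRankFun
    obtain ⟨r', hr'⟩ := Q.exists_isRankFun
    exact (hr.prod hr').maxChainsSameLength

/-- The poset with one element. -/
def point : GradedPoset.{v} where
  carrier := PUnit.{v + 1}
  graded := (⟨rfl, fun a _ h => absurd h (lt_irrefl a), fun a _ h => absurd h.1 (lt_irrefl a)⟩ :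
    IsRankFun (fun _ : PUnit.{v + 1} => 0)).maxChainsSameLength

theorem rank_eq {P : GradedPoset.{v}} {r : P → ℕ} (hr : IsRankFun r) : P.rank = r ⊤ :=
  hr.posetRank_eq

theorem rank_interval {P : GradedPoset.{v}} {r : P → ℕ} (hr : IsRankFun r) {x y : P} (h : x ≤ y) :
    (P.interval x y h).rank = r y - r x := hr.posetRank_icc h

theorem rank_prod (P Q : GradedPoset.{v}) : (P.prod Q).rank = P.rank + Q.rank := by
  obtain ⟨r, hr⟩ := P.exists_isRankFun
  obtain ⟨r', hr'⟩ := Q.exists_isRankFun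
  rw [rank_eq hr, rank_eq hr']
  exact rank_eq (P := P.prod Q) (hr.prod hr')

theorem rank_interval_add (P : GradedPoset.{v}) (z : P) :
    (P.interval ⊥ z bot_le).rank + (P.interval z ⊤ le_top).rank = P.rank := by
  obtain ⟨r, hr⟩ := P.exists_isRankFun
  have h1 := hr.strictMono.monotone (le_top (a := z))
  rw [rank_interval hr, rank_interval hr, rank_eq hr, hr.bot]
  omega

theorem rank_congr {P Q : GradedPoset.{v}} (e : P ≃o Q) : P.rank = Q.rank := by
  obtain ⟨r, hr⟩ := Q.exists_isRankFun
  rw [rank_eq hr, rank_eq (hr.comp_orderIso e)]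
  simp

theorem bot_eq_top_of_rank_eq_zero {P : GradedPoset.{v}} (h : P.rank = 0) : (⊥ : P) = ⊤ := by
  obtain ⟨r, hr⟩ := P.exists_isRankFun
  by_contra hne
  have := hr.strictMono (lt_of_le_of_ne bot_le hne)
  rw [rank_eq hr] at h
  omega

/-- Isomorphism of graded posets. -/
instance isoSetoid : Setoid GradedPoset.{v} where
  r P Q := Nonempty (P ≃o Q)
  iseqv := ⟨fun P => ⟨OrderIso.refl P⟩, fun ⟨e⟩ => ⟨e.symm⟩, fun ⟨e⟩ ⟨f⟩ => ⟨e.trans f⟩⟩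

/-- The product of two order isomorphisms. -/
def prodIso {P P' Q Q' : GradedPoset.{v}} (e : P ≃o P') (f : Q ≃o Q') :
    P.prod Q ≃o P'.prod Q' where
  toEquiv := e.toEquiv.prodCongr f.toEquiv
  map_rel_iff' := by
    rintro ⟨a, b⟩ ⟨c, d⟩
    exact and_congr e.le_iff_le f.le_iff_le

/-- An order isomorphism restricts to intervals. -/
def intervalIso {P Q : GradedPoset.{v}} (e : P ≃o Q) {x y : P} (h : x ≤ y) {x' y' : Q}
    (h' : x' ≤ y') (hx : e x = x') (hy : e y = y') :
    P.interval x y h ≃o Q.interval x' y' h' where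
  toEquiv := e.toEquiv.subtypeEquiv fun a => by
    subst hx hy
    exact (and_congr e.le_iff_le e.le_iff_le).symm
  map_rel_iff' := e.le_iff_le

/-- An interval of an interval is an interval. -/
def intervalInterval {P : GradedPoset.{v}} {x y : P} (h : x ≤ y) {a b : P.interval x y h}
    (hab : a ≤ b) {a' b' : P} (hab' : a' ≤ b') (ha : a.1 = a') (hb : b.1 = b') :
    (P.interval x y h).interval a b hab ≃o P.interval a' b' hab' where
  toFun c := ⟨c.1.1, by subst ha hb; exact c.2⟩
  invFun c := ⟨⟨c.1, a.2.1.trans (ha.le.trans c.2.1), (c.2.2.trans hb.ge).trans b.2.2⟩,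
    ⟨ha.le.trans c.2.1, c.2.2.trans hb.ge⟩⟩
  left_inv _ := rfl
  right_inv _ := rfl
  map_rel_iff' := Iff.rfl

/-- An interval of a product is the product of the intervals. -/
def intervalProd {P Q : GradedPoset.{v}} {x y : P} (h : x ≤ y) {x' y' : Q} (h' : x' ≤ y')
    (hp : ((x, x') : P × Q) ≤ (y, y')) :
    (P.prod Q).interval (x, x') (y, y') hp ≃o (P.interval x y h).prod (Q.interval x' y' h') where
  toFun c := (⟨c.1.1, c.2.1.1, c.2.2.1⟩, ⟨c.1.2, c.2.1.2, c.2.2.2⟩)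
  invFun c := ⟨(c.1.1, c.2.1), ⟨c.1.2.1, c.2.2.1⟩, ⟨c.1.2.2, c.2.2.2⟩⟩
  left_inv _ := rfl
  right_inv _ := rfl
  map_rel_iff' := Iff.rfl

/-- The interval `[0, 1]` is the whole poset. -/
def intervalBotTop (P : GradedPoset.{v}) {x y : P} (h : x ≤ y) (hx : x = ⊥) (hy : y = ⊤) :
    P.interval x y h ≃o P where
  toFun c := c.1
  invFun c := ⟨c, hx.le.trans bot_le, le_top.trans hy.ge⟩
  left_inv _ := rfl
  right_inv _ := rfl
  map_rel_iff' := Iff.rfl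

/-- A graded poset with `0 = 1` has one element. -/
def isoPoint {P : GradedPoset.{v}} (h : (⊥ : P) = ⊤) : P ≃o point.{v} where
  toFun _ := PUnit.unit
  invFun _ := ⊥
  left_inv x := le_antisymm bot_le (le_top.trans h.ge)
  right_inv _ := rfl
  map_rel_iff' := by
    intro a b
    exact ⟨fun _ => le_top.trans (h.ge.trans bot_le), fun _ => le_rfl⟩

end GradedPoset

/-- Isomorphism classes of finite graded posets. -/
def GradedPosetClass : Type (v + 1) := Quotient GradedPoset.isoSetoid.{v}

namespace GradedPosetClass

/-- The isomorphism class of a graded poset. -/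
def mk (P : GradedPoset.{v}) : GradedPosetClass.{v} := Quotient.mk _ P

theorem sound {P Q : GradedPoset.{v}} (e : P ≃o Q) : mk P = mk Q := Quotient.sound ⟨e⟩

theorem mk_eq_mk {P Q : GradedPoset.{v}} : mk P = mk Q ↔ Nonempty (P ≃o Q) :=
  ⟨fun h => Quotient.exact h, fun ⟨e⟩ => sound e⟩

theorem ind {p : GradedPosetClass.{v} → Prop} (h : ∀ P, p (mk P)) (c) : p c := Quotient.ind h c

/-- The product of isomorphism classes is the cartesian product of posets; the unit is the poset
with one element. -/
instance : CommMonoid GradedPosetClass.{v} where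
  mul := Quotient.map₂ GradedPoset.prod fun _ _ ⟨e⟩ _ _ ⟨f⟩ => ⟨GradedPoset.prodIso e f⟩
  one := mk GradedPoset.point
  mul_assoc := by
    refine ind fun P => ind fun Q => ind fun R => sound ?_
    exact OrderIso.prodAssoc P Q R
  one_mul := by
    refine ind fun P => sound ?_
    exact ⟨Equiv.punitProd P, by intro a b; exact ⟨fun h => ⟨le_rfl, h⟩, fun h => h.2⟩⟩
  mul_one := by
    refine ind fun P => sound ?_
    exact ⟨Equiv.prodPUnit P, by intro a b; exact ⟨fun h => ⟨h, le_rfl⟩, fun h => h.1⟩⟩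
  mul_comm := by
    refine ind fun P => ind fun Q => sound ?_
    exact OrderIso.prodComm (α := P) (β := Q)

theorem mk_mul_mk (P Q : GradedPoset.{v}) : mk P * mk Q = mk (P.prod Q) := rfl

/-- The rank of an isomorphism class. -/
noncomputable def rank : GradedPosetClass.{v} → ℕ :=
  Quotient.lift GradedPoset.rank fun _ _ ⟨e⟩ => GradedPoset.rank_congr e

theorem rank_mk (P : GradedPoset.{v}) : rank (mk P) = P.rank := rfl

theorem rank_mul (c d : GradedPosetClass.{v}) : rank (c * d) = rank c + rank d := by
  induction c using ind with | h P
  induction d using ind with | h Q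
  exact GradedPoset.rank_prod P Q

theorem mk_eq_one_iff {P : GradedPoset.{v}} : mk P = 1 ↔ (⊥ : P) = ⊤ := by
  constructor
  · intro h
    obtain ⟨e⟩ := mk_eq_mk.1 h
    exact e.injective rfl
  · intro h
    exact sound (GradedPoset.isoPoint h)

theorem eq_one_of_rank_eq_zero {c : GradedPosetClass.{v}} (h : rank c = 0) : c = 1 := by
  induction c using ind with | h P
  exact mk_eq_one_iff.2 (GradedPoset.bot_eq_top_of_rank_eq_zero h)

theorem rank_one : rank (1 : GradedPosetClass.{v}) = 0 := by
  have := rank_mul (1 : GradedPosetClass.{v}) 1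
  rw [one_mul] at this
  omega

theorem mul_eq_one {c d : GradedPosetClass.{v}} : c * d = 1 ↔ c = 1 ∧ d = 1 := by
  constructor
  · intro h
    have h1 := congrArg rank h
    rw [rank_mul, rank_one] at h1
    exact ⟨eq_one_of_rank_eq_zero (by omega), eq_one_of_rank_eq_zero (by omega)⟩
  · rintro ⟨rfl, rfl⟩; exact one_mul 1

end GradedPosetClass

/-- Rota's Hopf algebra: the free module on the isomorphism classes of finite graded posets,
with product induced by the cartesian product of posets. -/
def Rota (k : Type u) [CommRing k] : Type (max u (v + 1)) := MonoidAlgebra k GradedPosetClass.{v}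

namespace Rota

variable (k : Type u) [CommRing k]

noncomputable instance : CommRing (Rota.{u, v} k) :=
  inferInstanceAs (CommRing (MonoidAlgebra k GradedPosetClass.{v}))
noncomputable instance : Algebra k (Rota.{u, v} k) :=
  inferInstanceAs (Algebra k (MonoidAlgebra k GradedPosetClass.{v}))

/-- The basis of isomorphism classes. -/
noncomputable def basis : Module.Basis GradedPosetClass.{v} k (Rota.{u, v} k) :=
  MonoidAlgebra.basis GradedPosetClass.{v} k

/-- The basis element of an isomorphism class, as a morphism of monoids. -/
noncomputable def ofClass : GradedPosetClass.{v} →* Rota.{u, v} k :=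
  MonoidAlgebra.of k GradedPosetClass.{v}

/-- A graded poset, as an element of Rota's Hopf algebra. -/
noncomputable def of (P : GradedPoset.{v}) : Rota.{u, v} k := ofClass k (GradedPosetClass.mk P)

theorem basis_apply (c : GradedPosetClass.{v}) : basis k c = ofClass k c := rfl

variable {k} in
theorem of_congr {P Q : GradedPoset.{v}} (e : P ≃o Q) : of k P = of k Q :=
  congrArg (ofClass k) (GradedPosetClass.sound e)

theorem of_prod (P Q : GradedPoset.{v}) : of k (P.prod Q) = of k P * of k Q :=
  map_mul (ofClass k) (GradedPosetClass.mk P) (GradedPosetClass.mk Q)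

theorem of_eq_one {P : GradedPoset.{v}} (h : (⊥ : P) = ⊤) : of k P = 1 := by
  rw [of, GradedPosetClass.mk_eq_one_iff.2 h, map_one]

/-- The morphism of algebras determined by a multiplicative function of isomorphism classes. -/
noncomputable def lift {A : Type*} [CommRing A] [Algebra k A] (F : GradedPosetClass.{v} →* A) :
    Rota.{u, v} k →ₐ[k] A := MonoidAlgebra.lift k A GradedPosetClass.{v} F

variable {k} in
theorem lift_of {A : Type*} [CommRing A] [Algebra k A] (F : GradedPosetClass.{v} →* A)
    (P : GradedPoset.{v}) : lift k F (of k P) = F (GradedPosetClass.mk P) :=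
  MonoidAlgebra.lift_of F _

variable {k} in
theorem algHom_ext_of {A : Type*} [CommRing A] [Algebra k A] {f g : Rota.{u, v} k →ₐ[k] A}
    (h : ∀ P, f (of k P) = g (of k P)) : f = g :=
  MonoidAlgebra.algHom_ext (GradedPosetClass.ind h) (by ext)

/-- `∑ [0, z] ⊗ [z, 1]`, summed over the elements `z` of the poset. -/
noncomputable def coprod (P : GradedPoset.{v}) : Rota.{u, v} k ⊗[k] Rota.{u, v} k :=
  ∑ z : P, of k (P.interval ⊥ z bot_le) ⊗ₜ[k] of k (P.interval z ⊤ le_top)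

variable {k} in
theorem coprod_congr {P Q : GradedPoset.{v}} (e : P ≃o Q) : coprod k P = coprod k Q := by
  refine Fintype.sum_equiv e.toEquiv _ _ fun z => ?_
  rw [of_congr (GradedPoset.intervalIso e bot_le bot_le (map_bot e) rfl),
    of_congr (GradedPoset.intervalIso e le_top le_top rfl (map_top e))]
  rfl

theorem coprod_point : coprod k GradedPoset.point.{v} = 1 := by
  have : Subsingleton GradedPoset.point.{v} := inferInstanceAs (Subsingleton PUnit)
  rw [coprod, Fintype.sum_subsingleton _ ⊥, of_eq_one, of_eq_one]
  · rfl
  · exact Subtype.ext (Subsingleton.elim _ _)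
  · exact Subtype.ext (Subsingleton.elim _ _)

theorem coprod_prod (P Q : GradedPoset.{v}) :
    coprod k (P.prod Q) = coprod k P * coprod k Q := by
  have h1 : coprod k (P.prod Q) = ∑ z : P × Q,
      of k ((P.prod Q).interval ⊥ z bot_le) ⊗ₜ[k] of k ((P.prod Q).interval z ⊤ le_top) := by
    rw [coprod]
    exact @Fintype.sum_equiv (P.prod Q) (P × Q) _ _ _ _ (Equiv.refl _) _ _ fun _ => rfl
  rw [h1, coprod, coprod, Finset.sum_mul_sum, Fintype.sum_prod_type]
  refine Finset.sum_congr rfl fun z _ => Finset.sum_congr rfl fun w _ => ?_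
  rw [Algebra.TensorProduct.tmul_mul_tmul, ← of_prod, ← of_prod]
  congr 1
  · exact of_congr (GradedPoset.intervalProd bot_le bot_le _)
  · exact of_congr (GradedPoset.intervalProd le_top le_top _)

/-- The coproduct of Rota's Hopf algebra: `Δ(P) = ∑ [0, z] ⊗ [z, 1]`. -/
noncomputable def comulHom : Rota.{u, v} k →ₐ[k] Rota.{u, v} k ⊗[k] Rota.{u, v} k :=
  lift k
    { toFun := Quotient.lift (coprod k) fun _ _ ⟨e⟩ => coprod_congr e
      map_one' := coprod_point k
      map_mul' := GradedPosetClass.ind fun P => GradedPosetClass.ind fun Q => coprod_prod k P Q }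

theorem comulHom_of (P : GradedPoset.{v}) : comulHom k (of k P) = coprod k P := lift_of _ P

open Classical in
/-- The counit: `1` on the one-element poset, `0` on the other posets. -/
noncomputable def counitHom : Rota.{u, v} k →ₐ[k] k :=
  lift k
    { toFun := fun c => if c = 1 then 1 else 0
      map_one' := if_pos rfl
      map_mul' := fun c d => by
        by_cases hc : c = 1 <;> by_cases hd : d = 1 <;>
          simp [GradedPosetClass.mul_eq_one, hc, hd] }

open Classical in
theorem counitHom_of (P : GradedPoset.{v}) :
    counitHom k (of k P) = if (⊥ : P) = ⊤ then 1 else 0 := by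
  rw [counitHom, lift_of]
  exact if_congr GradedPosetClass.mk_eq_one_iff rfl rfl

theorem coassoc_of (P : GradedPoset.{v}) :
    (Algebra.TensorProduct.assoc k k k _ _ _) ((Algebra.TensorProduct.map (comulHom k)
      (AlgHom.id k (Rota.{u, v} k))) (coprod k P)) =
      (Algebra.TensorProduct.map (AlgHom.id k (Rota.{u, v} k)) (comulHom k)) (coprod k P) := by
  rw [coprod, map_sum, map_sum, map_sum]
  simp only [Algebra.TensorProduct.map_tmul, comulHom_of, AlgHom.id_apply]
  simp only [coprod, TensorProduct.sum_tmul, TensorProduct.tmul_sum, map_sum,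
    Algebra.TensorProduct.assoc_tmul]
  rw [Finset.sum_sigma', Finset.sum_sigma']
  refine Finset.sum_bij' (fun z _ => ⟨z.2.1, ⟨z.1, z.2.2.2, le_top⟩⟩)
    (fun z _ => ⟨z.2.1, ⟨z.1, bot_le, z.2.2.1⟩⟩) (fun _ _ => Finset.mem_sigma.2 ⟨Finset.mem_univ _,
      Finset.mem_univ _⟩) (fun _ _ => Finset.mem_sigma.2 ⟨Finset.mem_univ _, Finset.mem_univ _⟩)
    (fun _ _ => rfl) (fun _ _ => rfl) ?_
  rintro ⟨z, w⟩ _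
  rw [of_congr (GradedPoset.intervalInterval bot_le bot_le bot_le rfl rfl),
    of_congr (GradedPoset.intervalInterval bot_le le_top w.2.2 rfl rfl),
    of_congr (GradedPoset.intervalInterval le_top bot_le w.2.2 rfl rfl),
    of_congr (GradedPoset.intervalInterval le_top le_top le_top rfl rfl)]

theorem counit_rTensor_of (P : GradedPoset.{v}) :
    (Algebra.TensorProduct.map (counitHom k) (AlgHom.id k (Rota.{u, v} k))) (coprod k P) =
      1 ⊗ₜ of k P := by
  rw [coprod, map_sum, Finset.sum_eq_single ⊥]
  · rw [Algebra.TensorProduct.map_tmul, counitHom_of,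
      if_pos (show (⊥ : P.interval ⊥ ⊥ bot_le) = ⊤ from Subtype.ext rfl), AlgHom.id_apply,
      of_congr (P.intervalBotTop le_top rfl rfl)]
  · intro z _ hz
    rw [Algebra.TensorProduct.map_tmul, counitHom_of, if_neg, TensorProduct.zero_tmul]
    intro h
    exact hz (congrArg Subtype.val h).symm
  · simp

theorem counit_lTensor_of (P : GradedPoset.{v}) :
    (Algebra.TensorProduct.map (AlgHom.id k (Rota.{u, v} k)) (counitHom k)) (coprod k P) =
      of k P ⊗ₜ 1 := by
  rw [coprod, map_sum, Finset.sum_eq_single ⊤]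
  · rw [Algebra.TensorProduct.map_tmul, counitHom_of,
      if_pos (show (⊥ : P.interval ⊤ ⊤ le_top) = ⊤ from Subtype.ext rfl), AlgHom.id_apply,
      of_congr (P.intervalBotTop bot_le rfl rfl)]
  · intro z _ hz
    rw [Algebra.TensorProduct.map_tmul, counitHom_of, if_neg, TensorProduct.tmul_zero]
    intro h
    exact hz (congrArg Subtype.val h)
  · simp

noncomputable instance : Bialgebra k (Rota.{u, v} k) :=
  Bialgebra.ofAlgHom (comulHom k) (counitHom k)
    (algHom_ext_of fun P => by
      simp only [AlgHom.comp_apply, comulHom_of]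
      exact coassoc_of k P)
    (algHom_ext_of fun P => by
      rw [AlgHom.comp_apply, comulHom_of]
      exact counit_rTensor_of k P)
    (algHom_ext_of fun P => by
      rw [AlgHom.comp_apply, comulHom_of]
      exact counit_lTensor_of k P)

/-- The homogeneous component of degree `n`, spanned by the posets of rank `n`. -/
noncomputable def grading (n : ℕ) : Submodule k (Rota.{u, v} k) :=
  basisGrading (basis k) GradedPosetClass.rank n

noncomputable instance : GradedAlgebra (grading.{u, v} k) :=
  gradedAlgebraOfBasis (basis k) GradedPosetClass.rank
    (by
      have := basis_mem_basisGrading (basis.{u, v} k) GradedPosetClass.rank 1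
      rw [GradedPosetClass.rank_one, basis_apply, map_one] at this
      exact this)
    (fun c d => by
      have := basis_mem_basisGrading (basis.{u, v} k) GradedPosetClass.rank (c * d)
      rw [GradedPosetClass.rank_mul, basis_apply, map_mul] at this
      exact this)

noncomputable instance : HopfAlgebra k (Rota.{u, v} k) :=
  hopfAlgebraOfBasis (basis k) GradedPosetClass.rank
    (fun c hc => by
      rw [GradedPosetClass.eq_one_of_rank_eq_zero hc, basis_apply, map_one])
    (GradedPosetClass.ind fun P => by
      change comulHom k (of k P) ∈ _
      rw [comulHom_of, coprod]
      exact sum_mem fun z _ => Submodule.subset_span ⟨GradedPosetClass.mk (P.interval ⊥ z bot_le),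
        GradedPosetClass.mk (P.interval z ⊤ le_top), P.rank_interval_add z, rfl⟩)

end Rota

namespace QSym

variable (k : Type*) [CommRing k]

theorem coeff_M (α β : List ℕ+) : coeff (M k α) β = if α = β then 1 else 0 := by
  classical
  rw [coeff, M, Module.Basis.repr_self, Finsupp.single_apply]

theorem coeff_add (x y : QSym k) (α : List ℕ+) : coeff (x + y) α = coeff x α + coeff y α := by
  simp [coeff]

theorem coeff_smul (r : k) (x : QSym k) (α : List ℕ+) : coeff (r • x) α = r * coeff x α := by
  simp [coeff]

theorem coeff_zero (α : List ℕ+) : coeff (0 : QSym k) α = 0 := by simp [coeff]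

theorem coeff_sum {ι : Type*} (s : Finset ι) (x : ι → QSym k) (α : List ℕ+) :
    coeff (∑ i ∈ s, x i) α = ∑ i ∈ s, coeff (x i) α := by simp [coeff]

theorem coeff_nil (x : QSym k) : coeff x [] = counitMap k x := by
  induction x using induction_M with
  | zero => simp [coeff_zero]
  | add x y h h' => rw [coeff_add, h, h', map_add]
  | smul r x h => rw [coeff_smul, h, map_smul]; rfl
  | M α => rw [coeff_M, counitMap_M]

/-- The canonical character `ζ_Q`: it sends `M_α` to `1` if `α` has at most one part, and to `0`
otherwise. It is the evaluation at `x₁ = 1`, `xᵢ = 0` for `i ≠ 1`. -/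
noncomputable def zetaMap : QSym k →ₗ[k] k :=
  (basis k).constr k fun α => if α.length ≤ 1 then 1 else 0

theorem zetaMap_M (α : List ℕ+) : zetaMap k (M k α) = if α.length ≤ 1 then 1 else 0 :=
  (basis k).constr_basis k _ α

theorem zetaMap_consOp (a : ℕ+) (x : QSym k) : zetaMap k (consOp k a x) = counitMap k x := by
  have : zetaMap k ∘ₗ consOp k a = counitMap k := ext_M fun α => by
    rw [LinearMap.comp_apply, consOp_M, zetaMap_M, counitMap_M]
    simp
  exact congr($this x)

theorem zetaMap_mul (x y : QSym k) : zetaMap k (x * y) = zetaMap k x * zetaMap k y := by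
  have : (mulMap k).compr₂ (zetaMap k) =
      (LinearMap.mul k k).compl₁₂ (zetaMap k) (zetaMap k) := by
    refine ext_M fun α => ext_M fun β => ?_
    simp only [LinearMap.compr₂_apply, LinearMap.compl₁₂_apply, ← mul_def, LinearMap.mul_apply']
    rcases α with _ | ⟨a, α⟩
    · rw [← one_def, one_mul, one_def]; simp [zetaMap_M]
    rcases β with _ | ⟨b, β⟩
    · rw [← one_def, mul_one, one_def]; simp [zetaMap_M]
    simp only [← consOp_M, consOp_mul_consOp, map_add, zetaMap_consOp, counitMap_mul,
      counitMap_consOp]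
    simp
  exact congr($this x y)

/-- The canonical character `ζ_Q` as a morphism of algebras. -/
noncomputable def zeta : QSym k →ₐ[k] k :=
  AlgHom.ofLinearMap (zetaMap k) (by rw [one_def, zetaMap_M]; rfl) (zetaMap_mul k)

/-- The composition obtained from a list of natural numbers by omitting the zero parts. -/
def omitZeros (l : List ℕ) : List ℕ+ :=
  l.filterMap fun n => if h : 0 < n then some ⟨n, h⟩ else none

theorem omitZeros_cons_zero (l : List ℕ) : omitZeros (0 :: l) = omitZeros l := rfl

theorem omitZeros_cons_pos (a : ℕ+) (l : List ℕ) :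
    omitZeros ((a : ℕ) :: l) = a :: omitZeros l := by
  rw [omitZeros, List.filterMap_cons_some (b := a)]
  · rfl
  · rw [dif_pos a.pos]; rfl

theorem omitZeros_map_coe (α : List ℕ+) : omitZeros (α.map fun a : ℕ+ => (a : ℕ)) = α := by
  induction α with
  | nil => rfl
  | cons a α ih => rw [List.map_cons, omitZeros_cons_pos, ih]

theorem size_omitZeros (l : List ℕ) : size (omitZeros l) = l.sum := by
  induction l with
  | nil => rfl
  | cons a l ih =>
    rcases Nat.eq_zero_or_pos a with rfl | ha
    · rw [omitZeros_cons_zero, ih]; simp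
    · lift a to ℕ+ using ha
      rw [omitZeros_cons_pos, size_cons, ih, List.sum_cons]

/-- The finite set of all compositions of `n`. -/
def compositions (n : ℕ) : Finset (List ℕ+) :=
  Finset.univ.image fun c : Composition n => omitZeros c.blocks

theorem mem_compositions {n : ℕ} {α : List ℕ+} : α ∈ compositions n ↔ size α = n := by
  simp only [compositions, Finset.mem_image, Finset.mem_univ, true_and]
  constructor
  · rintro ⟨c, rfl⟩; rw [size_omitZeros, c.blocks_sum]
  · intro h
    refine ⟨⟨α.map fun a : ℕ+ => (a : ℕ), ?_, h⟩, omitZeros_map_coe α⟩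
    intro i hi
    obtain ⟨a, _, rfl⟩ := List.mem_map.1 hi
    exact a.pos

section PowerSeries

/-- The composition formed by the nonzero exponents of a monomial, in the order of the variables.
-/
noncomputable def shape (m : ℕ →₀ ℕ) : List ℕ+ := omitZeros ((m.support.sort (· ≤ ·)).map m)

theorem shape_zero : shape 0 = [] := by simp [shape, omitZeros]

theorem shape_single_add (j : ℕ) (c : ℕ+) (m : ℕ →₀ ℕ) (hm : ∀ i ∈ m.support, j < i) :
    shape (Finsupp.single j (c : ℕ) + m) = c :: shape m := by
  have hj : j ∉ m.support := fun h => lt_irrefl _ (hm j h)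
  have hsupp : (Finsupp.single j (c : ℕ) + m).support = insert j m.support := by
    ext i
    simp only [Finsupp.mem_support_iff, Finsupp.add_apply, Finset.mem_insert, Finsupp.single_apply]
    by_cases h : j = i
    · subst h; simp
    · simp [h, Ne.symm h]
  rw [shape, hsupp, Finset.sort_insert (· ≤ ·) (fun b hb => (hm b hb).le) hj, List.map_cons]
  have hmj : m j = 0 := Finsupp.notMem_support_iff.1 hj
  have h1 : (Finsupp.single j (c : ℕ) + m) j = c := by simp [hmj]
  rw [h1, omitZeros_cons_pos, shape]
  congr 2
  refine List.map_congr_left fun i hi => ?_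
  have : j ≠ i := (hm i ((Finset.mem_sort _).1 hi)).ne
  simp [this]

/-- The operator on quasi-symmetric functions taking the coefficient of `x₁ ^ c`. -/
noncomputable def headOp (c : ℕ) : QSym k →ₗ[k] QSym k :=
  (basis k).constr k fun α =>
    match α with
    | [] => if c = 0 then M k [] else 0
    | a :: α => if c = 0 then M k (a :: α) else if (a : ℕ) = c then M k α else 0

theorem headOp_M (c : ℕ) (α : List ℕ+) : headOp k c (M k α) =
    match α with
    | [] => if c = 0 then M k [] else 0
    | a :: α => if c = 0 then M k (a :: α) else if (a : ℕ) = c then M k α else 0 :=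
  (basis k).constr_basis k _ α

theorem headOp_zero (x : QSym k) : headOp k 0 x = x := by
  have : headOp k 0 = LinearMap.id := ext_M fun α => by
    rw [headOp_M]; cases α <;> rfl
  rw [this]; rfl

theorem headOp_one (c : ℕ) (hc : c ≠ 0) : headOp k c 1 = 0 := by
  rw [one_def, headOp_M]; simp [hc]

theorem headOp_consOp (c : ℕ) (hc : c ≠ 0) (a : ℕ+) (x : QSym k) :
    headOp k c (consOp k a x) = if (a : ℕ) = c then x else 0 := by
  have : headOp k c ∘ₗ consOp k a = if (a : ℕ) = c then LinearMap.id else 0 := ext_M fun α => by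
    rw [LinearMap.comp_apply, consOp_M, headOp_M]
    simp only [hc, if_false]
    split_ifs <;> rfl
  rw [← LinearMap.comp_apply, this]
  split_ifs <;> rfl

theorem coeff_headOp (c : ℕ+) (x : QSym k) (α : List ℕ+) :
    coeff (headOp k c x) α = coeff x (c :: α) := by
  induction x using induction_M with
  | zero => simp [coeff_zero]
  | add x y h h' => rw [map_add, coeff_add, coeff_add, h, h']
  | smul r x h => rw [map_smul, coeff_smul, coeff_smul, h]
  | M β =>
    rw [headOp_M]
    rcases β with _ | ⟨b, β⟩
    · simp [coeff_zero, coeff_M]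
    · by_cases hb : b = c
      · simp [hb, coeff_M]
      · simp [hb, coeff_M, coeff_zero]

theorem headOp_mul (c : ℕ) (x y : QSym k) : headOp k c (x * y) =
    ∑ p ∈ Finset.HasAntidiagonal.antidiagonal c, headOp k p.1 x * headOp k p.2 y := by
  rcases Nat.eq_zero_or_pos c with rfl | hc
  · simp [headOp_zero]
  induction x using induction_M with
  | zero => simp
  | add x x' h h' => simp only [add_mul, map_add, h, h', Finset.sum_add_distrib]
  | smul r x h => simp only [smul_mul_assoc, map_smul, h, Finset.smul_sum]
  | M α =>
    induction y using induction_M with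
    | zero => simp
    | add x x' h h' => simp only [mul_add, map_add, h, h', Finset.sum_add_distrib]
    | smul r x h => simp only [mul_smul_comm, map_smul, h, Finset.smul_sum]
    | M β =>
      rcases α with _ | ⟨a, α⟩
      · rw [← one_def, one_mul, Finset.sum_eq_single (0, c)]
        · rw [headOp_zero, one_mul]
        · rintro ⟨i, j⟩ hij hne
          have hij' := Finset.HasAntidiagonal.mem_antidiagonal.1 hij
          have : i ≠ 0 := by rintro rfl; exact hne (by simpa using hij')
          rw [headOp_one k i this, zero_mul]
        · simp
      rcases β with _ | ⟨b, β⟩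
      · rw [← one_def, mul_one, Finset.sum_eq_single (c, 0)]
        · rw [headOp_zero, mul_one]
        · rintro ⟨i, j⟩ hij hne
          have hij' := Finset.HasAntidiagonal.mem_antidiagonal.1 hij
          have : j ≠ 0 := by rintro rfl; exact hne (by simpa using hij')
          rw [headOp_one k j this, mul_zero]
        · simp
      rw [← consOp_M, ← consOp_M, consOp_mul_consOp, map_add, map_add, headOp_consOp k c hc.ne',
        headOp_consOp k c hc.ne', headOp_consOp k c hc.ne']
      obtain ⟨d, rfl⟩ : ∃ d, c = d + 1 := ⟨c - 1, by omega⟩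
      rcases d with _ | d
      · have ha := a.pos
        have hb := b.pos
        have h3 : ¬ ((a + b : ℕ+) : ℕ) = 0 + 1 := by push_cast; omega
        rw [if_neg h3, zero_add, Finset.Nat.antidiagonal_succ]
        simp [headOp_M, add_comm]
      · rw [Finset.Nat.antidiagonal_succ_succ']
        simp only [Finset.sum_cons, Finset.sum_map, headOp_zero, Function.Embedding.coe_prodMap,
          Prod.map_fst, Prod.map_snd, Function.Embedding.coeFn_mk]
        rw [headOp_consOp k _ (by omega), headOp_consOp k _ (by omega)]
        have : ∑ p ∈ Finset.HasAntidiagonal.antidiagonal d, headOp k (p.1 + 1) (consOp k a (M k α)) *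
            headOp k (p.2 + 1) (consOp k b (M k β)) =
            if ((a + b : ℕ+) : ℕ) = d + 1 + 1 then M k α * M k β else 0 := by
          simp only [headOp_consOp k _ (Nat.succ_ne_zero _)]
          have ha := a.pos
          have hb := b.pos
          split_ifs with hab
          · rw [Finset.sum_eq_single ((a : ℕ) - 1, (b : ℕ) - 1)]
            · rw [if_pos (by omega), if_pos (by omega)]
            · rintro ⟨i, j⟩ _ hne
              by_cases h1 : (a : ℕ) = i + 1
              · by_cases h2 : (b : ℕ) = j + 1
                · exact absurd (by simp [h1, h2]) hne
                · simp [h2]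
              · simp [h1]
            · intro h
              rw [PNat.add_coe] at hab
              exact absurd (Finset.HasAntidiagonal.mem_antidiagonal.2 (by simp only; omega)) h
          · refine Finset.sum_eq_zero ?_
            rintro ⟨i, j⟩ hij
            have hij' := Finset.HasAntidiagonal.mem_antidiagonal.1 hij
            simp only at hij'
            rw [PNat.add_coe] at hab
            by_cases h1 : (a : ℕ) = i + 1
            · rw [if_neg (show ¬ (b : ℕ) = j + 1 by omega), mul_zero]
            · rw [if_neg h1, zero_mul]
        simp only [Nat.succ_eq_add_one] at this ⊢
        rw [this]
        split_ifs <;> simp <;> abel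

theorem sum_antidiagonal_single_add {A : Type*} [AddCommMonoid A] (j c : ℕ) (m : ℕ →₀ ℕ)
    (hm : m j = 0) (F : (ℕ →₀ ℕ) → (ℕ →₀ ℕ) → A) :
    ∑ p ∈ Finset.HasAntidiagonal.antidiagonal (Finsupp.single j c + m), F p.1 p.2 =
      ∑ q ∈ Finset.HasAntidiagonal.antidiagonal c, ∑ p ∈ Finset.HasAntidiagonal.antidiagonal m,
        F (Finsupp.single j q.1 + p.1) (Finsupp.single j q.2 + p.2) := by
  rw [← Finset.sum_product']
  refine Finset.sum_bij' (fun p _ => ((p.1 j, p.2 j), (p.1.erase j, p.2.erase j)))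
    (fun q _ => (Finsupp.single j q.1.1 + q.2.1, Finsupp.single j q.1.2 + q.2.2)) ?_ ?_ ?_ ?_ ?_
  · rintro ⟨p, q⟩ hpq
    have h := Finset.HasAntidiagonal.mem_antidiagonal.1 hpq
    simp only [Finset.mem_product, Finset.HasAntidiagonal.mem_antidiagonal]
    constructor
    · have := DFunLike.congr_fun h j
      simpa [hm] using this
    · ext i
      have := DFunLike.congr_fun h i
      by_cases hi : i = j
      · subst hi; simp [hm]
      · simpa [hi, Finsupp.single_apply, Ne.symm hi] using this
  · rintro ⟨⟨a, b⟩, ⟨p, q⟩⟩ h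
    simp only [Finset.mem_product, Finset.HasAntidiagonal.mem_antidiagonal] at h
    rw [Finset.HasAntidiagonal.mem_antidiagonal, ← h.1, ← h.2, Finsupp.single_add]
    exact add_add_add_comm _ _ _ _
  · rintro ⟨p, q⟩ _
    exact Prod.ext (Finsupp.single_add_erase j p) (Finsupp.single_add_erase j q)
  · rintro ⟨⟨a, b⟩, ⟨p, q⟩⟩ h
    simp only [Finset.mem_product, Finset.HasAntidiagonal.mem_antidiagonal] at h
    have h2 := DFunLike.congr_fun h.2 j
    rw [hm, Finsupp.add_apply] at h2
    have hp : p j = 0 := by omega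
    have hq : q j = 0 := by omega
    have e1 : p.erase j = p := Finsupp.erase_of_notMem_support (by simpa using hp)
    have e2 : q.erase j = q := Finsupp.erase_of_notMem_support (by simpa using hq)
    simp [hp, hq, e1, e2]
  · rintro ⟨p, q⟩ _
    exact congrArg₂ F (Finsupp.single_add_erase j p).symm (Finsupp.single_add_erase j q).symm

theorem exists_eq_single_add (m : ℕ →₀ ℕ) (hm : m ≠ 0) : ∃ (j : ℕ) (c : ℕ+) (m' : ℕ →₀ ℕ),
    m = Finsupp.single j (c : ℕ) + m' ∧ (∀ i ∈ m'.support, j < i) ∧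
      m'.support.card < m.support.card := by
  have hne : m.support.Nonempty := Finsupp.support_nonempty_iff.2 hm
  let j := m.support.min' hne
  have hj : j ∈ m.support := m.support.min'_mem hne
  refine ⟨j, ⟨m j, Nat.pos_of_ne_zero (Finsupp.mem_support_iff.1 hj)⟩, m.erase j, ?_, ?_, ?_⟩
  · exact (Finsupp.single_add_erase j m).symm
  · intro i hi
    rw [Finsupp.support_erase, Finset.mem_erase] at hi
    exact lt_of_le_of_ne (m.support.min'_le i hi.2) (Ne.symm hi.1)
  · rw [Finsupp.support_erase]
    exact Finset.card_erase_lt_of_mem hj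

theorem coeff_mul_shape (m : ℕ →₀ ℕ) (x y : QSym k) : coeff (x * y) (shape m) =
    ∑ p ∈ Finset.HasAntidiagonal.antidiagonal m, coeff x (shape p.1) * coeff y (shape p.2) := by
  induction h : m.support.card using Nat.strong_induction_on generalizing m x y with
  | _ n ih =>
    subst h
    by_cases hm : m = 0
    · subst hm
      simp [shape_zero, coeff_nil, counitMap_mul]
    obtain ⟨j, c, m', rfl, hlt, hcard⟩ := exists_eq_single_add m hm
    have hj : m' j = 0 := Finsupp.notMem_support_iff.1 fun h => lt_irrefl _ (hlt j h)
    rw [shape_single_add j c m' hlt, ← coeff_headOp, headOp_mul, coeff_sum,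
      sum_antidiagonal_single_add j c m' hj fun p q => coeff x (shape p) * coeff y (shape q)]
    have key : ∀ (d : ℕ) (z : QSym k) (p : ℕ →₀ ℕ), (∀ i ∈ p.support, j < i) →
        coeff z (shape (Finsupp.single j d + p)) = coeff (headOp k d z) (shape p) := by
      intro d z p hp
      rcases Nat.eq_zero_or_pos d with rfl | hd
      · simp [headOp_zero]
      · lift d to ℕ+ using hd
        rw [shape_single_add j d p hp, coeff_headOp]
    refine Finset.sum_congr rfl fun q _ => ?_
    rw [ih _ hcard m' _ _ rfl]
    refine Finset.sum_congr rfl fun p hp => ?_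
    have hpm := Finset.HasAntidiagonal.mem_antidiagonal.1 hp
    have hle1 : p.1 ≤ m' := hpm ▸ le_self_add
    have hle2 : p.2 ≤ m' := hpm ▸ le_add_self
    rw [key, key]
    · exact fun i hi => hlt i (Finsupp.support_mono hle2 hi)
    · exact fun i hi => hlt i (Finsupp.support_mono hle1 hi)

/-- The realization of quasi-symmetric functions as formal power series in `x₀, x₁, x₂, …`: the
coefficient of a monomial is the coefficient of `M_α`, for `α` the composition formed by the nonzero
exponents. Thus `M_α` is sent to the sum of the monomials `x_{i₁} ^ a₁ ⋯ x_{i_k} ^ a_k` with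
`i₁ < ⋯ < i_k`. -/
noncomputable def toPowerSeries : QSym k →ₐ[k] MvPowerSeries ℕ k :=
  AlgHom.ofLinearMap
    { toFun := fun x => fun m => coeff x (shape m)
      map_add' := fun x y => funext fun m => coeff_add k x y _
      map_smul' := fun r x => funext fun m => coeff_smul k r x _ }
    (by
      classical
      ext m
      rw [MvPowerSeries.coeff_one]
      change coeff (M k []) (shape m) = _
      rw [coeff_M]
      by_cases hm : m = 0
      · subst hm; simp [shape_zero]
      · obtain ⟨j, c, m', rfl, hlt, _⟩ := exists_eq_single_add m hm
        rw [shape_single_add j c m' hlt, if_neg hm]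
        simp)
    (fun x y => by
      classical
      ext m
      rw [MvPowerSeries.coeff_mul]
      exact coeff_mul_shape k m x y)

theorem coeff_toPowerSeries_M (α : List ℕ+) (m : ℕ →₀ ℕ) :
    MvPowerSeries.coeff m (toPowerSeries k (M k α)) = if α = shape m then 1 else 0 :=
  coeff_M k α (shape m)

theorem exists_shape_eq (α : List ℕ+) (s : ℕ) :
    ∃ m : ℕ →₀ ℕ, (∀ i ∈ m.support, s < i) ∧ shape m = α := by
  induction α generalizing s with
  | nil => exact ⟨0, by simp, shape_zero⟩
  | cons a α ih =>
    obtain ⟨m, hm, rfl⟩ := ih (s + 1)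
    refine ⟨Finsupp.single (s + 1) (a : ℕ) + m, fun i hi => ?_, shape_single_add _ a m hm⟩
    rcases Finset.mem_union.1 (Finsupp.support_add hi) with h | h
    · have := Finset.mem_singleton.1 (Finsupp.support_single_subset h); omega
    · have := hm i h; omega

theorem toPowerSeries_injective : Function.Injective (toPowerSeries k) := by
  intro x y h
  apply (basis k).repr.injective
  ext α
  obtain ⟨m, _, rfl⟩ := exists_shape_eq α 0
  exact congr_fun h m

end PowerSeries

end QSym

/-- The zeta character of Rota's Hopf algebra: `ζ(P) = 1` for every graded poset `P`. -/
noncomputable def Rota.zeta (k : Type u) [CommRing k] : Rota.{u, v} k →ₐ[k] k := Rota.lift k 1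

theorem Rota.zeta_of (k : Type u) [CommRing k] (P : GradedPoset.{v}) :
    Rota.zeta k (Rota.of k P) = 1 := Rota.lift_of 1 P

namespace GradedPoset

/-- A graded poset is eulerian if `μ(x, y) = (-1) ^ rank [x, y]` for all `x < y`. -/
def IsEulerian (P : GradedPoset.{v}) : Prop :=
  ∀ (x y : P) (h : x < y), IncidenceAlgebra.mu ℤ x y = (-1) ^ (P.interval x y h.le).rank

/-- The flag `f`-vector: `f_α(P)` is the number of chains `0 = z₀ < z₁ < ⋯ < z_k = 1` in `P`
such that the rank of `[z_{i-1}, z_i]` is the `i`-th part of `α`, for all `i`. -/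
noncomputable def flagVector (P : GradedPoset.{v}) (α : List ℕ+) : ℕ :=
  Nat.card {z : Fin (α.length + 1) → P // StrictMono z ∧ z 0 = ⊥ ∧ z (Fin.last _) = ⊤ ∧
    ∀ i : Fin α.length, posetRank (Set.Icc (z i.castSucc) (z i.succ)) = (α.get i : ℕ)}

end GradedPoset

/-- The subspace of Rota's Hopf algebra spanned by the eulerian posets. -/
noncomputable def Rota.eulerianSubspace (k : Type u) [CommRing k] : Submodule k (Rota.{u, v} k) :=
  Submodule.span k {x | ∃ P : GradedPoset.{v}, P.IsEulerian ∧ x = Rota.of k P}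

namespace GradedHopf

variable {k H : Type*} [CommRing k] [Ring H] [HopfAlgebra k H]

/-- The Möbius functional `ζ⁻¹ = ζ ∘ S`: the inverse of a character for the convolution product. -/
noncomputable def inverse (φ : H →ₗ[k] k) : H →ₗ[k] k := φ ∘ₗ HopfAlgebra.antipode k

/-- The convolution product of two linear functionals. -/
noncomputable def convolution (φ ψ : H →ₗ[k] k) : H →ₗ[k] k :=
  (WithConv.toConv φ * WithConv.toConv ψ).ofConv

/-- The map `(id ⊗ φ ⊗ id) ∘ Δ⁽²⁾ : H → H ⊗ k ⊗ H = H ⊗ H`. -/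
noncomputable def applyMiddle (φ : H →ₗ[k] k) : H →ₗ[k] H ⊗[k] H :=
  ((TensorProduct.lid k H).toLinearMap ∘ₗ φ.rTensor H).lTensor H ∘ₗ
    (Coalgebra.comul (R := k)).lTensor H ∘ₗ Coalgebra.comul

variable (𝒜 : ℕ → Submodule k H) [GradedAlgebra 𝒜]

/-- The canonical involution of a graded algebra: `h ↦ (-1) ^ n h` for `h` homogeneous of degree
`n`. -/
noncomputable def involution : H →ₗ[k] H :=
  DirectSum.toModule k ℕ H (fun n => (-1 : k) ^ n • (𝒜 n).subtype) ∘ₗ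
    (DirectSum.decomposeLinearEquiv 𝒜).toLinearMap

/-- The conjugate `φ̄` of a linear functional: `φ̄(h) = (-1) ^ n φ(h)` for `h` of degree `n`. -/
noncomputable def conjugate (φ : H →ₗ[k] k) : H →ₗ[k] k := φ ∘ₗ involution 𝒜

/-- The Euler functional `χ = ζ̄ ζ` (convolution product). -/
noncomputable def euler (ζ : H →ₗ[k] k) : H →ₗ[k] k := convolution (conjugate 𝒜 ζ) ζ

/-- A graded subcoalgebra: `Δ(C) ⊆ C ⊗ C`, and `C` contains the homogeneous components of its
elements. -/
def IsGradedSubcoalgebra (C : Submodule k H) : Prop :=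
  (∀ h ∈ C, Coalgebra.comul (R := k) h ∈
    LinearMap.range (TensorProduct.map C.subtype C.subtype)) ∧
  ∀ h ∈ C, ∀ n : ℕ, (DirectSum.decompose 𝒜 h n : H) ∈ C

/-- `S(φ, ψ)`: the largest graded subcoalgebra on which `φ` and `ψ` agree, that is, the sum of all
of them. -/
noncomputable def agreementSubcoalgebra (φ ψ : H →ₗ[k] k) : Submodule k H :=
  sSup {C | IsGradedSubcoalgebra 𝒜 C ∧ ∀ h ∈ C, φ h = ψ h}

/-- The odd subalgebra `S₋(H, ζ) = S(ζ̄, ζ⁻¹)`. -/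
noncomputable def oddSubalgebra (ζ : H →ₐ[k] k) : Submodule k H :=
  agreementSubcoalgebra 𝒜 (conjugate 𝒜 ζ.toLinearMap) (inverse ζ.toLinearMap)

/-- The functional `ζ̄ - ζ⁻¹` of the first form of the generalized Dehn-Sommerville relations. -/
noncomputable def dehnSommervilleFunctional (ζ : H →ₐ[k] k) : H →ₗ[k] k :=
  conjugate 𝒜 ζ.toLinearMap - inverse ζ.toLinearMap

/-- The functional `χ - ε` of the second form of the generalized Dehn-Sommerville relations. -/
noncomputable def eulerFunctional (ζ : H →ₐ[k] k) : H →ₗ[k] k :=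
  euler 𝒜 ζ.toLinearMap - Coalgebra.counit

theorem involution_apply {n : ℕ} {h : H} (hh : h ∈ 𝒜 n) : involution 𝒜 h = (-1 : k) ^ n • h := by
  rw [involution, LinearMap.comp_apply, LinearEquiv.coe_coe, DirectSum.decomposeLinearEquiv_apply,
    DirectSum.decompose_of_mem 𝒜 hh]
  exact DirectSum.toModule_lof k n _

end GradedHopf

namespace QSym

variable {R : Type*} [Ring R]

/-- For a family `f` indexed by compositions, a composition `α = (a₁, …, a_k)` and an index `i`:
`B_{α,i} = ∑_{j=0}^{a_i} (-1)^j f_{(a₁, …, a_{i-1}, j, a_i - j, a_{i+1}, …, a_k)}`, where zero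
parts are omitted. -/
def bayerBillera (f : List ℕ+ → R) (α : List ℕ+) (i : Fin α.length) : R :=
  ∑ j ∈ Finset.range ((α.get i : ℕ) + 1), (-1) ^ j *
    f (α.take i ++ omitZeros [j, (α.get i : ℕ) - j] ++ α.drop (i + 1))

/-- `E_{α,i} = (-1)^{a_i} f_α - ∑_β (-1)^{k(β)} f_{(a₁, …, a_{i-1}, β, a_{i+1}, …, a_k)}`, where
`β` runs over the compositions of `a_i`, and `k(β)` is the number of parts of `β`. -/
def dehnSommerville (f : List ℕ+ → R) (α : List ℕ+) (i : Fin α.length) : R :=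
  (-1) ^ (α.get i : ℕ) * f α -
    ∑ β ∈ compositions (α.get i), (-1) ^ β.length * f (α.take i ++ β ++ α.drop (i + 1))

end QSym

open GradedHopf

/-!
The odd subalgebra is controlled by functionals applied to the middle factor of the iterated
coproduct. For any functional `φ`, the map `(id ⊗ φ ⊗ id) Δ⁽²⁾` is `id ⊗ leftAct φ` after `Δ`, where
`leftAct φ = (φ ⊗ id) Δ`, and `leftAct` turns convolution products into compositions. As
`χ - ε = (ζ̄ - ζ⁻¹) ζ` and `ζ` is invertible, the two forms of the generalized Dehn-Sommerville
relations are equivalent in any graded Hopf algebra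
(`applyMiddle_dehnSommervilleFunctional_eq_zero_iff`), and they hold on every graded subcoalgebra
on which `ζ̄ = ζ⁻¹`.

In `QSym` the coproduct deconcatenates, so the coefficient of `M_β ⊗ M_δ` in `Δ(x)` is the
coefficient `f_{βδ}(x)` (`QSym.pairing_comul`), and the coefficient of `M_β ⊗ M_δ` in
`(id ⊗ φ ⊗ id) Δ⁽²⁾(x)` is `φ` applied to `∑ f_{βγδ}(x) M_γ` (`QSym.pairing_applyMiddle`). With the
values of the two functionals on the monomial basis, this gives the relations in coordinates.
Conversely, the relations attached to a functional cut out a subspace `QSym.annihilated` which is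
visibly graded, and which is stable under removing initial or final parts of compositions; hence it
is a graded subcoalgebra on which the functional vanishes, and a solution of the relations belongs
to the odd subalgebra.

In Rota's Hopf algebra, `ζ⁻¹` is the Möbius function (`Rota.inverse_zeta_interval`), so `ζ̄ = ζ⁻¹`
on eulerian posets; intervals of eulerian posets being eulerian, their span is a graded
subcoalgebra. The flag `f`-vector satisfies a recursion on the first element of a chain above the
minimum (`GradedPoset.flagVector_cons`) and a splitting rule at an intermediate element
(`GradedPoset.flagVector_append`). These make `P ↦ ∑ f_α(P) M_α` a morphism for the product
(`GradedPoset.flagQSym_prod`) and for the coproduct (`GradedPoset.comul_flagQSym`). Morphisms of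
combinatorial Hopf algebras preserve odd subalgebras (`map_mem_oddSubalgebra`), which yields the
Bayer-Billera relations for eulerian posets.
-/

/-! ### Functionals acting on a Hopf algebra -/

namespace GradedHopf

variable {k H : Type*} [CommRing k] [Ring H] [HopfAlgebra k H]

/-- The operator `(φ ⊗ id) ∘ Δ` on `H`. -/
noncomputable def leftAct (φ : H →ₗ[k] k) : H →ₗ[k] H :=
  (TensorProduct.lid k H).toLinearMap ∘ₗ φ.rTensor H ∘ₗ Coalgebra.comul

/-- The operator `(id ⊗ φ) ∘ Δ` on `H`. -/
noncomputable def rightAct (φ : H →ₗ[k] k) : H →ₗ[k] H :=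
  (TensorProduct.rid k H).toLinearMap ∘ₗ φ.lTensor H ∘ₗ Coalgebra.comul

/-- The functional `x ⊗ y ↦ φ x * ψ y` on `H ⊗ H`. -/
noncomputable def pairing (φ ψ : H →ₗ[k] k) : H ⊗[k] H →ₗ[k] k :=
  LinearMap.mul' k k ∘ₗ TensorProduct.map φ ψ

@[simp] theorem pairing_tmul (φ ψ : H →ₗ[k] k) (x y : H) :
    pairing φ ψ (x ⊗ₜ y) = φ x * ψ y := by simp [pairing]

theorem pairing_lTensor (φ ψ : H →ₗ[k] k) (f : H →ₗ[k] H) (t : H ⊗[k] H) :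
    pairing φ ψ (f.lTensor H t) = pairing φ (ψ ∘ₗ f) t := by
  have : pairing φ ψ ∘ₗ f.lTensor H = pairing φ (ψ ∘ₗ f) := by ext x y; simp
  exact congr($this t)

theorem pairing_rTensor (φ ψ : H →ₗ[k] k) (f : H →ₗ[k] H) (t : H ⊗[k] H) :
    pairing φ ψ (f.rTensor H t) = pairing (φ ∘ₗ f) ψ t := by
  have : pairing φ ψ ∘ₗ f.rTensor H = pairing (φ ∘ₗ f) ψ := by ext x y; simp
  exact congr($this t)

theorem apply_leftAct (φ ψ : H →ₗ[k] k) (x : H) :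
    ψ (leftAct φ x) = pairing φ ψ (Coalgebra.comul x) := by
  have : ψ ∘ₗ (TensorProduct.lid k H).toLinearMap ∘ₗ φ.rTensor H = pairing φ ψ := by
    ext x y; simp
  exact congr($this (Coalgebra.comul x))

theorem apply_rightAct (φ ψ : H →ₗ[k] k) (x : H) :
    φ (rightAct ψ x) = pairing φ ψ (Coalgebra.comul x) := by
  have : φ ∘ₗ (TensorProduct.rid k H).toLinearMap ∘ₗ ψ.lTensor H = pairing φ ψ := by
    ext x y; simp [mul_comm]
  exact congr($this (Coalgebra.comul x))

theorem convolution_apply (φ ψ : H →ₗ[k] k) (x : H) :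
    convolution φ ψ x = pairing φ ψ (Coalgebra.comul x) := rfl

theorem convolution_assoc (φ ψ θ : H →ₗ[k] k) :
    convolution (convolution φ ψ) θ = convolution φ (convolution ψ θ) := by
  simp only [convolution, WithConv.toConv_ofConv, mul_assoc]

theorem convolution_sub_left (φ ψ θ : H →ₗ[k] k) :
    convolution (φ - ψ) θ = convolution φ θ - convolution ψ θ := by
  simp only [convolution, WithConv.toConv_sub, sub_mul, WithConv.ofConv_sub]

theorem one_eq_toConv_counit :
    (1 : WithConv (H →ₗ[k] k)) = WithConv.toConv (Coalgebra.counit (R := k) (A := H)) := by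
  rw [LinearMap.convOne_def]; rfl

theorem counit_convolution (φ : H →ₗ[k] k) :
    convolution (Coalgebra.counit (R := k)) φ = φ := by
  rw [convolution, ← one_eq_toConv_counit, one_mul]

theorem convolution_counit (φ : H →ₗ[k] k) :
    convolution φ (Coalgebra.counit (R := k)) = φ := by
  rw [convolution, ← one_eq_toConv_counit, mul_one]

theorem inverse_convolution (ζ : H →ₐ[k] k) :
    convolution (inverse ζ.toLinearMap) ζ.toLinearMap = Coalgebra.counit := by
  have h := LinearMap.algHom_comp_convMul_distrib ζ
    (WithConv.toConv (HopfAlgebra.antipode k (A := H))) (WithConv.toConv LinearMap.id)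
  rw [LinearMap.antipode_mul_id] at h
  ext x
  exact (congr($h x)).symm.trans (by simp [LinearMap.convOne_def])

theorem convolution_inverse (ζ : H →ₐ[k] k) :
    convolution ζ.toLinearMap (inverse ζ.toLinearMap) = Coalgebra.counit := by
  have h := LinearMap.algHom_comp_convMul_distrib ζ
    (WithConv.toConv LinearMap.id) (WithConv.toConv (HopfAlgebra.antipode k (A := H)))
  rw [LinearMap.id_mul_antipode] at h
  ext x
  exact (congr($h x)).symm.trans (by simp [LinearMap.convOne_def])

/-- A left inverse of a character for the convolution product is its inverse. -/
theorem eq_inverse_of_convolution {ζ : H →ₐ[k] k} {φ : H →ₗ[k] k}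
    (h : convolution φ ζ.toLinearMap = Coalgebra.counit) : φ = inverse ζ.toLinearMap := by
  rw [← convolution_counit φ, ← convolution_inverse ζ, ← convolution_assoc, h, counit_convolution]

theorem applyMiddle_eq (φ : H →ₗ[k] k) :
    applyMiddle φ = (leftAct φ).lTensor H ∘ₗ Coalgebra.comul := by
  rw [applyMiddle, leftAct, ← LinearMap.comp_assoc, ← LinearMap.lTensor_comp, LinearMap.comp_assoc]

theorem leftAct_convolution (φ ψ : H →ₗ[k] k) :
    leftAct (convolution φ ψ) = leftAct ψ ∘ₗ leftAct φ := by
  have hL : leftAct (convolution φ ψ) = ((TensorProduct.lid k H).toLinearMap ∘ₗ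
      (pairing φ ψ).rTensor H) ∘ₗ Coalgebra.comul.rTensor H ∘ₗ Coalgebra.comul := by
    have : (convolution φ ψ).rTensor H = (pairing φ ψ).rTensor H ∘ₗ Coalgebra.comul.rTensor H := by
      rw [← LinearMap.rTensor_comp]; rfl
    rw [leftAct, this]; rfl
  have hR : leftAct ψ ∘ₗ leftAct φ = ((TensorProduct.lid k H).toLinearMap ∘ₗ
      (pairing φ ψ).rTensor H) ∘ₗ (TensorProduct.assoc k H H H).symm.toLinearMap ∘ₗ
      Coalgebra.comul.lTensor H ∘ₗ Coalgebra.comul := by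
    have : leftAct ψ ∘ₗ (TensorProduct.lid k H).toLinearMap ∘ₗ φ.rTensor H =
        ((TensorProduct.lid k H).toLinearMap ∘ₗ (pairing φ ψ).rTensor H) ∘ₗ
        (TensorProduct.assoc k H H H).symm.toLinearMap ∘ₗ Coalgebra.comul.lTensor H := by
      refine TensorProduct.ext' fun x y => ?_
      simp only [LinearMap.comp_apply, LinearMap.rTensor_tmul, LinearMap.lTensor_tmul,
        LinearEquiv.coe_coe, TensorProduct.lid_tmul, map_smul, leftAct]
      generalize (Coalgebra.comul y : H ⊗[k] H) = t
      induction t using TensorProduct.induction_on with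
      | zero => simp
      | add s t hs ht => simp only [map_add, smul_add, TensorProduct.tmul_add, hs, ht]
      | tmul a b => simp [mul_smul]
    calc _ = (leftAct ψ ∘ₗ (TensorProduct.lid k H).toLinearMap ∘ₗ φ.rTensor H) ∘ₗ
        Coalgebra.comul := rfl
      _ = _ := by rw [this]; rfl
  rw [hL, hR, ← Coalgebra.coassoc]
  ext x
  simp

theorem applyMiddle_convolution (φ ψ : H →ₗ[k] k) :
    applyMiddle (convolution φ ψ) = (leftAct ψ).lTensor H ∘ₗ applyMiddle φ := by
  rw [applyMiddle_eq, applyMiddle_eq, leftAct_convolution, LinearMap.lTensor_comp,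
    LinearMap.comp_assoc]

theorem pairing_applyMiddle (φ ψ θ : H →ₗ[k] k) (x : H) :
    pairing φ ψ (applyMiddle θ x) = θ (rightAct ψ (leftAct φ x)) := by
  rw [applyMiddle_eq, LinearMap.comp_apply, pairing_lTensor, ← apply_leftAct, apply_rightAct,
    LinearMap.comp_apply, apply_leftAct]

variable (𝒜 : ℕ → Submodule k H) [GradedAlgebra 𝒜]

theorem conjugate_apply {n : ℕ} {h : H} (hh : h ∈ 𝒜 n) (φ : H →ₗ[k] k) :
    conjugate 𝒜 φ h = (-1) ^ n * φ h := by
  rw [conjugate, LinearMap.comp_apply, involution_apply 𝒜 hh, map_smul, smul_eq_mul]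

theorem eulerFunctional_eq (ζ : H →ₐ[k] k) :
    eulerFunctional 𝒜 ζ = convolution (dehnSommervilleFunctional 𝒜 ζ) ζ.toLinearMap := by
  rw [eulerFunctional, dehnSommervilleFunctional, convolution_sub_left, inverse_convolution, euler]

theorem dehnSommervilleFunctional_eq (ζ : H →ₐ[k] k) :
    dehnSommervilleFunctional 𝒜 ζ =
      convolution (eulerFunctional 𝒜 ζ) (inverse ζ.toLinearMap) := by
  rw [eulerFunctional, dehnSommervilleFunctional, convolution_sub_left, euler, convolution_assoc,
    convolution_inverse, convolution_counit, counit_convolution]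

/-- The two forms of the generalized Dehn-Sommerville relations are equivalent, because
`χ - ε = (ζ̄ - ζ⁻¹) ζ` and `ζ` is invertible for the convolution product. -/
theorem applyMiddle_dehnSommervilleFunctional_eq_zero_iff (ζ : H →ₐ[k] k) (h : H) :
    applyMiddle (dehnSommervilleFunctional 𝒜 ζ) h = 0 ↔
      applyMiddle (eulerFunctional 𝒜 ζ) h = 0 := by
  constructor <;> intro h0
  · rw [eulerFunctional_eq, applyMiddle_convolution, LinearMap.comp_apply, h0, map_zero]
  · rw [dehnSommervilleFunctional_eq, applyMiddle_convolution, LinearMap.comp_apply, h0, map_zero]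

theorem applyMiddle_eq_zero_of_mem {φ : H →ₗ[k] k} {C : Submodule k H}
    (hC : IsGradedSubcoalgebra 𝒜 C) (hφ : ∀ h ∈ C, φ h = 0) {h : H} (hh : h ∈ C) :
    applyMiddle φ h = 0 := by
  have h0 : leftAct φ ∘ₗ C.subtype = 0 := by
    ext ⟨x, hx⟩
    obtain ⟨t, ht⟩ := hC.1 x hx
    have h1 : φ ∘ₗ C.subtype = 0 := by ext ⟨y, hy⟩; exact hφ y hy
    simp only [leftAct, LinearMap.comp_apply, Submodule.subtype_apply, ← ht]
    rw [← LinearMap.comp_apply (φ.rTensor H), LinearMap.rTensor_comp_map, h1]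
    simp
  obtain ⟨t, ht⟩ := hC.1 h hh
  rw [applyMiddle_eq, LinearMap.comp_apply, ← ht, ← LinearMap.comp_apply (LinearMap.lTensor _ _),
    LinearMap.lTensor_comp_map, h0]
  simp

theorem applyMiddle_eq_zero_of_mem_oddSubalgebra {ζ : H →ₐ[k] k} {h : H}
    (hh : h ∈ oddSubalgebra 𝒜 ζ) : applyMiddle (dehnSommervilleFunctional 𝒜 ζ) h = 0 := by
  have : oddSubalgebra 𝒜 ζ ≤ LinearMap.ker (applyMiddle (dehnSommervilleFunctional 𝒜 ζ)) :=
    sSup_le fun C hC x hx => applyMiddle_eq_zero_of_mem 𝒜 hC.1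
      (fun y hy => sub_eq_zero.2 (hC.2 y hy)) hx
  exact this hh

theorem decompose_map {H' : Type*} [Ring H'] [HopfAlgebra k H'] (ℬ : ℕ → Submodule k H')
    [GradedAlgebra ℬ] {f : H →ₗ[k] H'} (hf : ∀ n, ∀ x ∈ 𝒜 n, f x ∈ ℬ n) (x : H) (n : ℕ) :
    (DirectSum.decompose ℬ (f x) n : H') = f (DirectSum.decompose 𝒜 x n) := by
  classical
  conv_lhs => rw [← DirectSum.sum_support_decompose 𝒜 x]
  rw [map_sum, DirectSum.decompose_sum, DFinsupp.finsetSum_apply, AddSubmonoidClass.coe_finsetSum]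
  have h : ∀ i, (DirectSum.decompose ℬ (f (DirectSum.decompose 𝒜 x i)) n : H') =
      if i = n then f (DirectSum.decompose 𝒜 x n) else 0 := fun i => by
    split_ifs with hi
    · subst hi
      exact DirectSum.decompose_of_mem_same ℬ (hf _ _ (SetLike.coe_mem _))
    · exact DirectSum.decompose_of_mem_ne ℬ (hf _ _ (SetLike.coe_mem _)) hi
  simp only [h, Finset.sum_ite_eq']
  split_ifs with hn
  · rfl
  · rw [DFinsupp.notMem_support_iff] at hn
    rw [hn]; simp

/-- The image of the odd subalgebra under a morphism of combinatorial Hopf algebras is contained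
in the odd subalgebra. -/
theorem map_mem_oddSubalgebra {H' : Type*} [Ring H'] [HopfAlgebra k H'] (ℬ : ℕ → Submodule k H')
    [GradedAlgebra ℬ] {ζ : H →ₐ[k] k} {ζ' : H' →ₐ[k] k} (Ψ : H →ₐc[k] H')
    (hΨ : ∀ n, ∀ x ∈ 𝒜 n, Ψ x ∈ ℬ n) (hζ : ∀ x, ζ' (Ψ x) = ζ x) {x : H}
    (hx : x ∈ oddSubalgebra 𝒜 ζ) : Ψ x ∈ oddSubalgebra ℬ ζ' := by
  let f : H →ₗ[k] H' := (Ψ : H →ₐ[k] H').toLinearMap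
  have hf : ∀ n, ∀ x ∈ 𝒜 n, f x ∈ ℬ n := hΨ
  have hcomul : ∀ x, Coalgebra.comul (R := k) (f x) =
      TensorProduct.map f f (Coalgebra.comul x) := fun x =>
    (CoalgHomClass.map_comp_comul_apply Ψ x).symm
  have hcounit : ∀ x, Coalgebra.counit (R := k) (f x) = Coalgebra.counit (R := k) x :=
    fun x => CoalgHomClass.counit_comp_apply Ψ x
  have hinv : inverse ζ'.toLinearMap ∘ₗ f = inverse ζ.toLinearMap := by
    apply eq_inverse_of_convolution
    ext x
    rw [convolution_apply, ← hcounit, ← inverse_convolution ζ', convolution_apply, hcomul]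
    have h : pairing (inverse ζ'.toLinearMap) ζ'.toLinearMap ∘ₗ TensorProduct.map f f =
        pairing (inverse ζ'.toLinearMap ∘ₗ f) ζ.toLinearMap :=
      TensorProduct.ext' fun y z => by simp [f, hζ]
    exact congr($h.symm (Coalgebra.comul x))
  have hconj : ∀ x, conjugate ℬ ζ'.toLinearMap (f x) = conjugate 𝒜 ζ.toLinearMap x := by
    intro x
    classical
    rw [← DirectSum.sum_support_decompose 𝒜 x]
    simp only [map_sum]
    refine Finset.sum_congr rfl fun n _ => ?_
    rw [conjugate_apply 𝒜 (SetLike.coe_mem _), conjugate_apply ℬ (hf n _ (SetLike.coe_mem _))]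
    exact congrArg _ (hζ _)
  have key : oddSubalgebra 𝒜 ζ ≤ (oddSubalgebra ℬ ζ').comap f := by
    refine sSup_le fun C hC => ?_
    rw [← Submodule.map_le_iff_le_comap]
    refine le_sSup ⟨⟨?_, ?_⟩, ?_⟩
    · rintro _ ⟨y, hy, rfl⟩
      obtain ⟨t, ht⟩ := hC.1.1 y hy
      rw [hcomul, ← ht]
      let g : C →ₗ[k] C.map f := f.restrict fun z hz => Submodule.mem_map_of_mem hz
      refine ⟨TensorProduct.map g g t, ?_⟩
      rw [← LinearMap.comp_apply, ← LinearMap.comp_apply, ← TensorProduct.map_comp,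
        ← TensorProduct.map_comp]
      rfl
    · rintro _ ⟨y, hy, rfl⟩ n
      rw [decompose_map 𝒜 ℬ hf]
      exact Submodule.mem_map_of_mem (hC.1.2 y hy n)
    · rintro _ ⟨y, hy, rfl⟩
      rw [hconj, hC.2 y hy, ← hinv]
      rfl
  exact key hx

end GradedHopf

/-! ### Coefficients of quasi-symmetric functions -/

namespace QSym

variable (k : Type*) [CommRing k]

/-- The functional `x ↦ f_α(x)`. -/
noncomputable def lcoeff (α : List ℕ+) : QSym k →ₗ[k] k := (basis k).coord α

variable {k}

@[simp] theorem lcoeff_apply (α : List ℕ+) (x : QSym k) : lcoeff k α x = coeff x α := rfl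

theorem ext_coeff {x y : QSym k} (h : ∀ α, coeff x α = coeff y α) : x = y :=
  (basis k).ext_elem h

theorem ext_pairing {s t : QSym k ⊗[k] QSym k}
    (h : ∀ β δ, pairing (lcoeff k β) (lcoeff k δ) s = pairing (lcoeff k β) (lcoeff k δ) t) :
    s = t := by
  have key : ∀ (β δ : List ℕ+) (t : QSym k ⊗[k] QSym k),
      ((basis k).tensorProduct (basis k)).repr t (β, δ) =
        pairing (lcoeff k β) (lcoeff k δ) t := by
    intro β δ t
    induction t using TensorProduct.induction_on with
    | zero => simp
    | add s t hs ht => rw [map_add, map_add, Finsupp.add_apply, hs, ht]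
    | tmul x y =>
      rw [Module.Basis.tensorProduct_repr_tmul_apply, pairing_tmul, smul_eq_mul, mul_comm]
      rfl
  refine ((basis k).tensorProduct (basis k)).ext_elem ?_
  rintro ⟨β, δ⟩
  rw [key, key, h]

theorem comul_M (α : List ℕ+) : Coalgebra.comul (R := k) (M k α) =
    ∑ i ∈ Finset.range (α.length + 1), M k (α.take i) ⊗ₜ[k] M k (α.drop i) := comulMap_M k α

theorem counit_M (α : List ℕ+) :
    Coalgebra.counit (R := k) (M k α) = if α = [] then 1 else 0 := counitMap_M k α

theorem counit_eq_coeff (x : QSym k) : Coalgebra.counit (R := k) x = coeff x [] :=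
  (coeff_nil k x).symm

/-- Since `Δ` deconcatenates, the coefficient of `M_β ⊗ M_δ` in `Δ(x)` is `f_{βδ}(x)`. -/
theorem pairing_comul (β δ : List ℕ+) (x : QSym k) :
    pairing (lcoeff k β) (lcoeff k δ) (Coalgebra.comul x) = coeff x (β ++ δ) := by
  induction x using induction_M with
  | zero => simp [coeff_zero]
  | add x y h h' => simp only [map_add, h, h', coeff_add]
  | smul r x h => simp only [map_smul, h, coeff_smul, smul_eq_mul]
  | M γ =>
    simp only [comul_M, map_sum, pairing_tmul, lcoeff_apply, coeff_M]
    split_ifs with h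
    · subst h
      rw [Finset.sum_eq_single β.length]
      · simp
      · intro i hi hne
        rw [Finset.mem_range] at hi
        rw [if_neg, zero_mul]
        intro h
        have := congrArg List.length h
        rw [List.length_take] at this
        omega
      · simp
    · refine Finset.sum_eq_zero fun i _ => ?_
      by_cases h1 : γ.take i = β
      · by_cases h2 : γ.drop i = δ
        · exact absurd (by rw [← h1, ← h2, List.take_append_drop]) h
        · simp [h2]
      · simp [h1]

theorem coeff_leftAct_lcoeff (β δ : List ℕ+) (x : QSym k) :
    coeff (leftAct (lcoeff k β) x) δ = coeff x (β ++ δ) := by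
  rw [← lcoeff_apply, apply_leftAct, pairing_comul]

theorem coeff_rightAct_lcoeff (β δ : List ℕ+) (x : QSym k) :
    coeff (rightAct (lcoeff k δ) x) β = coeff x (β ++ δ) := by
  rw [← lcoeff_apply, apply_rightAct, pairing_comul]

variable (k) in
/-- The operator which reads off the part of a quasi-symmetric function between the initial parts
`β` and the final parts `δ`: `strip β δ (∑ f_γ M_γ) = ∑ f_{βγδ} M_γ`. -/
noncomputable def strip (β δ : List ℕ+) : QSym k →ₗ[k] QSym k :=
  rightAct (lcoeff k δ) ∘ₗ leftAct (lcoeff k β)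

theorem coeff_strip (β δ γ : List ℕ+) (x : QSym k) :
    coeff (strip k β δ x) γ = coeff x (β ++ γ ++ δ) := by
  rw [strip, LinearMap.comp_apply, coeff_rightAct_lcoeff, coeff_leftAct_lcoeff, List.append_assoc]

theorem pairing_applyMiddle (φ : QSym k →ₗ[k] k) (β δ : List ℕ+) (x : QSym k) :
    pairing (lcoeff k β) (lcoeff k δ) (applyMiddle φ x) = φ (strip k β δ x) :=
  GradedHopf.pairing_applyMiddle _ _ _ _

theorem M_mem_grading (α : List ℕ+) : M k α ∈ grading k (size α) :=
  basis_mem_basisGrading (basis k) size α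

theorem mem_grading_iff {n : ℕ} {x : QSym k} :
    x ∈ grading k n ↔ ∀ α, size α ≠ n → coeff x α = 0 := by
  constructor
  · intro hx α hα
    have : grading k n ≤ LinearMap.ker (lcoeff k α) := by
      refine Submodule.span_le.2 ?_
      rintro _ ⟨β, rfl, rfl⟩
      change coeff (M k β) α = 0
      rw [coeff_M, if_neg]
      rintro rfl
      exact hα rfl
    exact this hx
  · intro h
    rw [← (basis k).linearCombination_repr x, Finsupp.linearCombination_apply]
    refine sum_mem fun α hα => Submodule.smul_mem _ _ ?_
    by_cases hn : size α = n
    · exact hn ▸ M_mem_grading α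
    · exact absurd (h α hn) (Finsupp.mem_support_iff.1 hα)

theorem eq_sum_compositions {n : ℕ} {x : QSym k} (hx : x ∈ grading k n) :
    x = ∑ α ∈ compositions n, coeff x α • M k α := by
  classical
  refine ext_coeff fun β => ?_
  simp only [coeff_sum, coeff_smul, coeff_M, mul_ite, mul_one, mul_zero, Finset.sum_ite_eq']
  split_ifs with h
  · rfl
  · exact mem_grading_iff.1 hx β (fun h' => h (mem_compositions.2 h'))

theorem coeff_decompose (x : QSym k) (n : ℕ) (α : List ℕ+) :
    coeff (DirectSum.decompose (grading k) x n : QSym k) α =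
      if size α = n then coeff x α else 0 := by
  classical
  have h : ∀ m, coeff (DirectSum.decompose (grading k) x m : QSym k) α =
      if size α = m then coeff (DirectSum.decompose (grading k) x m : QSym k) α else 0 := by
    intro m
    split_ifs with hm
    · rfl
    · exact mem_grading_iff.1 (SetLike.coe_mem _) α hm
  rw [h]
  split_ifs with hn
  · conv_rhs => rw [← DirectSum.sum_support_decompose (grading k) x]
    rw [coeff_sum, Finset.sum_congr rfl (fun m _ => h m), Finset.sum_ite_eq, hn]
    split_ifs with hs
    · rfl
    · rw [DFinsupp.notMem_support_iff] at hs
      rw [hs]; exact coeff_zero k α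
  · rfl

/-! ### The functionals of the generalized Dehn-Sommerville relations -/

theorem zeta_M (α : List ℕ+) : zeta k (M k α) = if α.length ≤ 1 then 1 else 0 := zetaMap_M k α

theorem conjugate_zeta_M (α : List ℕ+) : conjugate (grading k) (zeta k).toLinearMap (M k α) =
    if α.length ≤ 1 then (-1) ^ size α else 0 := by
  rw [conjugate_apply (grading k) (M_mem_grading α), AlgHom.toLinearMap_apply, zeta_M]
  split_ifs <;> simp

theorem inverse_zeta_M (α : List ℕ+) : inverse (zeta k).toLinearMap (M k α) = (-1) ^ α.length := by
  have h : (basis k).constr k (fun α : List ℕ+ => (-1 : k) ^ α.length) =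
      inverse (zeta k).toLinearMap := by
    apply eq_inverse_of_convolution
    refine ext_M fun α => ?_
    have hb : ∀ β, (basis k).constr k (fun α : List ℕ+ => (-1 : k) ^ α.length) (M k β) =
      (-1) ^ β.length := fun β => (basis k).constr_basis k _ β
    simp only [convolution_apply, comul_M, map_sum, pairing_tmul, hb, AlgHom.toLinearMap_apply,
      zeta_M, counit_M]
    rcases α.eq_nil_or_concat with rfl | ⟨α, a, rfl⟩
    · simp
    · -- only the two splittings whose second factor has at most one part contribute
      rw [List.concat_eq_append, List.length_append, List.length_singleton,
        Finset.sum_range_succ, Finset.sum_range_succ, Finset.sum_eq_zero]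
      · simp [pow_succ]
      · intro i hi
        rw [Finset.mem_range] at hi
        rw [if_neg, mul_zero]
        simp
        omega
  rw [← h]
  exact (basis k).constr_basis k _ α

theorem dehnSommervilleFunctional_M (β : List ℕ+) :
    dehnSommervilleFunctional (grading k) (zeta k) (M k β) =
      if β.length = 0 then 0
      else if β.length = 1 then (-1) ^ size β + 1
      else -(-1) ^ β.length := by
  rw [dehnSommervilleFunctional, LinearMap.sub_apply, conjugate_zeta_M, inverse_zeta_M]
  match β with
  | [] => simp [size]
  | [a] => simp
  | a :: b :: β => simp

theorem eulerFunctional_M (β : List ℕ+) : eulerFunctional (grading k) (zeta k) (M k β) =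
    ∑ i ∈ Finset.range (β.length + 1),
      (if (β.take i).length ≤ 1 then (-1) ^ size (β.take i) else 0) *
      (if (β.drop i).length ≤ 1 then 1 else 0) - if β = [] then 1 else 0 := by
  rw [eulerFunctional, LinearMap.sub_apply, euler, convolution_apply, comul_M, map_sum]
  simp only [pairing_tmul, conjugate_zeta_M, AlgHom.toLinearMap_apply, zeta_M, counit_M]

theorem eulerFunctional_M_nil : eulerFunctional (grading k) (zeta k) (M k []) = 0 := by
  simp [eulerFunctional_M, size]

theorem eulerFunctional_M_singleton (n : ℕ+) :
    eulerFunctional (grading k) (zeta k) (M k [n]) = 1 + (-1) ^ (n : ℕ) := by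
  simp [eulerFunctional_M, Finset.sum_range_succ, size]

theorem eulerFunctional_M_pair (i j : ℕ+) :
    eulerFunctional (grading k) (zeta k) (M k [i, j]) = (-1) ^ (i : ℕ) := by
  simp [eulerFunctional_M, Finset.sum_range_succ, size]

theorem eulerFunctional_M_of_two_lt_length {β : List ℕ+} (hβ : 2 < β.length) :
    eulerFunctional (grading k) (zeta k) (M k β) = 0 := by
  rw [eulerFunctional_M, if_neg (by rintro rfl; simp at hβ), sub_zero]
  refine Finset.sum_eq_zero fun i hi => ?_
  rcases Nat.lt_or_ge 1 i with h | h
  · rw [if_neg, zero_mul]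
    simp; omega
  · rw [if_neg (c := (List.drop _ _).length ≤ 1), mul_zero]
    simp; omega

/-! ### The generalized Dehn-Sommerville relations in coordinates -/

theorem strip_mem_grading {n m : ℕ} {β δ : List ℕ+} (hm : size β + m + size δ = n) {h : QSym k}
    (hh : h ∈ grading k n) : strip k β δ h ∈ grading k m := by
  refine mem_grading_iff.2 fun γ hγ => ?_
  rw [coeff_strip]
  refine mem_grading_iff.1 hh _ ?_
  rw [size_append, size_append]
  omega

theorem strip_eq_zero {n : ℕ} {β δ : List ℕ+} (hn : n < size β + size δ) {h : QSym k}
    (hh : h ∈ grading k n) : strip k β δ h = 0 := by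
  refine ext_coeff fun γ => ?_
  rw [coeff_strip, coeff_zero]
  refine mem_grading_iff.1 hh _ ?_
  rw [size_append, size_append]
  omega

theorem apply_strip {n m : ℕ} {β δ : List ℕ+} (hm : size β + m + size δ = n) {h : QSym k}
    (hh : h ∈ grading k n) (φ : QSym k →ₗ[k] k) :
    φ (strip k β δ h) = ∑ γ ∈ compositions m, φ (M k γ) * coeff h (β ++ γ ++ δ) := by
  rw [eq_sum_compositions (strip_mem_grading hm hh), map_sum]
  refine Finset.sum_congr rfl fun γ _ => ?_
  rw [map_smul, coeff_strip, smul_eq_mul, mul_comm]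

theorem take_append_get_cons_drop (α : List ℕ+) (i : Fin α.length) :
    α.take i ++ [α.get i] ++ α.drop (i + 1) = α := by simp

theorem size_take_add (α : List ℕ+) (i : Fin α.length) :
    size (α.take i) + (α.get i : ℕ) + size (α.drop (i + 1)) = size α := by
  conv_rhs => rw [← take_append_get_cons_drop α i, size_append, size_append]
  simp [size]

/-- A composition with a marked part is the same as a pair of compositions, of the parts before
and after it; hence `(id ⊗ φ ⊗ id) Δ⁽²⁾(h)` is a sum over compositions with a marked part. -/
theorem applyMiddle_eq_sum {φ : QSym k →ₗ[k] k} (hφ : φ 1 = 0) {n : ℕ} {h : QSym k}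
    (hh : h ∈ grading k n) : applyMiddle φ h = ∑ α ∈ compositions n, ∑ i : Fin α.length,
      φ (strip k (α.take i) (α.drop (i + 1)) h) • (M k (α.take i) ⊗ₜ[k] M k (α.drop (i + 1))) := by
  refine ext_pairing fun β δ => ?_
  simp only [pairing_applyMiddle, map_sum, map_smul, pairing_tmul, lcoeff_apply, coeff_M,
    smul_eq_mul]
  have hne : ∀ (α : List ℕ+) (i : Fin α.length), ¬ (α.take i = β ∧ α.drop (i + 1) = δ) →
      φ (strip k (α.take i) (α.drop (i + 1)) h) * ((if α.take i = β then 1 else 0) *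
        (if α.drop (i + 1) = δ then 1 else 0)) = 0 := by
    intro α i h
    by_cases h1 : α.take i = β
    · rw [if_neg (c := α.drop (i + 1) = δ) (fun h2 => h ⟨h1, h2⟩), mul_zero, mul_zero]
    · rw [if_neg h1, zero_mul, mul_zero]
  have hle : ∀ α ∈ compositions n, ∀ i : Fin α.length, α.take i = β → α.drop (i + 1) = δ →
      size β + (α.get i : ℕ) + size δ = n := by
    rintro α hα i rfl rfl
    rw [size_take_add, mem_compositions.1 hα]
  rcases lt_trichotomy n (size β + size δ) with hn | hn | hn
  · rw [strip_eq_zero hn hh, map_zero]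
    refine (Finset.sum_eq_zero fun α hα => Finset.sum_eq_zero fun i _ => hne α i ?_).symm
    rintro ⟨h1, h2⟩
    have := hle α hα i h1 h2
    omega
  · rw [Finset.sum_eq_zero]
    · rw [apply_strip (m := 0) (by omega) hh]
      refine Finset.sum_eq_zero fun γ hγ => ?_
      rcases γ with _ | ⟨c, γ⟩
      · rw [← one_def, hφ, zero_mul]
      · have := mem_compositions.1 hγ
        rw [size_cons] at this
        have := c.pos
        omega
    · refine fun α hα => Finset.sum_eq_zero fun i _ => hne α i ?_
      rintro ⟨h1, h2⟩
      have := hle α hα i h1 h2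
      have := (α.get i).pos
      omega
  · obtain ⟨a, ha⟩ : ∃ a : ℕ+, size β + (a : ℕ) + size δ = n :=
      ⟨⟨n - (size β + size δ), by omega⟩, by simp only [PNat.mk_coe]; omega⟩
    rw [Finset.sum_eq_single (β ++ a :: δ)]
    · rw [Finset.sum_eq_single ⟨β.length, by simp⟩]
      · simp
      · intro i _ hi
        refine hne _ i fun h1 => hi (Fin.ext ?_)
        have := congrArg List.length h1.1
        have := i.2
        simp only [List.length_take, List.length_append, List.length_cons] at *
        omega
      · simp
    · intro α hα hne'
      refine Finset.sum_eq_zero fun i _ => hne α i ?_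
      rintro ⟨h1, h2⟩
      have h3 := hle α hα i h1 h2
      have h4 : α.get i = a := PNat.coe_injective (by omega)
      apply hne'
      rw [← take_append_get_cons_drop α i, h1, h2, h4]
      simp
    · intro hα
      refine absurd (mem_compositions.2 ?_) hα
      rw [size_append, size_cons]
      omega

theorem singleton_mem_compositions (a : ℕ+) : [a] ∈ compositions a :=
  mem_compositions.2 (by simp [size])

theorem eq_singleton_of_size {a : ℕ+} {γ : List ℕ+} (hγ : size γ = a) (hl : γ.length = 1) :
    γ = [a] := by
  obtain ⟨c, rfl⟩ := List.length_eq_one_iff.1 hl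
  have : (c : ℕ) = a := by simpa [size] using hγ
  rw [PNat.coe_injective this]

theorem dehnSommervilleFunctional_strip {n : ℕ} {h : QSym k} (hh : h ∈ grading k n)
    {α : List ℕ+} (hα : size α = n) (i : Fin α.length) :
    dehnSommervilleFunctional (grading k) (zeta k) (strip k (α.take i) (α.drop (i + 1)) h) =
      dehnSommerville h.coeff α i := by
  rw [apply_strip ((size_take_add α i).trans hα) hh, dehnSommerville]
  have h1 : (-1) ^ (α.get i : ℕ) * coeff h α = ∑ γ ∈ compositions (α.get i),
      (if γ = [α.get i] then (-1) ^ (α.get i : ℕ) else 0) *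
        coeff h (α.take i ++ γ ++ α.drop (i + 1)) := by
    rw [Finset.sum_eq_single [α.get i]]
    · rw [if_pos rfl, take_append_get_cons_drop]
    · intro γ _ hγ
      rw [if_neg hγ, zero_mul]
    · exact fun h => absurd (singleton_mem_compositions _) h
  rw [h1, ← Finset.sum_sub_distrib]
  refine Finset.sum_congr rfl fun γ hγ => ?_
  rw [← sub_mul, dehnSommervilleFunctional_M]
  have hs := mem_compositions.1 hγ
  have hpos := (α.get i).pos
  congr 1
  by_cases h0 : γ.length = 0
  · rw [List.length_eq_zero_iff] at h0
    subst h0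
    change 0 = (α.get i : ℕ) at hs
    omega
  by_cases h1 : γ.length = 1
  · rw [if_neg h0, if_pos h1, if_pos (eq_singleton_of_size hs h1), hs, h1]
    ring
  · rw [if_neg h0, if_neg h1, if_neg (by rintro rfl; exact h1 rfl)]
    ring

theorem omitZeros_pair_zero_left (a : ℕ+) : omitZeros [0, (a : ℕ)] = [a] := by
  rw [omitZeros_cons_zero, omitZeros_cons_pos]; rfl

theorem omitZeros_pair_zero_right (a : ℕ+) : omitZeros [(a : ℕ), 0] = [a] := by
  rw [omitZeros_cons_pos]; rfl

theorem omitZeros_pair (a b : ℕ+) : omitZeros [(a : ℕ), (b : ℕ)] = [a, b] := by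
  rw [omitZeros_cons_pos, omitZeros_cons_pos]; rfl

theorem sum_compositions_eulerFunctional (a : ℕ+) (F : List ℕ+ → k) :
    ∑ γ ∈ compositions a, eulerFunctional (grading k) (zeta k) (M k γ) * F γ =
      ∑ j ∈ Finset.range ((a : ℕ) + 1), (-1) ^ j * F (omitZeros [j, (a : ℕ) - j]) := by
  classical
  -- the one-part composition accounts for both extreme terms `j = 0` and `j = a`
  have hF : ∀ γ ∈ compositions a, eulerFunctional (grading k) (zeta k) (M k γ) * F γ =
      (if γ = [a] then F γ else 0) + ∑ j ∈ Finset.range (a : ℕ),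
        if γ = omitZeros [j + 1, (a : ℕ) - (j + 1)] then (-1) ^ (j + 1) * F γ else 0 := by
    intro γ hγ
    have hs := mem_compositions.1 hγ
    have ha := a.pos
    have hj : ∀ j ∈ Finset.range (a : ℕ), γ = omitZeros [j + 1, (a : ℕ) - (j + 1)] →
        ∃ c : ℕ+, (c : ℕ) = j + 1 ∧ (γ = [c] ∨ ∃ d : ℕ+, γ = [c, d]) := by
      intro j _ hγ
      refine ⟨⟨j + 1, j.succ_pos⟩, rfl, ?_⟩
      rcases Nat.eq_zero_or_pos ((a : ℕ) - (j + 1)) with h0 | h0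
      · left; rw [hγ, h0]; exact omitZeros_pair_zero_right ⟨j + 1, j.succ_pos⟩
      · right; exact ⟨⟨_, h0⟩, hγ.trans (omitZeros_pair ⟨j + 1, j.succ_pos⟩ ⟨_, h0⟩)⟩
    match γ with
    | [] => simp [size] at hs; omega
    | [c] =>
      obtain rfl : c = a := PNat.coe_injective (by simpa [size] using hs)
      rw [eulerFunctional_M_singleton, if_pos rfl, Finset.sum_eq_single ((c : ℕ) - 1)]
      · rw [if_pos, Nat.sub_add_cancel ha]
        · ring
        · rw [Nat.sub_add_cancel ha, Nat.sub_self, omitZeros_pair_zero_right]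
      · intro j hj' hne
        rw [if_neg]
        intro h
        obtain ⟨d, hd, h | ⟨e, h⟩⟩ := hj j hj' h
        · simp only [List.cons.injEq, and_true] at h
          subst h; omega
        · simp at h
      · intro h; exact absurd (Finset.mem_range.2 (by omega)) h
    | [c, d] =>
      have hcd : (c : ℕ) + d = a := by simpa [size] using hs
      have hc := c.pos
      have hd := d.pos
      rw [eulerFunctional_M_pair, if_neg (by simp), zero_add, Finset.sum_eq_single ((c : ℕ) - 1)]
      · rw [if_pos, Nat.sub_add_cancel hc]
        rw [Nat.sub_add_cancel hc, ← hcd, Nat.add_sub_cancel_left, omitZeros_pair]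
      · intro j hj' hne
        rw [if_neg]
        intro h
        obtain ⟨e, he, h | ⟨f, h⟩⟩ := hj j hj' h
        · simp at h
        · simp only [List.cons.injEq, and_true] at h
          rw [h.1] at hne; omega
      · intro h; exact absurd (Finset.mem_range.2 (by omega)) h
    | c :: d :: e :: γ =>
      rw [eulerFunctional_M_of_two_lt_length (by simp), zero_mul, if_neg (by simp), zero_add,
        Finset.sum_eq_zero]
      intro j hj'
      rw [if_neg]
      intro h
      obtain ⟨f, _, h | ⟨g, h⟩⟩ := hj j hj' h <;> simp at h
  rw [Finset.sum_congr rfl hF, Finset.sum_add_distrib, Finset.sum_comm, Finset.sum_range_succ',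
    add_comm]
  congr 1
  · refine Finset.sum_congr rfl fun j hj => ?_
    have hj' := Finset.mem_range.1 hj
    rw [Finset.sum_ite_eq', if_pos]
    rw [mem_compositions, size_omitZeros]
    simp only [List.sum_cons, List.sum_nil]
    omega
  · rw [Finset.sum_ite_eq', if_pos (singleton_mem_compositions a), Nat.sub_zero,
      omitZeros_pair_zero_left, pow_zero, one_mul]

theorem eulerFunctional_strip {n : ℕ} {h : QSym k} (hh : h ∈ grading k n)
    {α : List ℕ+} (hα : size α = n) (i : Fin α.length) :
    eulerFunctional (grading k) (zeta k) (strip k (α.take i) (α.drop (i + 1)) h) =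
      bayerBillera h.coeff α i := by
  rw [apply_strip ((size_take_add α i).trans hα) hh, bayerBillera,
    sum_compositions_eulerFunctional _ fun γ => coeff h (α.take i ++ γ ++ α.drop (i + 1))]

theorem applyMiddle_dehnSommervilleFunctional {n : ℕ} {h : QSym k} (hh : h ∈ grading k n) :
    applyMiddle (dehnSommervilleFunctional (grading k) (zeta k)) h =
      ∑ α ∈ compositions n, ∑ i : Fin α.length, dehnSommerville h.coeff α i •
        (M k (α.take i) ⊗ₜ[k] M k (α.drop (i + 1))) := by
  rw [applyMiddle_eq_sum (by rw [one_def, dehnSommervilleFunctional_M]; simp) hh]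
  refine Finset.sum_congr rfl fun α hα => Finset.sum_congr rfl fun i _ => ?_
  rw [dehnSommervilleFunctional_strip hh (mem_compositions.1 hα)]

theorem applyMiddle_eulerFunctional {n : ℕ} {h : QSym k} (hh : h ∈ grading k n) :
    applyMiddle (eulerFunctional (grading k) (zeta k)) h =
      ∑ α ∈ compositions n, ∑ i : Fin α.length, bayerBillera h.coeff α i •
        (M k (α.take i) ⊗ₜ[k] M k (α.drop (i + 1))) := by
  rw [applyMiddle_eq_sum (by rw [one_def, eulerFunctional_M_nil]) hh]
  refine Finset.sum_congr rfl fun α hα => Finset.sum_congr rfl fun i _ => ?_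
  rw [eulerFunctional_strip hh (mem_compositions.1 hα)]

/-! ### The odd subalgebra of the quasi-symmetric functions -/

/-- The quasi-symmetric functions `x` satisfying `∑_γ φ(M_γ) f_{βγδ}(x) = 0` for all `β`, `δ` and
`a`, where `γ` runs over the compositions of `a`. Each relation involves coefficients of a single
degree only, so that this is a graded subspace even though `φ` is not homogeneous. -/
noncomputable def annihilated (φ : QSym k →ₗ[k] k) : Submodule k (QSym k) :=
  ⨅ (β : List ℕ+) (a : ℕ) (δ : List ℕ+),
    LinearMap.ker (∑ γ ∈ compositions a, φ (M k γ) • lcoeff k (β ++ γ ++ δ))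

theorem mem_annihilated {φ : QSym k →ₗ[k] k} {x : QSym k} : x ∈ annihilated φ ↔
    ∀ (β : List ℕ+) (a : ℕ) (δ : List ℕ+),
      ∑ γ ∈ compositions a, φ (M k γ) * coeff x (β ++ γ ++ δ) = 0 := by
  simp [annihilated, Submodule.mem_iInf, LinearMap.sum_apply]

theorem leftAct_mem_annihilated {φ : QSym k →ₗ[k] k} {x : QSym k} (hx : x ∈ annihilated φ)
    (β : List ℕ+) : leftAct (lcoeff k β) x ∈ annihilated φ := by
  rw [mem_annihilated] at *
  intro β' a δ
  simpa only [coeff_leftAct_lcoeff, List.append_assoc] using hx (β ++ β') a δ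

theorem rightAct_mem_annihilated {φ : QSym k →ₗ[k] k} {x : QSym k} (hx : x ∈ annihilated φ)
    (δ : List ℕ+) : rightAct (lcoeff k δ) x ∈ annihilated φ := by
  rw [mem_annihilated] at *
  intro β a δ'
  simpa only [coeff_rightAct_lcoeff, List.append_assoc] using hx β a (δ' ++ δ)

theorem decompose_mem_annihilated {φ : QSym k →ₗ[k] k} {x : QSym k} (hx : x ∈ annihilated φ)
    (n : ℕ) : (DirectSum.decompose (grading k) x n : QSym k) ∈ annihilated φ := by
  rw [mem_annihilated] at *
  intro β a δ
  refine Eq.trans ?_ ((congrArg (fun c => (if size β + a + size δ = n then 1 else 0) * c)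
    (hx β a δ)).trans (mul_zero _))
  rw [Finset.mul_sum]
  refine Finset.sum_congr rfl fun γ hγ => ?_
  rw [coeff_decompose, size_append, size_append, mem_compositions.1 hγ]
  split_ifs <;> simp

theorem apply_eq_zero_of_mem_annihilated {φ : QSym k →ₗ[k] k} {x : QSym k}
    (hx : x ∈ annihilated φ) : φ x = 0 := by
  classical
  rw [← DirectSum.sum_support_decompose (grading k) x, map_sum]
  refine Finset.sum_eq_zero fun n _ => ?_
  have h := mem_annihilated.1 (decompose_mem_annihilated hx n) [] n []
  rw [eq_sum_compositions (SetLike.coe_mem (DirectSum.decompose (grading k) x n)), map_sum, ← h]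
  refine Finset.sum_congr rfl fun γ _ => ?_
  rw [map_smul, smul_eq_mul, mul_comm, List.nil_append, List.append_nil]

theorem mem_annihilated_of_applyMiddle {φ : QSym k →ₗ[k] k} {n : ℕ} {h : QSym k}
    (hh : h ∈ grading k n) (h0 : applyMiddle φ h = 0) : h ∈ annihilated φ := by
  rw [mem_annihilated]
  intro β a δ
  by_cases hn : size β + a + size δ = n
  · rw [← apply_strip hn hh, ← pairing_applyMiddle, h0, map_zero]
  · refine Finset.sum_eq_zero fun γ hγ => ?_
    rw [mem_grading_iff.1 hh, mul_zero]
    rw [size_append, size_append, mem_compositions.1 hγ]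
    exact hn

theorem isGradedSubcoalgebra_annihilated {k : Type*} [Field k] (φ : QSym k →ₗ[k] k) :
    IsGradedSubcoalgebra (grading k) (annihilated φ) := by
  refine ⟨fun x hx => ?_, fun x hx n => decompose_mem_annihilated hx n⟩
  -- a linear projection onto the subspace fixes `Δ(x)` on either side
  obtain ⟨p, hp⟩ := (annihilated φ).subtype.exists_leftInverse_of_injective
    (Submodule.ker_subtype _)
  have hπ : ∀ y ∈ annihilated φ, (annihilated φ).subtype (p y) = y := fun y hy =>
    congrArg Subtype.val (congr($hp ⟨y, hy⟩) : p y = ⟨y, hy⟩)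
  have hl : ((annihilated φ).subtype ∘ₗ p).lTensor (QSym k) (Coalgebra.comul x) =
      Coalgebra.comul (R := k) x := by
    refine ext_pairing fun β δ => ?_
    rw [pairing_lTensor, ← apply_leftAct, ← apply_leftAct, LinearMap.comp_apply,
      LinearMap.comp_apply, hπ _ (leftAct_mem_annihilated hx β)]
  have hr : ((annihilated φ).subtype ∘ₗ p).rTensor (QSym k) (Coalgebra.comul x) =
      Coalgebra.comul (R := k) x := by
    refine ext_pairing fun β δ => ?_
    rw [pairing_rTensor, ← apply_rightAct, ← apply_rightAct, LinearMap.comp_apply,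
      LinearMap.comp_apply, hπ _ (rightAct_mem_annihilated hx δ)]
  refine ⟨TensorProduct.map p p (Coalgebra.comul x), ?_⟩
  rw [← LinearMap.comp_apply, ← TensorProduct.map_comp, ← LinearMap.rTensor_comp_lTensor,
    LinearMap.comp_apply, hl, hr]

theorem mem_oddSubalgebra_of_applyMiddle {k : Type*} [Field k] {n : ℕ} {h : QSym k}
    (hh : h ∈ grading k n)
    (h0 : applyMiddle (dehnSommervilleFunctional (grading k) (zeta k)) h = 0) :
    h ∈ oddSubalgebra (grading k) (zeta k) := by
  have hle : annihilated (dehnSommervilleFunctional (grading k) (zeta k)) ≤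
      oddSubalgebra (grading k) (zeta k) :=
    le_sSup ⟨isGradedSubcoalgebra_annihilated _, fun _ hy =>
      sub_eq_zero.1 (apply_eq_zero_of_mem_annihilated hy)⟩
  exact hle (mem_annihilated_of_applyMiddle hh h0)

theorem oddSubalgebra_tfae {k : Type*} [Field k] {n : ℕ} {h : QSym k} (hh : h ∈ grading k n) :
    List.TFAE [
      h ∈ oddSubalgebra (grading k) (zeta k),
      applyMiddle (dehnSommervilleFunctional (grading k) (zeta k)) h = 0,
      applyMiddle (eulerFunctional (grading k) (zeta k)) h = 0,
      ∀ α : List ℕ+, size α = n → ∀ i : Fin α.length, dehnSommerville h.coeff α i = 0,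
      ∀ α : List ℕ+, size α = n → ∀ i : Fin α.length, bayerBillera h.coeff α i = 0] := by
  tfae_have 1 → 2 := applyMiddle_eq_zero_of_mem_oddSubalgebra (grading k)
  tfae_have 2 → 1 := mem_oddSubalgebra_of_applyMiddle hh
  tfae_have 2 ↔ 3 := applyMiddle_dehnSommervilleFunctional_eq_zero_iff (grading k) (zeta k) h
  tfae_have 2 → 4 := fun h0 α hα i => by
    rw [← dehnSommervilleFunctional_strip hh hα, ← pairing_applyMiddle, h0, map_zero]
  tfae_have 4 → 2 := fun h0 => by
    rw [applyMiddle_dehnSommervilleFunctional hh]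
    refine Finset.sum_eq_zero fun α hα => Finset.sum_eq_zero fun i _ => ?_
    rw [h0 α (mem_compositions.1 hα), zero_smul]
  tfae_have 3 → 5 := fun h0 α hα i => by
    rw [← eulerFunctional_strip hh hα, ← pairing_applyMiddle, h0, map_zero]
  tfae_have 5 → 3 := fun h0 => by
    rw [applyMiddle_eulerFunctional hh]
    refine Finset.sum_eq_zero fun α hα => Finset.sum_eq_zero fun i _ => ?_
    rw [h0 α (mem_compositions.1 hα), zero_smul]
  tfae_finish

end QSym

/-! ### The Möbius function and the eulerian subspace -/

namespace Rota

variable {k : Type u} [CommRing k]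

theorem comul_of (P : GradedPoset.{v}) : Coalgebra.comul (R := k) (of k P) =
    ∑ z : P, of k (P.interval ⊥ z bot_le) ⊗ₜ[k] of k (P.interval z ⊤ le_top) := comulHom_of k P

open Classical in
theorem counit_of (P : GradedPoset.{v}) :
    Coalgebra.counit (R := k) (of k P) = if (⊥ : P) = ⊤ then 1 else 0 := counitHom_of k P

theorem of_mem_grading (P : GradedPoset.{v}) : of k P ∈ grading k P.rank :=
  basis_mem_basisGrading (basis k) GradedPosetClass.rank (GradedPosetClass.mk P)

theorem conjugate_zeta_of (P : GradedPoset.{v}) :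
    conjugate (grading k) (zeta k).toLinearMap (of k P) = (-1) ^ P.rank := by
  rw [conjugate_apply (grading k) (of_mem_grading P), AlgHom.toLinearMap_apply, zeta_of, mul_one]

theorem sum_interval {A : Type*} [AddCommMonoid A] (P : GradedPoset.{v}) {x y : P} (hxy : x ≤ y)
    (F : P → A) : ∑ z : P.interval x y hxy, F z.1 = ∑ z ∈ Finset.Icc x y, F z :=
  (Finset.sum_subtype (p := fun z => z ∈ Set.Icc x y) (Finset.Icc x y)
    (fun z => by rw [Finset.mem_Icc, Set.mem_Icc]) F).symm

theorem sum_inverse_zeta_interval (P : GradedPoset.{v}) {x y : P} (hxy : x ≤ y) :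
    ∑ z : P.interval x y hxy, inverse (zeta k).toLinearMap (of k (P.interval x z.1 z.2.1)) =
      if x = y then 1 else 0 := by
  have h := congr($(inverse_convolution (zeta k)) (of k (P.interval x y hxy)))
  rw [convolution_apply, comul_of, map_sum, counit_of] at h
  simp only [pairing_tmul, AlgHom.toLinearMap_apply, zeta_of, mul_one] at h
  refine Eq.trans ?_ (h.trans (if_congr Subtype.ext_iff rfl rfl))
  refine Finset.sum_congr rfl fun z _ => ?_
  rw [of_congr (GradedPoset.intervalInterval hxy (a := ⊥) (b := z) bot_le z.2.1 rfl rfl)]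

/-- The functional `ζ⁻¹` of Rota's Hopf algebra is given by the Möbius function: both satisfy the
recursion of `sum_inverse_zeta_interval`, which is the identity `ζ⁻¹ ζ = ε` on `[x, y]`. -/
theorem inverse_zeta_interval (P : GradedPoset.{v}) {x y : P} (hxy : x ≤ y) :
    inverse (zeta k).toLinearMap (of k (P.interval x y hxy)) =
      ((IncidenceAlgebra.mu ℤ x y : ℤ) : k) := by
  classical
  induction y using WellFoundedLT.induction with
  | _ y ih =>
    have h1 := sum_inverse_zeta_interval (k := k) P hxy
    have h2 := congrArg (Int.cast : ℤ → k) (IncidenceAlgebra.sum_Icc_mu_right (𝕜 := ℤ) x y)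
    rw [Int.cast_sum, ← sum_interval P hxy
      fun z => ((IncidenceAlgebra.mu ℤ x z : ℤ) : k)] at h2
    let y' : P.interval x y hxy := ⟨y, hxy, le_rfl⟩
    rw [← Finset.add_sum_erase _ _ (Finset.mem_univ y')] at h1 h2
    have h3 : ∀ z ∈ Finset.univ.erase y',
        inverse (zeta k).toLinearMap (of k (P.interval x z.1 z.2.1)) =
          ((IncidenceAlgebra.mu ℤ x z.1 : ℤ) : k) := fun z hz => by
      refine ih _ (lt_of_le_of_ne z.2.2 fun h => (Finset.mem_erase.1 hz).1 (Subtype.ext h)) _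
    rw [Finset.sum_congr rfl h3] at h1
    have h4 : ((if x = y then 1 else 0 : ℤ) : k) = if x = y then 1 else 0 := by
      split_ifs <;> simp
    rw [h4, ← h1] at h2
    exact (add_right_cancel h2).symm

end Rota

namespace GradedPoset

theorem IsEulerian.interval {P : GradedPoset.{v}} (hP : P.IsEulerian) {x y : P} (hxy : x ≤ y) :
    (P.interval x y hxy).IsEulerian := by
  intro a b hab
  -- over `ℤ`, both Möbius functions are the value of `ζ⁻¹` on the same isomorphism class
  have e := intervalInterval hxy hab.le (a' := a.1) (b' := b.1) hab.le rfl rfl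
  have h := Rota.inverse_zeta_interval (k := ℤ) (P.interval x y hxy) hab.le
  have h' := Rota.inverse_zeta_interval (k := ℤ) P (x := a.1) (y := b.1) hab.le
  rw [Int.cast_id] at h h'
  rw [← h, Rota.of_congr e, h', hP a.1 b.1 hab, rank_congr e]

end GradedPoset

namespace Rota

theorem inverse_zeta_of_isEulerian {k : Type u} [CommRing k] {P : GradedPoset.{v}}
    (hP : P.IsEulerian) : inverse (zeta k).toLinearMap (of k P) = (-1) ^ P.rank := by
  have e := P.intervalBotTop (x := ⊥) (y := ⊤) le_top rfl rfl
  rw [← of_congr e, inverse_zeta_interval, ← GradedPoset.rank_congr e]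
  rcases eq_or_ne (⊥ : P) ⊤ with h | h
  · have h0 : (P.interval ⊥ ⊤ le_top).rank = 0 := by
      obtain ⟨r, hr⟩ := P.exists_isRankFun
      rw [GradedPoset.rank_interval hr, ← h, Nat.sub_self]
    rw [h0, ← h, IncidenceAlgebra.mu_self]
    simp
  · rw [hP ⊥ ⊤ (lt_of_le_of_ne bot_le h)]
    simp

theorem decompose_mem_span_of {k : Type u} [CommRing k] {S : Set GradedPoset.{v}}
    {x : Rota.{u, v} k} (hx : x ∈ Submodule.span k (of k '' S)) (n : ℕ) :
    (DirectSum.decompose (grading k) x n : Rota.{u, v} k) ∈ Submodule.span k (of k '' S) := by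
  induction hx using Submodule.span_induction with
  | mem x h =>
    obtain ⟨P, hP, rfl⟩ := h
    by_cases hn : P.rank = n
    · subst hn
      rw [DirectSum.decompose_of_mem_same _ (of_mem_grading P)]
      exact Submodule.subset_span ⟨P, hP, rfl⟩
    · rw [DirectSum.decompose_of_mem_ne _ (of_mem_grading P) hn]
      exact zero_mem _
  | zero => simp
  | add x y _ _ hx hy =>
    rw [DirectSum.decompose_add]
    exact add_mem hx hy
  | smul r x _ hx =>
    rw [DirectSum.decompose_smul]
    exact Submodule.smul_mem _ _ hx

theorem eulerianSubspace_eq (k : Type u) [CommRing k] :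
    eulerianSubspace.{u, v} k = Submodule.span k (of k '' {P | P.IsEulerian}) := by
  rw [eulerianSubspace]
  congr 1
  ext x
  exact exists_congr fun P => and_congr_right fun _ => eq_comm

theorem of_mem_eulerianSubspace {k : Type u} [CommRing k] {P : GradedPoset.{v}}
    (hP : P.IsEulerian) : of k P ∈ eulerianSubspace k := Submodule.subset_span ⟨P, hP, rfl⟩

theorem isGradedSubcoalgebra_eulerianSubspace (k : Type u) [CommRing k] :
    IsGradedSubcoalgebra (grading k) (eulerianSubspace.{u, v} k) := by
  constructor
  · suffices eulerianSubspace.{u, v} k ≤ (LinearMap.range (TensorProduct.map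
        (eulerianSubspace k).subtype (eulerianSubspace k).subtype)).comap Coalgebra.comul from
      fun x hx => this hx
    refine Submodule.span_le.2 ?_
    rintro _ ⟨P, hP, rfl⟩
    rw [SetLike.mem_coe, Submodule.mem_comap, comul_of]
    exact sum_mem fun z _ => ⟨⟨_, of_mem_eulerianSubspace (hP.interval bot_le)⟩ ⊗ₜ
      ⟨_, of_mem_eulerianSubspace (hP.interval le_top)⟩, rfl⟩
  · intro x hx n
    rw [eulerianSubspace_eq] at *
    exact decompose_mem_span_of hx n

theorem eulerianSubspace_le_oddSubalgebra (k : Type u) [CommRing k] :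
    eulerianSubspace.{u, v} k ≤ oddSubalgebra (grading k) (zeta k) := by
  refine le_sSup ⟨isGradedSubcoalgebra_eulerianSubspace k, fun x hx => ?_⟩
  have : eulerianSubspace.{u, v} k ≤ LinearMap.eqLocus
      (conjugate (grading k) (zeta k).toLinearMap) (inverse (zeta k).toLinearMap) := by
    refine Submodule.span_le.2 ?_
    rintro _ ⟨P, hP, rfl⟩
    exact (conjugate_zeta_of P).trans (inverse_zeta_of_isEulerian hP).symm
  exact this hx

end Rota

/-! ### The flag `f`-vector -/

namespace GradedPoset

/-- The rank of the element `z` of `P`, that is, of the interval `[0, z]`. -/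
noncomputable def height (P : GradedPoset.{v}) (z : P) : ℕ := (P.interval ⊥ z bot_le).rank

theorem height_eq {P : GradedPoset.{v}} {r : P → ℕ} (hr : IsRankFun r) (z : P) :
    P.height z = r z := by
  rw [height, rank_interval hr, hr.bot, Nat.sub_zero]

theorem isRankFun_height (P : GradedPoset.{v}) : IsRankFun P.height := by
  obtain ⟨r, hr⟩ := P.exists_isRankFun
  rwa [show P.height = r from funext (height_eq hr)]

theorem height_interval (P : GradedPoset.{v}) {x y : P} (hxy : x ≤ y) (z : P.interval x y hxy) :
    (P.interval x y hxy).height z = P.height z.1 - P.height x :=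
  height_eq (P.isRankFun_height.icc hxy) z

theorem height_mono (P : GradedPoset.{v}) : Monotone P.height :=
  P.isRankFun_height.strictMono.monotone

theorem height_congr {P Q : GradedPoset.{v}} (e : P ≃o Q) (z : P) : Q.height (e z) = P.height z :=
  rank_congr (intervalIso e bot_le bot_le (map_bot e) rfl).symm

/-- The chains counted by the flag `f`-vector, in terms of the heights of their elements. -/
structure IsFlag (P : GradedPoset.{v}) (α : List ℕ+) (z : Fin (α.length + 1) → P) : Prop where
  strictMono : StrictMono z
  bot : z 0 = ⊥
  top : z (Fin.last _) = ⊤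
  height_succ : ∀ i : Fin α.length, P.height (z i.succ) = P.height (z i.castSucc) + α.get i

theorem flagVector_eq (P : GradedPoset.{v}) (α : List ℕ+) :
    P.flagVector α = Nat.card {z : Fin (α.length + 1) → P // P.IsFlag α z} := by
  refine Nat.card_congr (Equiv.subtypeEquivRight fun z => ?_)
  have key : StrictMono z → ((∀ i : Fin α.length,
      posetRank (Set.Icc (z i.castSucc) (z i.succ)) = (α.get i : ℕ)) ↔
      ∀ i : Fin α.length, P.height (z i.succ) = P.height (z i.castSucc) + α.get i) := by
    intro hz
    refine forall_congr' fun i => ?_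
    have h := (hz i.castSucc_lt_succ).le
    have := P.height_mono h
    rw [P.isRankFun_height.posetRank_icc h]
    omega
  exact ⟨fun h => ⟨h.1, h.2.1, h.2.2.1, (key h.1).1 h.2.2.2⟩,
    fun h => ⟨h.1, h.2, h.3, (key h.1).2 h.4⟩⟩

open Classical in
theorem flagVector_nil (P : GradedPoset.{v}) :
    P.flagVector [] = if (⊥ : P) = ⊤ then 1 else 0 := by
  rw [flagVector_eq]
  split_ifs with h
  · rw [Nat.card_eq_one_iff_exists]
    refine ⟨⟨fun _ => ⊥, fun i j hij => absurd hij (by simp), rfl, h, fun i => i.elim0⟩, ?_⟩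
    rintro ⟨z, hz⟩
    refine Subtype.ext (funext fun i => ?_)
    exact (congrArg z (Fin.fin_one_eq_zero i)).trans hz.bot
  · have : IsEmpty {z : Fin (([] : List ℕ+).length + 1) → P // P.IsFlag [] z} :=
      ⟨fun z => h (z.2.bot.symm.trans z.2.top)⟩
    exact Nat.card_of_isEmpty

theorem IsFlag.le_succ {P : GradedPoset.{v}} {a : ℕ+} {α : List ℕ+} {y : P}
    {z : Fin ((a :: α).length + 1) → P} (hz : P.IsFlag (a :: α) z) (hy : z 1 = y)
    (i : Fin (α.length + 1)) : y ≤ z i.succ :=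
  hy.ge.trans (hz.strictMono.monotone (Fin.succ_le_succ_iff.2 (Fin.zero_le i)))

/-- Removing the minimum of a chain whose next element is `y` gives a chain of `[y, 1]`. -/
def flagTailEquiv (P : GradedPoset.{v}) (a : ℕ+) (α : List ℕ+) (y : P)
    (hy : P.height y = a) :
    {z : {z : Fin ((a :: α).length + 1) → P // P.IsFlag (a :: α) z} // z.1 1 = y} ≃
      {z : Fin (α.length + 1) → P.interval y ⊤ le_top // (P.interval y ⊤ le_top).IsFlag α z} where
  toFun z := ⟨fun i => ⟨z.1.1 i.succ, z.1.2.le_succ z.2 i, le_top⟩,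
    { strictMono := fun i j hij => z.1.2.strictMono (Fin.succ_lt_succ_iff.2 hij)
      bot := Subtype.ext z.2
      top := Subtype.ext z.1.2.top
      height_succ := fun i => by
        have h1 : P.height (z.1.1 i.succ.succ) = P.height (z.1.1 i.castSucc.succ) + α.get i :=
          z.1.2.height_succ i.succ
        have h3 : ∀ (w : P) (hw : y ≤ w), (P.interval y ⊤ le_top).height ⟨w, hw, le_top⟩ =
          P.height w - P.height y := fun w hw => P.height_interval le_top ⟨w, hw, le_top⟩
        have h2 : P.height y ≤ P.height (z.1.1 i.castSucc.succ) :=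
          P.height_mono (z.1.2.le_succ z.2 _)
        refine (h3 _ (z.1.2.le_succ z.2 _)).trans (Eq.trans ?_
          (congrArg (· + (α.get i : ℕ)) (h3 _ (z.1.2.le_succ z.2 _)).symm))
        omega }⟩
  invFun w := ⟨⟨Fin.cons ⊥ fun i => (w.1 i).1,
    { strictMono := by
        refine Fin.strictMono_iff_lt_succ.2 fun i => ?_
        refine Fin.cases ?_ (fun j => ?_) i
        · have h0 : (w.1 0).1 = y := congrArg Subtype.val w.2.bot
          have : (⊥ : P) < y := bot_lt_iff_ne_bot.2 fun h => by
            rw [h, P.isRankFun_height.bot] at hy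
            exact a.pos.ne hy
          simpa [h0] using this
        · exact w.2.strictMono j.castSucc_lt_succ
      bot := rfl
      top := congrArg Subtype.val w.2.top
      height_succ := by
        refine Fin.cases ?_ fun j => ?_
        · have h0 : (w.1 0).1 = y := congrArg Subtype.val w.2.bot
          have : P.height (w.1 0).1 = P.height ⊥ + a := by
            rw [h0, hy, P.isRankFun_height.bot, zero_add]
          exact this
        · have h1 := w.2.height_succ j
          have h2 := P.height_mono (w.1 j.castSucc).2.1
          have h3 := P.height_mono (w.1 j.succ).2.1
          rw [height_interval, height_interval] at h1
          have : P.height (w.1 j.succ).1 = P.height (w.1 j.castSucc).1 + α.get j := by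
            have := (α.get j).pos
            omega
          exact this }⟩, congrArg Subtype.val w.2.bot⟩
  left_inv z := by
    refine Subtype.ext (Subtype.ext (funext fun i => ?_))
    refine Fin.cases ?_ (fun j => ?_) i
    · exact z.1.2.bot.symm
    · rfl
  right_inv w := rfl

/-- The chains of `P` with first rank `a`, sorted by their first element `z` above the minimum. -/
theorem flagVector_cons (P : GradedPoset.{v}) (a : ℕ+) (α : List ℕ+) :
    P.flagVector (a :: α) = ∑ z : P,
      if P.height z = a then (P.interval z ⊤ le_top).flagVector α else 0 := by
  rw [flagVector_eq, ← Nat.card_congr (Equiv.sigmaFiberEquiv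
    fun z : {z : Fin ((a :: α).length + 1) → P // P.IsFlag (a :: α) z} => z.1 1), Nat.card_sigma]
  refine Finset.sum_congr rfl fun y _ => ?_
  split_ifs with hy
  · rw [flagVector_eq]
    exact Nat.card_congr (flagTailEquiv P a α y hy)
  · refine @Nat.card_of_isEmpty _ ⟨fun z => hy ?_⟩
    have h := z.1.2.height_succ 0
    rw [show z.1.1 (Fin.castSucc 0) = ⊥ from z.1.2.bot, P.isRankFun_height.bot, zero_add] at h
    exact (congrArg P.height z.2).symm.trans h

theorem flagVector_congr {P Q : GradedPoset.{v}} (e : P ≃o Q) (α : List ℕ+) :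
    P.flagVector α = Q.flagVector α := by
  induction α generalizing P Q with
  | nil =>
    rw [flagVector_nil, flagVector_nil]
    refine if_congr ?_ rfl rfl
    rw [← map_bot e, ← map_top e, e.injective.eq_iff]
  | cons a α ih =>
    rw [flagVector_cons, flagVector_cons]
    refine Fintype.sum_equiv e.toEquiv _ _ fun z => ?_
    rw [ih (intervalIso e le_top le_top rfl (map_top e))]
    exact if_congr (by rw [← height_congr e]; rfl) rfl rfl

theorem flagVector_eq_zero {P : GradedPoset.{v}} {α : List ℕ+} (h : QSym.size α ≠ P.rank) :
    P.flagVector α = 0 := by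
  induction α generalizing P with
  | nil =>
    rw [flagVector_nil, if_neg]
    intro hbot
    rw [rank_eq P.isRankFun_height, ← hbot, P.isRankFun_height.bot] at h
    exact h rfl
  | cons a α ih =>
    rw [flagVector_cons]
    refine Finset.sum_eq_zero fun z _ => ?_
    split_ifs with hz
    · refine ih fun h' => h ?_
      rw [QSym.size_cons, h', ← hz, height, rank_interval_add]
    · rfl

/-- A chain with ranks `βγ` passes through a unique element `z` of rank `|β|`. In the sum over all
`z`, the other elements contribute zero. -/
theorem flagVector_append (P : GradedPoset.{v}) (β γ : List ℕ+) :
    P.flagVector (β ++ γ) = ∑ z : P,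
      (P.interval ⊥ z bot_le).flagVector β * (P.interval z ⊤ le_top).flagVector γ := by
  classical
  induction β generalizing P with
  | nil =>
    rw [Finset.sum_eq_single ⊥]
    · rw [flagVector_nil, if_pos (show (⊥ : P.interval ⊥ ⊥ bot_le) = ⊤ from Subtype.ext rfl),
        one_mul, List.nil_append,
        flagVector_congr (P.intervalBotTop le_top rfl rfl)]
    · intro z _ hz
      rw [flagVector_nil, if_neg, zero_mul]
      exact fun h => hz (congrArg Subtype.val h).symm
    · simp
  | cons a β ih =>
    rw [List.cons_append, flagVector_cons]
    simp only [flagVector_cons, ih, Finset.sum_mul, Finset.ite_sum_zero]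
    -- both sides count pairs of elements `w ≤ z`
    rw [Finset.sum_sigma', Finset.sum_sigma']
    refine Finset.sum_bij' (fun p _ => ⟨p.2.1, ⟨p.1, bot_le, p.2.2.1⟩⟩)
      (fun p _ => ⟨p.2.1, ⟨p.1, p.2.2.2, le_top⟩⟩)
      (fun _ _ => Finset.mem_sigma.2 ⟨Finset.mem_univ _, Finset.mem_univ _⟩)
      (fun _ _ => Finset.mem_sigma.2 ⟨Finset.mem_univ _, Finset.mem_univ _⟩)
      (fun _ _ => rfl) (fun _ _ => rfl) ?_
    rintro ⟨w, z⟩ _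
    rw [ite_mul, zero_mul]
    refine if_congr ?_ ?_ rfl
    · rw [height_interval, P.isRankFun_height.bot, Nat.sub_zero]
    · rw [flagVector_congr (intervalInterval le_top bot_le z.2.1 rfl rfl),
        flagVector_congr (intervalInterval le_top le_top le_top rfl rfl),
        flagVector_congr (intervalInterval bot_le le_top z.2.1 rfl rfl)]

end GradedPoset

/-! ### The morphism from Rota's Hopf algebra to the quasi-symmetric functions -/

namespace GradedPoset

variable (k : Type u) [CommRing k]

/-- The quasi-symmetric function `∑_α f_α(P) M_α` of a graded poset. -/
noncomputable def flagQSym (P : GradedPoset.{v}) : QSym k :=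
  ∑ α ∈ QSym.compositions P.rank, (P.flagVector α : k) • QSym.M k α

variable {k}

theorem coeff_flagQSym (P : GradedPoset.{v}) (α : List ℕ+) :
    QSym.coeff (P.flagQSym k) α = P.flagVector α := by
  classical
  simp only [flagQSym, QSym.coeff_sum, QSym.coeff_smul, QSym.coeff_M, mul_ite, mul_one, mul_zero,
    Finset.sum_ite_eq']
  split_ifs with h
  · rfl
  · rw [flagVector_eq_zero (fun h' => h (QSym.mem_compositions.2 h')), Nat.cast_zero]

theorem flagQSym_congr {P Q : GradedPoset.{v}} (e : P ≃o Q) : P.flagQSym k = Q.flagQSym k :=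
  QSym.ext_coeff fun α => by rw [coeff_flagQSym, coeff_flagQSym, flagVector_congr e]

theorem flagQSym_mem_grading (P : GradedPoset.{v}) :
    P.flagQSym k ∈ QSym.grading k P.rank :=
  sum_mem fun α hα => Submodule.smul_mem _ _
    (QSym.mem_compositions.1 hα ▸ QSym.M_mem_grading α)

theorem flagQSym_point : point.{v}.flagQSym k = 1 := by
  refine QSym.ext_coeff fun α => ?_
  have hrank : point.{v}.rank = 0 := GradedPosetClass.rank_one
  rw [coeff_flagQSym, QSym.one_def, QSym.coeff_M]
  rcases α with _ | ⟨a, α⟩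
  · rw [flagVector_nil, if_pos (show (⊥ : point.{v}) = ⊤ from rfl), if_pos rfl, Nat.cast_one]
  · rw [flagVector_eq_zero, if_neg (by simp), Nat.cast_zero]
    have := a.pos
    rw [hrank, QSym.size_cons]
    omega

theorem height_eq_zero_iff (P : GradedPoset.{v}) (z : P) : P.height z = 0 ↔ z = ⊥ := by
  constructor
  · intro h
    by_contra hz
    have := P.isRankFun_height.strictMono (bot_lt_iff_ne_bot.2 hz)
    omega
  · rintro rfl
    exact P.isRankFun_height.bot

theorem headOp_flagQSym (P : GradedPoset.{v}) (c : ℕ) : QSym.headOp k c (P.flagQSym k) =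
    ∑ z : P, if P.height z = c then (P.interval z ⊤ le_top).flagQSym k else 0 := by
  rcases Nat.eq_zero_or_pos c with rfl | hc
  · simp only [height_eq_zero_iff]
    rw [QSym.headOp_zero, Finset.sum_eq_single ⊥]
    · rw [if_pos rfl, flagQSym_congr (P.intervalBotTop le_top rfl rfl)]
    · intro z _ hz
      rw [if_neg hz]
    · simp
  · lift c to ℕ+ using hc
    refine QSym.ext_coeff fun α => ?_
    rw [QSym.coeff_headOp, coeff_flagQSym, flagVector_cons, QSym.coeff_sum, Nat.cast_sum]
    refine Finset.sum_congr rfl fun z _ => ?_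
    split_ifs
    · rw [coeff_flagQSym]
    · rw [QSym.coeff_zero, Nat.cast_zero]

theorem height_prod (P Q : GradedPoset.{v}) (z : P.prod Q) :
    (P.prod Q).height z = P.height z.1 + Q.height z.2 :=
  height_eq (P := P.prod Q) (P.isRankFun_height.prod Q.isRankFun_height) z

/-- The quasi-symmetric function of a product of posets is the product of their quasi-symmetric
functions: taking the coefficient of a power of the first variable is, on both sides, a sum over
the elements of a given rank. -/
theorem flagQSym_prod (P Q : GradedPoset.{v}) :
    (P.prod Q).flagQSym k = P.flagQSym k * Q.flagQSym k := by
  classical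
  refine QSym.ext_coeff fun α => ?_
  induction α generalizing P Q with
  | nil =>
    rw [QSym.coeff_nil k (_ * _), QSym.counitMap_mul, ← QSym.coeff_nil, ← QSym.coeff_nil,
      coeff_flagQSym, coeff_flagQSym, coeff_flagQSym, flagVector_nil, flagVector_nil,
      flagVector_nil]
    have h : (⊥ : P.prod Q) = ⊤ ↔ (⊥ : P) = ⊤ ∧ (⊥ : Q) = ⊤ := Prod.ext_iff
    by_cases h1 : (⊥ : P) = ⊤ <;> by_cases h2 : (⊥ : Q) = ⊤ <;> simp [h, h1, h2]
  | cons c α ih =>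
    have hL : QSym.coeff ((P.prod Q).flagQSym k) (c :: α) = ∑ z : P, ∑ w : Q,
        if P.height z + Q.height w = c then QSym.coeff ((P.interval z ⊤ le_top).flagQSym k *
          (Q.interval w ⊤ le_top).flagQSym k) α else 0 := by
      rw [← QSym.coeff_headOp, headOp_flagQSym, QSym.coeff_sum, ← Fintype.sum_prod_type']
      refine @Fintype.sum_equiv (P.prod Q) (P × Q) _ _ _ _ (Equiv.refl _) _ _ fun z => ?_
      rw [height_prod, apply_ite (fun x => QSym.coeff x α), QSym.coeff_zero]
      exact if_congr Iff.rfl ((congrArg (fun x => QSym.coeff x α) (flagQSym_congr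
        (intervalProd (P := P) (Q := Q) (x := z.1) (x' := z.2) (y := ⊤) (y' := ⊤)
          le_top le_top le_top))).trans (ih _ _)) rfl
    rw [hL, ← QSym.coeff_headOp, QSym.headOp_mul]
    simp only [headOp_flagQSym, Finset.sum_mul_sum, QSym.coeff_sum]
    conv_rhs => rw [Finset.sum_comm]
    refine Finset.sum_congr rfl fun z _ => ?_
    conv_rhs => rw [Finset.sum_comm]
    refine Finset.sum_congr rfl fun w _ => ?_
    have h : ∀ p : ℕ × ℕ, QSym.coeff
        ((if P.height z = p.1 then (P.interval z ⊤ le_top).flagQSym k else 0) *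
        if Q.height w = p.2 then (Q.interval w ⊤ le_top).flagQSym k else 0) α =
        if (P.height z, Q.height w) = p then QSym.coeff ((P.interval z ⊤ le_top).flagQSym k *
          (Q.interval w ⊤ le_top).flagQSym k) α else 0 := by
      rintro ⟨i, j⟩
      by_cases h1 : P.height z = i <;> by_cases h2 : Q.height w = j <;>
        simp [h1, h2, QSym.coeff_zero]
    rw [Finset.sum_congr rfl fun p _ => h p, Finset.sum_ite_eq]
    exact if_congr (by rw [Finset.HasAntidiagonal.mem_antidiagonal]) rfl rfl

theorem comul_flagQSym (P : GradedPoset.{v}) : Coalgebra.comul (R := k) (P.flagQSym k) =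
    ∑ z : P, (P.interval ⊥ z bot_le).flagQSym k ⊗ₜ[k] (P.interval z ⊤ le_top).flagQSym k := by
  refine QSym.ext_pairing fun β γ => ?_
  rw [QSym.pairing_comul, coeff_flagQSym, flagVector_append, map_sum, Nat.cast_sum]
  refine Finset.sum_congr rfl fun z _ => ?_
  rw [pairing_tmul, QSym.lcoeff_apply, QSym.lcoeff_apply, coeff_flagQSym, coeff_flagQSym,
    Nat.cast_mul]

theorem flagVector_singleton (P : GradedPoset.{v}) {a : ℕ+} (ha : (a : ℕ) = P.rank) :
    P.flagVector [a] = 1 := by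
  have hrank := rank_eq P.isRankFun_height
  rw [flagVector_cons, Finset.sum_eq_single ⊤]
  · rw [if_pos (hrank.symm.trans ha.symm), flagVector_nil,
      if_pos (show (⊥ : P.interval ⊤ ⊤ le_top) = ⊤ from Subtype.ext rfl)]
  · intro z _ hz
    rw [if_neg]
    have := P.isRankFun_height.strictMono (lt_top_iff_ne_top.2 hz)
    omega
  · simp

end GradedPoset

namespace QSym

variable {k : Type*} [CommRing k]

/-- The canonical character reads off the coefficient of the one-part composition. -/
theorem zeta_eq_coeff {x : QSym k} {a : ℕ+} (hx : x ∈ grading k a) : zeta k x = coeff x [a] := by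
  rw [eq_sum_compositions hx, map_sum, coeff_sum]
  refine Finset.sum_congr rfl fun α hα => ?_
  rw [map_smul, zeta_M, coeff_smul, coeff_M, smul_eq_mul]
  congr 1
  refine if_congr ⟨fun h => ?_, fun h => by rw [h]; simp⟩ rfl rfl
  refine eq_singleton_of_size (mem_compositions.1 hα) (le_antisymm h ?_)
  by_contra hlt
  have h0 : α = [] := List.length_eq_zero_iff.1 (by omega)
  have := mem_compositions.1 hα
  rw [h0] at this
  exact a.pos.ne this

end QSym

namespace Rota

variable (k : Type u) [CommRing k]

/-- The morphism of algebras `P ↦ ∑_α f_α(P) M_α`. -/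
noncomputable def flagAlgHom : Rota.{u, v} k →ₐ[k] QSym k :=
  lift k
    { toFun := Quotient.lift (GradedPoset.flagQSym k) fun _ _ ⟨e⟩ => GradedPoset.flagQSym_congr e
      map_one' := GradedPoset.flagQSym_point
      map_mul' := GradedPosetClass.ind fun P => GradedPosetClass.ind fun Q =>
        GradedPoset.flagQSym_prod P Q }

theorem flagAlgHom_of (P : GradedPoset.{v}) : flagAlgHom k (of k P) = P.flagQSym k := lift_of _ P

/-- The morphism of Hopf algebras `P ↦ ∑_α f_α(P) M_α`. -/
noncomputable def flagBialgHom : Rota.{u, v} k →ₐc[k] QSym k :=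
  BialgHom.ofAlgHom (flagAlgHom k)
    (algHom_ext_of fun P => by
      change Coalgebra.counit (R := k) (flagAlgHom k (of k P)) = Coalgebra.counit (R := k) (of k P)
      rw [flagAlgHom_of, QSym.counit_eq_coeff, GradedPoset.coeff_flagQSym,
        GradedPoset.flagVector_nil, counit_of]
      split_ifs <;> simp)
    (algHom_ext_of fun P => by
      change Algebra.TensorProduct.map _ _ (Coalgebra.comul (R := k) (of k P)) =
        Coalgebra.comul (R := k) (flagAlgHom k (of k P))
      rw [flagAlgHom_of, GradedPoset.comul_flagQSym, comul_of, map_sum]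
      simp only [Algebra.TensorProduct.map_tmul, flagAlgHom_of])

theorem flagBialgHom_of (P : GradedPoset.{v}) : flagBialgHom k (of k P) = P.flagQSym k :=
  flagAlgHom_of k P

variable {k}

theorem induction_of {p : Rota.{u, v} k → Prop} (x : Rota.{u, v} k) (zero : p 0)
    (add : ∀ x y, p x → p y → p (x + y)) (smul : ∀ (r : k) x, p x → p (r • x))
    (of : ∀ P, p (of k P)) : p x := by
  have hx : x ∈ Submodule.span k (Set.range (basis k)) := (basis k).mem_span x
  induction hx using Submodule.span_induction with
  | mem x h =>
    obtain ⟨c, rfl⟩ := h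
    induction c using GradedPosetClass.ind with | h P
    exact of P
  | zero => exact zero
  | add x y _ _ h1 h2 => exact add x y h1 h2
  | smul r x _ h => exact smul r x h

theorem flagBialgHom_mem_grading {n : ℕ} {x : Rota.{u, v} k} (hx : x ∈ grading k n) :
    flagBialgHom k x ∈ QSym.grading k n := by
  have : grading k n ≤ (QSym.grading k n).comap (flagAlgHom k).toLinearMap := by
    refine Submodule.span_le.2 ?_
    rintro _ ⟨c, rfl, rfl⟩
    induction c using GradedPosetClass.ind with | h P
    change flagAlgHom k (of k P) ∈ QSym.grading k P.rank
    rw [flagAlgHom_of]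
    exact P.flagQSym_mem_grading
  exact this hx

theorem zeta_flagBialgHom (x : Rota.{u, v} k) : QSym.zeta k (flagBialgHom k x) = zeta k x := by
  have : (QSym.zeta k).comp (flagAlgHom k) = zeta.{u, v} k := algHom_ext_of fun P => by
    rw [AlgHom.comp_apply, flagAlgHom_of, zeta_of]
    rcases Nat.eq_zero_or_pos P.rank with h | h
    · have e := GradedPoset.isoPoint (GradedPoset.bot_eq_top_of_rank_eq_zero h)
      rw [GradedPoset.flagQSym_congr e, GradedPoset.flagQSym_point, map_one]
    · obtain ⟨a, ha⟩ : ∃ a : ℕ+, (a : ℕ) = P.rank := ⟨⟨P.rank, h⟩, rfl⟩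
      rw [QSym.zeta_eq_coeff (ha ▸ P.flagQSym_mem_grading), GradedPoset.coeff_flagQSym,
        P.flagVector_singleton ha, Nat.cast_one]
  exact congr($this x)

/-- A morphism of combinatorial Hopf algebras is determined by the characters: the coefficient of
`M_{(a, α)}` in `Ψ(P)` is obtained from `Δ(Ψ(P)) = ∑ Ψ[0, z] ⊗ Ψ[z, 1]` by applying the part of
degree `a` of the canonical character to the first factor. -/
theorem eq_flagQSym (Ψ : Rota.{u, v} k →ₐc[k] QSym k)
    (hΨ : ∀ n, ∀ x ∈ grading k n, Ψ x ∈ QSym.grading k n)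
    (hζ : ∀ x, QSym.zeta k (Ψ x) = zeta k x) (P : GradedPoset.{v}) :
    Ψ (of k P) = P.flagQSym k := by
  refine QSym.ext_coeff fun α => ?_
  rw [GradedPoset.coeff_flagQSym]
  induction α generalizing P with
  | nil =>
    rw [← QSym.counit_eq_coeff, CoalgHomClass.counit_comp_apply, counit_of,
      GradedPoset.flagVector_nil]
    split_ifs <;> simp
  | cons a α ih =>
    have h : ∀ z : P, QSym.coeff (Ψ (of k (P.interval ⊥ z bot_le))) [a] =
        if P.height z = a then 1 else 0 := fun z => by
      have hz := hΨ _ _ (of_mem_grading (k := k) (P.interval ⊥ z bot_le))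
      split_ifs with hz'
      · rw [← QSym.zeta_eq_coeff (hz' ▸ hz), hζ, zeta_of]
      · refine QSym.mem_grading_iff.1 hz _ fun h => hz' ?_
        rw [GradedPoset.height, ← h]
        simp [QSym.size]
    rw [← List.singleton_append, ← QSym.pairing_comul, ← CoalgHomClass.map_comp_comul_apply Ψ,
      comul_of, map_sum, map_sum, List.singleton_append, GradedPoset.flagVector_cons, Nat.cast_sum]
    refine Finset.sum_congr rfl fun z _ => ?_
    rw [TensorProduct.map_tmul, pairing_tmul]
    refine (congrArg₂ (· * ·) (h z) (ih (P.interval z ⊤ le_top))).trans ?_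
    split_ifs <;> simp

end Rota

/-! ### The Bayer-Billera relations -/

/-- The relations hold over `ℚ`, since the quasi-symmetric function of an eulerian poset belongs
to the odd subalgebra; the flag `f`-vector consists of integers. -/
theorem GradedPoset.IsEulerian.bayerBillera_eq_zero {P : GradedPoset.{v}} (hP : P.IsEulerian)
    {α : List ℕ+} (hα : QSym.size α = P.rank) (i : Fin α.length) :
    QSym.bayerBillera (fun β => (P.flagVector β : ℤ)) α i = 0 := by
  have h1 : P.flagQSym ℚ ∈ oddSubalgebra (QSym.grading ℚ) (QSym.zeta ℚ) := by
    rw [← Rota.flagBialgHom_of]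
    exact map_mem_oddSubalgebra (Rota.grading ℚ) (QSym.grading ℚ) (Rota.flagBialgHom ℚ)
      (fun _ _ => Rota.flagBialgHom_mem_grading) Rota.zeta_flagBialgHom
      (Rota.eulerianSubspace_le_oddSubalgebra ℚ (Rota.of_mem_eulerianSubspace hP))
  have h2 : ∀ α : List ℕ+, QSym.size α = P.rank → ∀ i : Fin α.length,
      QSym.bayerBillera (P.flagQSym ℚ).coeff α i = 0 :=
    ((QSym.oddSubalgebra_tfae P.flagQSym_mem_grading).out 0 4).1 h1
  have h3 : ((QSym.bayerBillera (fun β => (P.flagVector β : ℤ)) α i : ℤ) : ℚ) =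
      QSym.bayerBillera (P.flagQSym ℚ).coeff α i := by
    simp only [QSym.bayerBillera, GradedPoset.coeff_flagQSym]
    push_cast
    rfl
  exact_mod_cast h3.trans (h2 α hα i)

theorem mainTheorem11 (k : Type u) [Field k] :
    -- the values of the two functionals on the monomial basis
    (∀ β : List ℕ+, dehnSommervilleFunctional (QSym.grading k) (QSym.zeta k) (QSym.M k β) =
      if β.length = 0 then 0
      else if β.length = 1 then (-1) ^ QSym.size β + 1
      else -(-1) ^ β.length) ∧
    (∀ β : List ℕ+, eulerFunctional (QSym.grading k) (QSym.zeta k) (QSym.M k β) =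
      match β with
      | [n] => 1 + (-1) ^ (n : ℕ)
      | [i, _] => (-1) ^ (i : ℕ)
      | _ => 0) ∧
    -- the generalized Dehn-Sommerville relations of `QSym`
    (∀ (n : ℕ) (h : QSym k), h ∈ QSym.grading k n →
      applyMiddle (dehnSommervilleFunctional (QSym.grading k) (QSym.zeta k)) h =
        ∑ α ∈ QSym.compositions n, ∑ i : Fin α.length, QSym.dehnSommerville h.coeff α i •
          (QSym.M k (α.take i) ⊗ₜ[k] QSym.M k (α.drop (i + 1))) ∧
      applyMiddle (eulerFunctional (QSym.grading k) (QSym.zeta k)) h =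
        ∑ α ∈ QSym.compositions n, ∑ i : Fin α.length, QSym.bayerBillera h.coeff α i •
          (QSym.M k (α.take i) ⊗ₜ[k] QSym.M k (α.drop (i + 1))) ∧
      List.TFAE [
        h ∈ oddSubalgebra (QSym.grading k) (QSym.zeta k),
        applyMiddle (dehnSommervilleFunctional (QSym.grading k) (QSym.zeta k)) h = 0,
        applyMiddle (eulerFunctional (QSym.grading k) (QSym.zeta k)) h = 0,
        ∀ α : List ℕ+, QSym.size α = n → ∀ i : Fin α.length,
          QSym.dehnSommerville h.coeff α i = 0,
        ∀ α : List ℕ+, QSym.size α = n → ∀ i : Fin α.length,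
          QSym.bayerBillera h.coeff α i = 0]) ∧
    -- eulerian posets belong to the odd subalgebra of Rota's Hopf algebra
    Rota.eulerianSubspace.{u, v} k ≤ oddSubalgebra (Rota.grading k) (Rota.zeta k) ∧
    -- there is a unique morphism of combinatorial Hopf algebras; it is given by the flag
    -- `f`-vector, and preserves the odd subalgebras
    (∃! Ψ : Rota.{u, v} k →ₐc[k] QSym k,
      (∀ n, ∀ x ∈ Rota.grading k n, Ψ x ∈ QSym.grading k n) ∧
      ∀ x, QSym.zeta k (Ψ x) = Rota.zeta k x) ∧
    (∀ Ψ : Rota.{u, v} k →ₐc[k] QSym k,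
      (∀ n, ∀ x ∈ Rota.grading k n, Ψ x ∈ QSym.grading k n) →
      (∀ x, QSym.zeta k (Ψ x) = Rota.zeta k x) →
      (∀ P : GradedPoset.{v}, Ψ (Rota.of k P) =
        ∑ α ∈ QSym.compositions P.rank, (P.flagVector α : k) • QSym.M k α) ∧
      (∀ x ∈ oddSubalgebra (Rota.grading k) (Rota.zeta k),
        Ψ x ∈ oddSubalgebra (QSym.grading k) (QSym.zeta k)) ∧
      ∀ x ∈ Rota.eulerianSubspace k, Ψ x ∈ oddSubalgebra (QSym.grading k) (QSym.zeta k)) ∧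
    -- the flag `f`-vector of an eulerian poset satisfies the Bayer-Billera relations
    (∀ P : GradedPoset.{v}, P.IsEulerian → ∀ α : List ℕ+, QSym.size α = P.rank →
      ∀ i : Fin α.length, QSym.bayerBillera (fun β => (P.flagVector β : ℤ)) α i = 0) := by
  refine ⟨QSym.dehnSommervilleFunctional_M, fun β => ?_, fun n h hh =>
    ⟨QSym.applyMiddle_dehnSommervilleFunctional hh, QSym.applyMiddle_eulerFunctional hh,
      QSym.oddSubalgebra_tfae hh⟩, Rota.eulerianSubspace_le_oddSubalgebra k, ?_, ?_,
    fun P hP α hα i => hP.bayerBillera_eq_zero hα i⟩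
  · match β with
    | [] => exact QSym.eulerFunctional_M_nil
    | [n] => exact QSym.eulerFunctional_M_singleton n
    | [i, j] => exact QSym.eulerFunctional_M_pair i j
    | a :: b :: c :: β => exact QSym.eulerFunctional_M_of_two_lt_length (by simp)
  · refine ⟨Rota.flagBialgHom k, ⟨fun _ _ => Rota.flagBialgHom_mem_grading,
      Rota.zeta_flagBialgHom⟩, fun Ψ hΨ => BialgHom.ext fun x => ?_⟩
    induction x using Rota.induction_of with
    | zero => rw [map_zero, map_zero]
    | add x y hx hy => rw [map_add, map_add, hx, hy]
    | smul r x hx => rw [map_smul, map_smul, hx]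
    | of P => rw [Rota.eq_flagQSym Ψ hΨ.1 hΨ.2, Rota.flagBialgHom_of]
  · intro Ψ hΨ hζ
    have hodd : ∀ x ∈ oddSubalgebra (Rota.grading k) (Rota.zeta k),
        Ψ x ∈ oddSubalgebra (QSym.grading k) (QSym.zeta k) := fun x hx =>
      map_mem_oddSubalgebra (Rota.grading k) (QSym.grading k) Ψ hΨ hζ hx
    exact ⟨Rota.eq_flagQSym Ψ hΨ hζ, hodd,
      fun x hx => hodd x (Rota.eulerianSubspace_le_oddSubalgebra k hx)⟩
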